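/- Let $\mathbb{D}=\{|w|<1\}$, $\mathbb{D}^*=\{|w|>1\}$, $S^1=\{|w|=1\}$. Let $\mathfrak{D}$ be the space of pairs $(f,g)$ such that * $f$ is holomorphic on $\mathbb{D}$ with $f(0)=0$, and it is the restriction of a $C^1$ homeomorphism of the Riemann sphere $\hat{\mathbb{C}}$ (with $C^1$ inverse) that is finite on $\overline{\mathbb{D}}$; * $g$ is holomorphic on $\mathbb{D}^*$, and it is the restriction of a $C^1$ homeomorphism of $\hat{\mathbb{C}}$ (with $C^1$ inverse) that fixes $\infty$ and does not vanish on $\overline{\mathbb{D}^*}$; * $f'(0)\,g'(\infty)=1$, where $g'(\infty)=\lim_{w\to\infty}g(w)/w$. Write $f,g$ also for the boundary values on $S^1$. The time variables are the functions on $\mathfrak{D}$ given, for $m\ge 1$, by $$t_m=\frac{1}{2\pi i\,m}\oint_{S^1}\frac{g^{-m}}{f}\,dg,\qquad t_{-m}=\frac{-1}{2\pi i\,m}\oint_{S^1} g\,f^{m-2}\,df,\qquad t_0=\frac{1}{2\pi i}\oint_{S^1}\frac{1}{f}\,dg .$$ Partial derivatives with respect to $t_n$ ($n\in\mathbb{Z}$)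 are understood as follows. A curve through $p=(f,g)\in\mathfrak{D}$ is a map $s\mapsto(f_s,g_s)\in\mathfrak{D}$ of a complex parameter $s$ with $(f_0,g_0)=p$ such that, as $s\to0$, the boundary values of $f_s,g_s$ converge to those of $f,g$ in $C^1(S^1)$ and the difference quotients $(f_s-f)/s$, $(g_s-g)/s$ converge in $L^2(S^1)$. It is a curve in the direction $t_n$ if $\frac{d}{ds}\big|_{s=0}t_m(f_s,g_s)=\delta_{m,n}$ for all $m\in\mathbb{Z}$. For a function $\Phi$ on $\mathfrak{D}$, $\frac{\partial\Phi}{\partial t_n}(p)=d$ means that curves through $p$ in the direction $t_n$ exist and that along every one of them $\Phi$ has complex derivative $d$ at $s=0$. Put $\mathcal{L}(w)=g(w)$ for $w\in\mathbb{D}^*$, $\tilde{\mathcal{L}}(w)=f(w)$ for $w\in\mathbb{D}$, and for $n\ge1$ $$\mathcal{B}_n=(\mathcal{L}^n)_{>0}+\tfrac12(\mathcal{L}^n)_0,\qquad \tilde{\mathcal{B}}_n=(\tilde{\mathcal{L}}^{-n})_{<0}+\tfrac12(\tilde{\mathcal{L}}^{-n})_0,$$ where $(\cdot)_S$ keeps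 the powers $w^k$, $k\in S$, of the Laurent expansion at $\infty$ (for $\mathcal{L}$), respectively at $0$ (for $\tilde{\mathcal{L}}$). Let $$\{A,B\}_T=w\frac{\partial A}{\partial w}\frac{\partial B}{\partial t_0}-w\frac{\partial A}{\partial t_0}\frac{\partial B}{\partial w}.$$ **Theorem.** At every point of $\mathfrak{D}$ and for every $n\ge1$, the pair $(\mathcal{L},\tilde{\mathcal{L}})=(g,f)$ satisfies the Lax equations of the dispersionless Toda hierarchy $$\frac{\partial\mathcal{L}}{\partial t_n}=\{\mathcal{B}_n,\mathcal{L}\}_T,\quad \frac{\partial\mathcal{L}}{\partial t_{-n}}=\{\tilde{\mathcal{B}}_n,\mathcal{L}\}_T\qquad (|w|>1),$$ $$\frac{\partial\tilde{\mathcal{L}}}{\partial t_n}=\{\mathcal{B}_n,\tilde{\mathcal{L}}\}_T,\quad \frac{\partial\tilde{\mathcal{L}}}{\partial t_{-n}}=\{\tilde{\mathcal{B}}_n,\tilde{\mathcal{L}}\}_T\qquad (0<|w|<1),$$ where all the partial derivatives occurring (with respect to $t_0$ and $t_{\pm n}$) exist. -/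

import Mathlib

open Filter Topology MeasureTheory
open scoped OnePoint

noncomputable section

namespace DToda

/-! ### Diffeomorphisms of class `C¹` of the Riemann sphere `ℂ ∪ {∞}` -/

/-- The inversion `z ↦ 1 / z` of the Riemann sphere, exchanging `0` and `∞`. -/
def sphereInv (x : OnePoint ℂ) : OnePoint ℂ :=
  x.elim ((0 : ℂ) : OnePoint ℂ) (fun z : ℂ => if z = 0 then ∞ else ((z⁻¹ : ℂ) : OnePoint ℂ))

/-- The standard coordinate of the Riemann sphere on `ℂ` (it is only used away from `∞`). -/
def sphereCoord (x : OnePoint ℂ) : ℂ :=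
  x.elim 0 (fun z : ℂ => z)

/-- A self-map of the Riemann sphere is of class `C¹` (in the real sense): it is so in the two
standard charts `z` and `1 / z`, at the source and at the target. -/
def IsC1 (F : OnePoint ℂ → OnePoint ℂ) : Prop :=
  ∀ σ ∈ ({id, sphereInv} : Set (OnePoint ℂ → OnePoint ℂ)),
  ∀ τ ∈ ({id, sphereInv} : Set (OnePoint ℂ → OnePoint ℂ)),
  ∀ z : ℂ, τ (F (σ (z : OnePoint ℂ))) ≠ ∞ →
    ContDiffAt ℝ 1 (fun ζ : ℂ => sphereCoord (τ (F (σ (ζ : OnePoint ℂ))))) z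

/-- A homeomorphism of the Riemann sphere that is of class `C¹` together with its inverse. -/
def IsC1Homeo (F : OnePoint ℂ ≃ₜ OnePoint ℂ) : Prop :=
  IsC1 F ∧ IsC1 F.symm

/-! ### The space of normalized pairs of conformal maps -/

/-- The space `𝔇` of pairs `(f, g)` of conformal maps. The map `f` is meant on the closed unit
disc and `g` on the closed exterior `1 ≤ ‖w‖`; their values elsewhere are irrelevant. Both are
restrictions of `C¹` homeomorphisms of the sphere (which makes them injective), with
`f(0) = 0`, `g(∞) = ∞`, `f` finite, `g` nonzero, and `f'(0) g'(∞) = 1`. -/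
structure ConformalPair where
  f : ℂ → ℂ
  g : ℂ → ℂ
  f_holo : DifferentiableOn ℂ f {w | ‖w‖ < 1}
  f_ext : ∃ F : OnePoint ℂ ≃ₜ OnePoint ℂ, IsC1Homeo F ∧
    ∀ w : ℂ, ‖w‖ ≤ 1 → F (w : OnePoint ℂ) = (f w : OnePoint ℂ)
  f_zero : f 0 = 0
  g_holo : DifferentiableOn ℂ g {w | 1 < ‖w‖}
  g_ext : ∃ G : OnePoint ℂ ≃ₜ OnePoint ℂ, IsC1Homeo G ∧ G ∞ = ∞ ∧
    ∀ w : ℂ, 1 ≤ ‖w‖ → G (w : OnePoint ℂ) = (g w : OnePoint ℂ)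
  g_ne_zero : ∀ w : ℂ, 1 ≤ ‖w‖ → g w ≠ 0
  normalized : ∃ b : ℂ, Tendsto (fun w => g w / w) (Bornology.cobounded ℂ) (𝓝 b) ∧ deriv f 0 * b = 1

/-- The boundary values `θ ↦ f(e^{iθ})`. -/
def ConformalPair.fb (p : ConformalPair) (θ : ℝ) : ℂ := p.f (circleMap 0 1 θ)

/-- The boundary values `θ ↦ g(e^{iθ})`. -/
def ConformalPair.gb (p : ConformalPair) (θ : ℝ) : ℂ := p.g (circleMap 0 1 θ)

/-- The line integral `(1 / 2πi) ∮_{S¹} φ dγ`, all functions on the circle being written in terms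
of the angle `θ`. -/
def lineIntegral (φ γ : ℝ → ℂ) : ℂ :=
  (2 * Real.pi * Complex.I)⁻¹ * ∫ θ in (0 : ℝ)..2 * Real.pi, φ θ * deriv γ θ

/-- The time variables: for `m ≥ 1`,
`t_m = (1 / 2πim) ∮ g^{-m} / f dg`, `t_{-m} = (-1 / 2πim) ∮ g f^{m-2} df`,
and `t_0 = (1 / 2πi) ∮ 1 / f dg`. -/
def time (n : ℤ) (p : ConformalPair) : ℂ :=
  if n = 0 then lineIntegral (fun θ => 1 / p.fb θ) p.gb
  else if 0 < n then (n : ℂ)⁻¹ * lineIntegral (fun θ => p.gb θ ^ (-n) / p.fb θ) p.gb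
  else (n : ℂ)⁻¹ * lineIntegral (fun θ => p.gb θ * p.fb θ ^ (-n - 2)) p.fb

/-! ### Partial derivatives with respect to the time variables -/

/-- The restriction of Lebesgue measure to one period of the angle. -/
def angleMeasure : Measure ℝ := volume.restrict (Set.Ioc 0 (2 * Real.pi))

/-- Convergence in `C¹(S¹)` of functions of the angle. -/
def TendstoC1 (u : ℂ → ℝ → ℂ) (u₀ : ℝ → ℂ) : Prop :=
  TendstoUniformly u u₀ (𝓝 0) ∧ TendstoUniformly (fun s => deriv (u s)) (deriv u₀) (𝓝 0)

/-- The family `u s` of functions of the angle is complex differentiable at `s = 0` in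
`L²(S¹)`. -/
def DifferentiableL2 (u : ℂ → ℝ → ℂ) : Prop :=
  ∃ φ : ℝ → ℂ, MemLp φ 2 angleMeasure ∧
    Tendsto (fun s : ℂ => eLpNorm (fun θ => (u s θ - u 0 θ) / s - φ θ) 2 angleMeasure)
      (𝓝[≠] 0) (𝓝 0)

/-- `c` is a complex curve in `𝔇` through `p = c 0`, which at `s = 0` is continuous for the `C¹`
topology of the boundary values and has a velocity in `L²(S¹)`. -/
def IsCurveThrough (p : ConformalPair) (c : ℂ → ConformalPair) : Prop :=
  c 0 = p ∧
  TendstoC1 (fun s => (c s).fb) p.fb ∧ TendstoC1 (fun s => (c s).gb) p.gb ∧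
  DifferentiableL2 (fun s => (c s).fb) ∧ DifferentiableL2 (fun s => (c s).gb)

/-- A curve through `p` in the direction of the coordinate `t_n`: at `s = 0` the coordinate `t_n`
moves with velocity `1`, and every other `t_m` with velocity `0`. -/
def IsTimeCurve (n : ℤ) (p : ConformalPair) (c : ℂ → ConformalPair) : Prop :=
  IsCurveThrough p c ∧
  ∀ m : ℤ, HasDerivAt (fun s => time m (c s)) (if m = n then 1 else 0) 0

/-- `∂Φ/∂t_n = d` at `p`: there are curves through `p` in the direction of `t_n`, and along every
one of them `Φ` has derivative `d`. -/
def HasTimeDeriv (n : ℤ) (Φ : ConformalPair → ℂ) (p : ConformalPair) (d : ℂ) : Prop :=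
  (∃ c, IsTimeCurve n p c) ∧ ∀ c, IsTimeCurve n p c → HasDerivAt (fun s => Φ (c s)) d 0

/-- `∂Φ/∂t_n` exists at `p`. -/
def TimeDifferentiable (n : ℤ) (Φ : ConformalPair → ℂ) (p : ConformalPair) : Prop :=
  ∃ d, HasTimeDeriv n Φ p d

theorem HasTimeDeriv.unique {n : ℤ} {Φ : ConformalPair → ℂ} {p : ConformalPair} {d e : ℂ}
    (hd : HasTimeDeriv n Φ p d) (he : HasTimeDeriv n Φ p e) : d = e := by
  obtain ⟨⟨c, hc⟩, h⟩ := hd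
  exact (h c hc).unique (he.2 c hc)

open Classical in
/-- The partial derivative `∂Φ/∂t_n` at `p` (and `0` if it does not exist). -/
def timeDeriv (n : ℤ) (Φ : ConformalPair → ℂ) (p : ConformalPair) : ℂ :=
  if h : TimeDifferentiable n Φ p then h.choose else 0

theorem HasTimeDeriv.timeDeriv_eq {n : ℤ} {Φ : ConformalPair → ℂ} {p : ConformalPair} {d : ℂ}
    (hd : HasTimeDeriv n Φ p d) : timeDeriv n Φ p = d := by
  have h : TimeDifferentiable n Φ p := ⟨d, hd⟩
  rw [timeDeriv, dif_pos h]
  exact h.choose_spec.unique hd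

/-! ### The dispersionless Toda hierarchy -/

/-- The coefficient of `w^k` in the Laurent series of a function on a one-sided neighbourhood of
the unit circle, continuous up to the circle. -/
def laurentCoeff (φ : ℂ → ℂ) (k : ℤ) : ℂ :=
  (2 * Real.pi * Complex.I)⁻¹ * ∮ w in C(0, 1), φ w * w ^ (-k - 1)

/-- The Lax function `𝓛 = g`. -/
def lax (p : ConformalPair) (w : ℂ) : ℂ := p.g w

/-- The Lax function `𝓛̃ = f`. -/
def laxTilde (p : ConformalPair) (w : ℂ) : ℂ := p.f w

/-- `𝓑_n = (𝓛^n)_{>0} + (1/2) (𝓛^n)_0`; the power series `𝓛^n` has no powers of `w` above `n`. -/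
def laxB (n : ℕ) (p : ConformalPair) (w : ℂ) : ℂ :=
  (∑ k ∈ Finset.Icc 1 n, laurentCoeff (fun v => lax p v ^ n) (k : ℤ) * w ^ k)
    + 1 / 2 * laurentCoeff (fun v => lax p v ^ n) 0

/-- `𝓑̃_n = (𝓛̃^{-n})_{<0} + (1/2) (𝓛̃^{-n})_0`; the power series `𝓛̃^{-n}` has no powers of `w`
below `-n`. -/
def laxBTilde (n : ℕ) (p : ConformalPair) (w : ℂ) : ℂ :=
  (∑ k ∈ Finset.Icc 1 n, laurentCoeff (fun v => (laxTilde p v ^ n)⁻¹) (-(k : ℤ)) * w ^ (-(k : ℤ)))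
    + 1 / 2 * laurentCoeff (fun v => (laxTilde p v ^ n)⁻¹) 0

/-- The Poisson bracket `{A, B}_T = w ∂A/∂w ∂B/∂t_0 - w ∂A/∂t_0 ∂B/∂w`. -/
def poisson (A B : ConformalPair → ℂ → ℂ) (p : ConformalPair) (w : ℂ) : ℂ :=
  w * deriv (A p) w * timeDeriv 0 (fun q => B q w) p
    - w * timeDeriv 0 (fun q => A q w) p * deriv (B p) w

/-- The Lax equation `∂L/∂t_n = {B, L}_T` at the pair `p` and the point `w`, including the
existence of the derivatives with respect to `t_0` and `t_n` that occur in it. -/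
def LaxEquation (n : ℤ) (B L : ConformalPair → ℂ → ℂ) (p : ConformalPair) (w : ℂ) : Prop :=
  TimeDifferentiable 0 (fun q => B q w) p ∧ TimeDifferentiable 0 (fun q => L q w) p ∧
    HasTimeDeriv n (fun q => L q w) p (poisson B L p w)

end DToda

end

/-! Replace `g` by `ginv`, that is `ζ ↦ 1 / g(1/ζ)`. A conformal pair becomes two disc maps with the
same derivative at `0`, one read on the circle with sign `ε = 1`, the other with `ε = -1`, and most
lemmas treat both signs at once.

Let a curve have boundary velocities `φ` of `f` and `γ` of `g`, and let primes on the circle denote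
`d/dθ`. After an integration by parts, every `δ t_m` is a constant times the mean of a weight
(`g^{-m}` for `m ≥ 0`, `f^{-m}` for `m < 0`) against one and the same density `X = -i (γ f' - φ g')
/ f²` (`hasDerivAt_time`). The weights are the powers of two disc maps. Since polynomials in a disc
map are rich enough to recover the powers of the coordinate
(`IsDiscMap.integral_mul_circ_pow_eq_zero`, via Cauchy–Pompeiu), the numbers `δ t_m` determine `X`
in `L²` (`ae_eq_zero_of_timePairing`). A residue computation finds the dual densities: `1` for
`t_0`, and `w ∂_w` of the Hamiltonian `𝓑_n` or `𝓑̃_n`, restricted to the circle, for `t_n` or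
`t_{-n}` (`IsDiscMap.fc_pow_mul_hamDeriv`).

Write `φ = -i f' v` and `-γ / g² = -i (1/g)' u`. Then `v` has only frequencies `≥ 0` and `u` only
frequencies `≤ 0`, and `f'(0) g'(∞) = 1` says that their constant terms are opposite. Moreover `u -
v = R X` with `R = densityRatio`. Such a balanced splitting exists and is unique
(`exists_balancedSplit`, `BalancedSplit.unique`), so the velocity in a time direction is determined.
Curves realizing it come from adding Taylor polynomials of slowly growing degree (`exists_curve`).

Now let `(u, v)` split `R`, the case of `t_0`, and let `H = w ∂_w 𝓑` be a dual density. The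
splitting of `R H` is `(H u - β, H v - β)` with `β = ∂𝓑/∂t_0`: this choice removes the forbidden
frequencies, and the factor `1/2` in `𝓑` is exactly what balances the constant terms
(`balanced_correction`). Multiplying by `w ∂_w f` gives `∂f/∂t_n = w ∂_w 𝓑 · ∂f/∂t_0 - ∂𝓑/∂t_0 · w
∂_w f` on the circle, and likewise for `g`. Comparison of Laurent series carries this into the disc
and into the exterior (`IsDiscMap.cauchyExt_correction`). -/

noncomputable section

namespace DToda

/-! ### Fourier coefficients of functions of the angle -/

/-- The `n`-th power of the coordinate on the unit circle, as a function of the angle. -/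
def circ (n : ℤ) (θ : ℝ) : ℂ := circleMap 0 1 θ ^ n

theorem circleMap_zero_one_ne_zero (θ : ℝ) : circleMap 0 1 θ ≠ 0 :=
  circleMap_ne_center one_ne_zero

theorem circ_ne_zero (n : ℤ) (θ : ℝ) : circ n θ ≠ 0 :=
  zpow_ne_zero _ (circleMap_zero_one_ne_zero θ)

theorem norm_circ (n : ℤ) (θ : ℝ) : ‖circ n θ‖ = 1 := by
  simp [circ]

theorem circ_add (m n : ℤ) (θ : ℝ) : circ (m + n) θ = circ m θ * circ n θ :=
  zpow_add₀ (circleMap_zero_one_ne_zero θ) m n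

theorem circ_neg (n : ℤ) (θ : ℝ) : circ (-n) θ = (circ n θ)⁻¹ := zpow_neg _ _

theorem circ_zero (θ : ℝ) : circ 0 θ = 1 := zpow_zero _

theorem circ_one (θ : ℝ) : circ 1 θ = circleMap 0 1 θ := zpow_one _

theorem circ_mul (m n : ℤ) (θ : ℝ) : circ (m * n) θ = circ m θ ^ n := zpow_mul _ m n

theorem circ_eq_exp (n : ℤ) (θ : ℝ) : circ n θ = Complex.exp (n * (θ * Complex.I)) := by
  rw [Complex.exp_int_mul]; simp [circ, circleMap]

theorem circ_periodic (n : ℤ) : Function.Periodic (circ n) (2 * Real.pi) := fun θ => by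
  simp only [circ, periodic_circleMap 0 1 θ]

theorem hasDerivAt_circ (n : ℤ) (θ : ℝ) :
    HasDerivAt (circ n) (n * Complex.I * circ n θ) θ := by
  have h : HasDerivAt (fun θ : ℝ => Complex.exp (n * (θ * Complex.I)))
      (Complex.exp (n * (θ * Complex.I)) * (n * (1 * Complex.I))) θ :=
    (((Complex.ofRealCLM.hasDerivAt (x := θ)).mul_const Complex.I).const_mul (n : ℂ)).cexp
  have h2 : circ n = fun θ : ℝ => Complex.exp (n * (θ * Complex.I)) := funext (circ_eq_exp n)
  rw [circ_eq_exp, h2]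
  convert h using 1
  ring

theorem continuous_circ (n : ℤ) : Continuous (circ n) :=
  continuous_iff_continuousAt.2 fun θ => (hasDerivAt_circ n θ).continuousAt

instance : IsFiniteMeasure angleMeasure := by
  unfold angleMeasure; infer_instance

theorem intervalIntegral_eq_angleMeasure (φ : ℝ → ℂ) :
    ∫ θ in (0 : ℝ)..2 * Real.pi, φ θ = ∫ θ, φ θ ∂angleMeasure :=
  intervalIntegral.integral_of_le (by positivity)

theorem ae_mem_angle : ∀ᵐ θ ∂angleMeasure, θ ∈ Set.Icc 0 (2 * Real.pi) := by
  unfold angleMeasure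
  filter_upwards [ae_restrict_mem measurableSet_Ioc] with θ hθ using Set.Ioc_subset_Icc_self hθ

theorem memLp_of_continuous {φ : ℝ → ℂ} (hφ : Continuous φ) (p : ENNReal) :
    MemLp φ p angleMeasure := by
  obtain ⟨C, hC⟩ := (isCompact_Icc (a := (0 : ℝ)) (b := 2 * Real.pi)).exists_bound_of_continuousOn
    hφ.continuousOn
  exact MemLp.of_bound hφ.aestronglyMeasurable C
    (by filter_upwards [ae_mem_angle] with θ hθ using hC θ hθ)

theorem memLp_continuous_mul {φ α : ℝ → ℂ} {p : ENNReal} (hφ : MemLp φ p angleMeasure)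
    (hα : Continuous α) : MemLp (fun θ => α θ * φ θ) p angleMeasure := by
  obtain ⟨C, hC⟩ := (isCompact_Icc (a := (0 : ℝ)) (b := 2 * Real.pi)).exists_bound_of_continuousOn
    hα.continuousOn
  refine hφ.of_le_mul (c := C) (hα.aestronglyMeasurable.mul hφ.1) ?_
  filter_upwards [ae_mem_angle] with θ hθ
  rw [norm_mul]
  gcongr
  exact hC θ hθ

theorem integrable_angle {φ : ℝ → ℂ} (hφ : MemLp φ 2 angleMeasure) :
    Integrable φ angleMeasure := hφ.integrable (by norm_num)

/-- The `k`-th Fourier coefficient of a function of the angle. -/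
def fc (k : ℤ) (φ : ℝ → ℂ) : ℂ :=
  (2 * Real.pi : ℂ)⁻¹ * ∫ θ, φ θ * circ (-k) θ ∂angleMeasure

theorem integrable_mul_circ {φ : ℝ → ℂ} (hφ : MemLp φ 2 angleMeasure) (k : ℤ) :
    Integrable (fun θ => φ θ * circ k θ) angleMeasure := by
  simpa only [mul_comm] using integrable_angle (memLp_continuous_mul hφ (continuous_circ k))

theorem fc_congr_ae {φ ψ : ℝ → ℂ} (h : φ =ᵐ[angleMeasure] ψ) (k : ℤ) : fc k φ = fc k ψ := by
  unfold fc
  congr 1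
  apply integral_congr_ae
  filter_upwards [h] with θ hθ
  rw [hθ]

theorem fc_add {φ ψ : ℝ → ℂ} (hφ : MemLp φ 2 angleMeasure) (hψ : MemLp ψ 2 angleMeasure) (k : ℤ) :
    fc k (fun θ => φ θ + ψ θ) = fc k φ + fc k ψ := by
  unfold fc
  rw [← mul_add, ← integral_add (integrable_mul_circ hφ _) (integrable_mul_circ hψ _)]
  simp only [add_mul]

theorem fc_sub {φ ψ : ℝ → ℂ} (hφ : MemLp φ 2 angleMeasure) (hψ : MemLp ψ 2 angleMeasure) (k : ℤ) :
    fc k (fun θ => φ θ - ψ θ) = fc k φ - fc k ψ := by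
  unfold fc
  rw [← mul_sub, ← integral_sub (integrable_mul_circ hφ _) (integrable_mul_circ hψ _)]
  simp only [sub_mul]

theorem fc_const_mul (c : ℂ) (φ : ℝ → ℂ) (k : ℤ) : fc k (fun θ => c * φ θ) = c * fc k φ := by
  unfold fc
  simp only [mul_assoc, integral_const_mul]
  ring

theorem fc_neg (φ : ℝ → ℂ) (k : ℤ) : fc k (fun θ => - φ θ) = - fc k φ := by
  simpa using fc_const_mul (-1) φ k

theorem fc_sum {ι : Type*} (s : Finset ι) (φ : ι → ℝ → ℂ)
    (hφ : ∀ i ∈ s, MemLp (φ i) 2 angleMeasure) (k : ℤ) :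
    fc k (fun θ => ∑ i ∈ s, φ i θ) = ∑ i ∈ s, fc k (φ i) := by
  unfold fc
  simp only [Finset.sum_mul]
  rw [integral_finsetSum _ fun i hi => integrable_mul_circ (hφ i hi) _, Finset.mul_sum]

theorem fc_circ_mul (j : ℤ) (φ : ℝ → ℂ) (k : ℤ) :
    fc k (fun θ => circ j θ * φ θ) = fc (k - j) φ := by
  unfold fc
  congr 2
  funext θ
  rw [show -(k - j) = -k + j by ring, circ_add]
  ring

/-- The bridge to the general theory of Fourier series, through which Parseval's identity and the
`L²` basis become available. -/
theorem fc_eq_fourierCoeffOn (φ : ℝ → ℂ) (k : ℤ) :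
    fc k φ = fourierCoeffOn (a := 0) (b := 2 * Real.pi) (by positivity) φ k := by
  rw [fourierCoeffOn_eq_integral, fc, ← intervalIntegral_eq_angleMeasure]
  simp only [sub_zero, smul_eq_mul, Complex.real_smul]
  congr 1
  · push_cast; ring
  · congr 1
    funext θ
    rw [fourier_coe_apply, circ_eq_exp, mul_comm]
    congr 2
    have : (Real.pi : ℂ) ≠ 0 := by exact_mod_cast Real.pi_ne_zero
    push_cast
    field_simp
    ring

theorem hasSum_sq_fc {φ : ℝ → ℂ} (hφ : MemLp φ 2 angleMeasure) :
    HasSum (fun k => ‖fc k φ‖ ^ 2) ((2 * Real.pi)⁻¹ * ∫ θ, ‖φ θ‖ ^ 2 ∂angleMeasure) := by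
  have h := hasSum_sq_fourierCoeffOn (a := 0) (b := 2 * Real.pi) (by positivity) hφ
  simp only [← fc_eq_fourierCoeffOn] at h
  rwa [intervalIntegral.integral_of_le (by positivity), sub_zero] at h

theorem eLpNorm_two_eq {φ : ℝ → ℂ} (hφ : MemLp φ 2 angleMeasure) :
    eLpNorm φ 2 angleMeasure = ENNReal.ofReal ((∫ θ, ‖φ θ‖ ^ 2 ∂angleMeasure) ^ (1 / 2 : ℝ)) := by
  rw [hφ.eLpNorm_eq_integral_rpow_norm (by norm_num) (by norm_num)]
  simp

theorem ae_eq_zero_of_fc {φ : ℝ → ℂ} (hφ : MemLp φ 2 angleMeasure) (h : ∀ k, fc k φ = 0) :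
    φ =ᵐ[angleMeasure] 0 := by
  have h1 := hasSum_sq_fc hφ
  simp only [h, norm_zero, ne_eq, OfNat.ofNat_ne_zero, not_false_eq_true, zero_pow] at h1
  have h2 := h1.unique hasSum_zero
  have h3 : ∫ θ, ‖φ θ‖ ^ 2 ∂angleMeasure = 0 := by
    have : (2 * Real.pi)⁻¹ ≠ 0 := by positivity
    simpa [this] using h2
  have h4 : eLpNorm φ 2 angleMeasure = 0 := by
    rw [eLpNorm_two_eq hφ, h3]; simp
  exact (eLpNorm_eq_zero_iff hφ.1 (by norm_num)).1 h4

theorem ae_eq_of_fc {φ ψ : ℝ → ℂ} (hφ : MemLp φ 2 angleMeasure) (hψ : MemLp ψ 2 angleMeasure)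
    (h : ∀ k, fc k φ = fc k ψ) : φ =ᵐ[angleMeasure] ψ := by
  have h1 := ae_eq_zero_of_fc (hφ.sub hψ) fun k => by
    have := fc_sub hφ hψ k
    rw [h k, sub_self] at this
    exact this
  filter_upwards [h1] with θ hθ
  exact sub_eq_zero.1 hθ

/-- Partial sums of the Fourier series. -/
def fourierSum (φ : ℝ → ℂ) (N : ℕ) (θ : ℝ) : ℂ :=
  ∑ j ∈ Finset.Icc (-(N : ℤ)) N, fc j φ * circ j θ

theorem fc_circ (j k : ℤ) : fc k (circ j) = if k = j then 1 else 0 := by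
  have h2π : (2 * Real.pi : ℂ) ≠ 0 := by exact_mod_cast (by positivity : 2 * Real.pi ≠ 0)
  have h : fc k (circ j) = fc (k - j) (fun _ => 1) := by
    rw [← fc_circ_mul]; simp
  rw [h, fc]
  simp only [one_mul]
  rw [← intervalIntegral_eq_angleMeasure]
  split_ifs with hkj
  · subst hkj
    simp only [sub_self, neg_zero, circ_zero]
    simp
    field_simp
  · set n : ℤ := -(k - j)
    have hn : (n : ℂ) ≠ 0 := by
      have : n ≠ 0 := by omega
      exact_mod_cast this
    have hd : ∀ θ ∈ Set.uIcc 0 (2 * Real.pi),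
        HasDerivAt (fun θ => (n * Complex.I)⁻¹ * circ n θ) (circ n θ) θ := by
      intro θ _
      refine ((hasDerivAt_circ n θ).const_mul ((n * Complex.I)⁻¹)).congr_deriv ?_
      have := Complex.I_ne_zero
      rw [← mul_assoc, inv_mul_cancel₀ (mul_ne_zero hn this), one_mul]
    rw [intervalIntegral.integral_eq_sub_of_hasDerivAt hd
      ((continuous_circ n).intervalIntegrable _ _)]
    have := circ_periodic n 0
    rw [zero_add] at this
    rw [this]; simp

theorem continuous_fourierSum (φ : ℝ → ℂ) (N : ℕ) : Continuous (fourierSum φ N) := by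
  unfold fourierSum
  exact continuous_finsetSum _ fun j _ => continuous_const.mul (continuous_circ j)

theorem fc_fourierSum (φ : ℝ → ℂ) (N : ℕ) (k : ℤ) :
    fc k (fourierSum φ N) = if k ∈ Finset.Icc (-(N : ℤ)) N then fc k φ else 0 := by
  unfold fourierSum
  rw [fc_sum]
  · simp only [fc_const_mul, fc_circ, mul_ite, mul_one, mul_zero]
    rw [Finset.sum_ite_eq]
  · intro j _
    exact memLp_of_continuous (continuous_const.mul (continuous_circ j)) 2

theorem tendsto_Icc_neg_atTop :
    Tendsto (fun N : ℕ => Finset.Icc (-(N : ℤ)) N) atTop atTop := by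
  refine tendsto_atTop_finset_of_monotone ?_ fun k => ⟨k.natAbs, ?_⟩
  · intro M N h
    refine Finset.Icc_subset_Icc ?_ ?_ <;> omega
  · rw [Finset.mem_Icc]; omega

/-- By Parseval, the squared `L²` error is the total energy minus the energy of the retained
frequencies, hence the tail of a convergent series. -/
theorem tendsto_fourierSum {φ : ℝ → ℂ} (hφ : MemLp φ 2 angleMeasure) :
    Tendsto (fun N : ℕ => eLpNorm (fun θ => fourierSum φ N θ - φ θ) 2 angleMeasure)
      atTop (𝓝 0) := by
  have hmem : ∀ N : ℕ, MemLp (fun θ => fourierSum φ N θ - φ θ) 2 angleMeasure := fun N =>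
    (memLp_of_continuous (continuous_fourierSum φ N) 2).sub hφ
  have hfc : ∀ N k, ‖fc k (fun θ => fourierSum φ N θ - φ θ)‖ ^ 2 =
      ‖fc k φ‖ ^ 2 - if k ∈ Finset.Icc (-(N : ℤ)) N then ‖fc k φ‖ ^ 2 else 0 := by
    intro N k
    rw [fc_sub (memLp_of_continuous (continuous_fourierSum φ N) 2) hφ, fc_fourierSum]
    split_ifs <;> simp
  have hI : ∀ N : ℕ, (2 * Real.pi)⁻¹ * ∫ θ, ‖fourierSum φ N θ - φ θ‖ ^ 2 ∂angleMeasure =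
      (2 * Real.pi)⁻¹ * (∫ θ, ‖φ θ‖ ^ 2 ∂angleMeasure) -
        ∑ k ∈ Finset.Icc (-(N : ℤ)) N, ‖fc k φ‖ ^ 2 := by
    intro N
    have h1 := hasSum_sq_fc (hmem N)
    simp only [hfc] at h1
    refine h1.unique ((hasSum_sq_fc hφ).sub ?_)
    have h2 := hasSum_sum_of_ne_finset_zero (L := .unconditional ℤ) (s := Finset.Icc (-(N : ℤ)) N)
      (f := fun k => if k ∈ Finset.Icc (-(N : ℤ)) N then ‖fc k φ‖ ^ 2 else 0)
      (fun b hb => by simp only [hb, if_false])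
    have h3 : ∑ k ∈ Finset.Icc (-(N : ℤ)) N, ‖fc k φ‖ ^ 2 = ∑ k ∈ Finset.Icc (-(N : ℤ)) N,
        if k ∈ Finset.Icc (-(N : ℤ)) N then ‖fc k φ‖ ^ 2 else 0 :=
      Finset.sum_congr rfl fun k hk => by simp only [hk, if_true]
    rw [h3]
    exact h2
  have hlim : Tendsto (fun N : ℕ => ∫ θ, ‖fourierSum φ N θ - φ θ‖ ^ 2 ∂angleMeasure)
      atTop (𝓝 0) := by
    have h1 : Tendsto (fun N : ℕ => (2 * Real.pi)⁻¹ * (∫ θ, ‖φ θ‖ ^ 2 ∂angleMeasure) -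
        ∑ k ∈ Finset.Icc (-(N : ℤ)) N, ‖fc k φ‖ ^ 2) atTop (𝓝 0) := by
      have := ((hasSum_sq_fc hφ).comp tendsto_Icc_neg_atTop).const_sub
        ((2 * Real.pi)⁻¹ * (∫ θ, ‖φ θ‖ ^ 2 ∂angleMeasure))
      simpa using this
    have h2 := (h1.congr fun N => (hI N).symm).const_mul (2 * Real.pi)
    simp only [mul_zero] at h2
    refine h2.congr fun N => ?_
    field_simp
  simp only [eLpNorm_two_eq (hmem _)]
  have h3 := hlim.rpow_const (p := 1 / 2) (Or.inr (by norm_num))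
  have h4 := (ENNReal.continuous_ofReal.tendsto _).comp h3
  simpa [Function.comp_def] using h4
/-! ### Convergence in `L²` of functions of the angle -/

/-- Convergence in `L²(S¹)` of a family of functions of the angle. -/
def TendstoL2 {ι : Type*} (l : Filter ι) (ψ : ι → ℝ → ℂ) (ψ₀ : ℝ → ℂ) : Prop :=
  (∀ᶠ i in l, MemLp (ψ i) 2 angleMeasure) ∧ MemLp ψ₀ 2 angleMeasure ∧
    Tendsto (fun i => eLpNorm (fun θ => ψ i θ - ψ₀ θ) 2 angleMeasure) l (𝓝 0)

theorem TendstoL2.add {ι : Type*} {l : Filter ι} {ψ χ : ι → ℝ → ℂ} {ψ₀ χ₀ : ℝ → ℂ}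
    (hψ : TendstoL2 l ψ ψ₀) (hχ : TendstoL2 l χ χ₀) :
    TendstoL2 l (fun i θ => ψ i θ + χ i θ) (fun θ => ψ₀ θ + χ₀ θ) := by
  refine ⟨by filter_upwards [hψ.1, hχ.1] with i h1 h2 using h1.add h2, hψ.2.1.add hχ.2.1, ?_⟩
  have h := hψ.2.2.add hχ.2.2
  rw [add_zero] at h
  refine tendsto_of_tendsto_of_tendsto_of_le_of_le' tendsto_const_nhds h
    (Eventually.of_forall fun _ => zero_le) ?_
  filter_upwards [hψ.1, hχ.1] with i h1 h2
  have := eLpNorm_add_le (h1.sub hψ.2.1).1 (h2.sub hχ.2.1).1 (p := 2) (by norm_num)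
  refine le_trans (le_of_eq ?_) this
  congr 1
  funext θ
  simp only [Pi.add_apply, Pi.sub_apply]
  ring

theorem tendstoUniformlyOn_angle {ι : Type*} {l : Filter ι} {K : ι → ℝ → ℂ} {K₀ : ℝ → ℂ}
    (hK : TendstoLocallyUniformly K K₀ l) :
    TendstoUniformlyOn K K₀ l (Set.Icc 0 (2 * Real.pi)) :=
  (tendstoLocallyUniformlyOn_iff_tendstoUniformlyOn_of_compact isCompact_Icc).1
    hK.tendstoLocallyUniformlyOn

theorem TendstoL2.mul {ι : Type*} {l : Filter ι} {ψ K : ι → ℝ → ℂ} {ψ₀ K₀ : ℝ → ℂ}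
    (hψ : TendstoL2 l ψ ψ₀) (hK : TendstoLocallyUniformly K K₀ l) (hKc : ∀ᶠ i in l, Continuous (K i))
    (hK₀ : Continuous K₀) :
    TendstoL2 l (fun i θ => K i θ * ψ i θ) (fun θ => K₀ θ * ψ₀ θ) := by
  have hm0 : MemLp (fun θ => K₀ θ * ψ₀ θ) 2 angleMeasure := memLp_continuous_mul hψ.2.1 hK₀
  have hmi : ∀ᶠ i in l, MemLp (fun θ => K i θ * ψ i θ) 2 angleMeasure := by
    filter_upwards [hψ.1, hKc] with i h1 h2 using memLp_continuous_mul h1 h2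
  refine ⟨hmi, hm0, ?_⟩
  obtain ⟨C, hC⟩ := (isCompact_Icc (a := (0 : ℝ)) (b := 2 * Real.pi)).exists_bound_of_continuousOn
    hK₀.continuousOn
  have hu := Metric.tendstoUniformlyOn_iff.1 (tendstoUniformlyOn_angle hK)
  -- Split `K ψ - K₀ ψ₀ = K (ψ - ψ₀) + (K - K₀) ψ₀`. The restriction `δ ≤ 1` gives the bound `C + 1`
  -- for `K` on one period.
  have hbound : ∀ δ : ℝ, 0 < δ → δ ≤ 1 → ∀ᶠ i in l,
      eLpNorm (fun θ => K i θ * ψ i θ - K₀ θ * ψ₀ θ) 2 angleMeasure ≤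
        ENNReal.ofReal (C + 1) * eLpNorm (fun θ => ψ i θ - ψ₀ θ) 2 angleMeasure +
          ENNReal.ofReal δ * eLpNorm ψ₀ 2 angleMeasure := by
    intro δ hδ hδ1
    filter_upwards [hψ.1, hKc, hu δ hδ] with i h1 h2 h3
    have e1 : eLpNorm (fun θ => K i θ * (ψ i θ - ψ₀ θ)) 2 angleMeasure ≤
        ENNReal.ofReal (C + 1) * eLpNorm (fun θ => ψ i θ - ψ₀ θ) 2 angleMeasure := by
      refine eLpNorm_le_mul_eLpNorm_of_ae_le_mul ?_ 2
      filter_upwards [ae_mem_angle] with θ hθ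
      rw [norm_mul]
      gcongr
      have h4 := h3 θ hθ
      rw [dist_eq_norm] at h4
      have h5 : K i θ = K₀ θ - (K₀ θ - K i θ) := by ring
      rw [h5]
      exact (norm_sub_le _ _).trans (add_le_add (hC θ hθ) (h4.le.trans hδ1))
    have e2 : eLpNorm (fun θ => (K i θ - K₀ θ) * ψ₀ θ) 2 angleMeasure ≤
        ENNReal.ofReal δ * eLpNorm ψ₀ 2 angleMeasure := by
      refine eLpNorm_le_mul_eLpNorm_of_ae_le_mul ?_ 2
      filter_upwards [ae_mem_angle] with θ hθ
      rw [norm_mul]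
      gcongr
      have h4 := h3 θ hθ
      rw [dist_comm, dist_eq_norm] at h4
      exact h4.le
    have m1 := memLp_continuous_mul (h1.sub hψ.2.1) h2
    have m2 := memLp_continuous_mul hψ.2.1 (h2.sub hK₀)
    refine le_trans ?_ (add_le_add e1 e2)
    refine le_trans (le_of_eq ?_) (eLpNorm_add_le m1.1 m2.1 (p := 2) (by norm_num))
    congr 1
    funext θ
    simp only [Pi.add_apply]
    ring
  rw [ENNReal.tendsto_nhds_zero]
  intro η hη
  have hfin : eLpNorm ψ₀ 2 angleMeasure ≠ ⊤ := hψ.2.1.2.ne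
  have t1 : Tendsto (fun δ : ℝ => ENNReal.ofReal δ * eLpNorm ψ₀ 2 angleMeasure) (𝓝[>] 0) (𝓝 0) := by
    have : Tendsto (fun δ : ℝ => ENNReal.ofReal δ) (𝓝[>] 0) (𝓝 0) := by
      have := (ENNReal.continuous_ofReal.tendsto 0).mono_left
        (nhdsWithin_le_nhds (a := (0 : ℝ)) (s := Set.Ioi 0))
      simpa using this
    simpa using ENNReal.Tendsto.mul_const this (Or.inr hfin)
  have hη2 : 0 < η / 2 := ENNReal.half_pos hη.ne'
  obtain ⟨δ, hδ1, hδ2⟩ := (((ENNReal.tendsto_nhds_zero.1 t1) _ hη2).and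
    (Ioc_mem_nhdsGT (zero_lt_one (α := ℝ)))).exists
  have t2 : Tendsto (fun i => ENNReal.ofReal (C + 1) *
      eLpNorm (fun θ => ψ i θ - ψ₀ θ) 2 angleMeasure) l (𝓝 0) := by
    simpa using ENNReal.Tendsto.const_mul hψ.2.2 (Or.inr ENNReal.ofReal_ne_top)
  filter_upwards [hbound δ hδ2.1 hδ2.2, (ENNReal.tendsto_nhds_zero.1 t2) _ hη2] with i h1 h2
  calc _ ≤ _ := h1
    _ ≤ η / 2 + η / 2 := add_le_add h2 hδ1
    _ = η := ENNReal.add_halves η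

theorem tendstoLocallyUniformly_const {ι : Type*} (l : Filter ι) (K : ℝ → ℂ) :
    TendstoLocallyUniformly (fun _ : ι => K) K l := by
  intro u hu x
  exact ⟨Set.univ, univ_mem, Eventually.of_forall fun _ y _ => refl_mem_uniformity hu⟩

theorem TendstoL2.const_mul {ι : Type*} {l : Filter ι} {ψ : ι → ℝ → ℂ} {ψ₀ K : ℝ → ℂ}
    (hψ : TendstoL2 l ψ ψ₀) (hK : Continuous K) :
    TendstoL2 l (fun i θ => K θ * ψ i θ) (fun θ => K θ * ψ₀ θ) :=
  hψ.mul (tendstoLocallyUniformly_const l K) (Eventually.of_forall fun _ => hK) hK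

theorem TendstoL2.integral {ι : Type*} {l : Filter ι} {ψ : ι → ℝ → ℂ} {ψ₀ : ℝ → ℂ}
    (hψ : TendstoL2 l ψ ψ₀) :
    Tendsto (fun i => ∫ θ, ψ i θ ∂angleMeasure) l (𝓝 (∫ θ, ψ₀ θ ∂angleMeasure)) := by
  refine tendsto_integral_of_L1' ψ₀ hψ.2.1.1 ?_ ?_
  · filter_upwards [hψ.1] with i h1 using integrable_angle h1
  · have hfin : angleMeasure Set.univ ^ (1 / (1 : ENNReal).toReal - 1 / (2 : ENNReal).toReal) ≠ ⊤ :=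
      ENNReal.rpow_ne_top_of_nonneg (by norm_num) (measure_ne_top _ _)
    have h := ENNReal.Tendsto.mul_const hψ.2.2 (Or.inr hfin)
    rw [zero_mul] at h
    refine tendsto_of_tendsto_of_tendsto_of_le_of_le' tendsto_const_nhds h
      (Eventually.of_forall fun _ => zero_le) ?_
    filter_upwards [hψ.1] with i h1
    exact eLpNorm_le_eLpNorm_mul_rpow_measure_univ (by norm_num) (h1.sub hψ.2.1).1

theorem TendstoL2.congr {ι : Type*} {l : Filter ι} {ψ χ : ι → ℝ → ℂ} {ψ₀ : ℝ → ℂ}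
    (hψ : TendstoL2 l ψ ψ₀) (h : ∀ᶠ i in l, ∀ θ, ψ i θ = χ i θ) : TendstoL2 l χ ψ₀ := by
  have h' : ∀ᶠ i in l, ψ i = χ i := h.mono fun i hi => funext hi
  refine ⟨?_, hψ.2.1, hψ.2.2.congr' ?_⟩
  · filter_upwards [hψ.1, h'] with i h1 h2
    rwa [← h2]
  · filter_upwards [h'] with i h2
    rw [h2]

/-! ### Curves of functions of the angle with a velocity in `L²` -/

/-- A family of continuous functions, locally uniformly continuous at `s = 0` and with velocity
`φ` in `L²` at `s = 0`. -/
structure L2Curve (u : ℂ → ℝ → ℂ) (φ : ℝ → ℂ) : Prop where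
  continuous : ∀ s, Continuous (u s)
  uniform : TendstoLocallyUniformly u (u 0) (𝓝 0)
  velocity : TendstoL2 (𝓝[≠] 0) (fun s θ => (u s θ - u 0 θ) / s) φ

theorem L2Curve.memLp {u : ℂ → ℝ → ℂ} {φ : ℝ → ℂ} (h : L2Curve u φ) : MemLp φ 2 angleMeasure :=
  h.velocity.2.1

theorem L2Curve.uniform' {u : ℂ → ℝ → ℂ} {φ : ℝ → ℂ} (h : L2Curve u φ) :
    TendstoLocallyUniformly u (u 0) (𝓝[≠] 0) := fun v hv x => by
  obtain ⟨t, ht, H⟩ := h.uniform v hv x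
  exact ⟨t, ht, nhdsWithin_le_nhds H⟩

/-- The increment of the product is `u_s Δv + Δu v_0`. Local uniform convergence of `u_s` is what
allows multiplying a merely `L²`-convergent quotient. -/
theorem L2Curve.mul {u v : ℂ → ℝ → ℂ} {φ ψ : ℝ → ℂ} (hu : L2Curve u φ) (hv : L2Curve v ψ) :
    L2Curve (fun s θ => u s θ * v s θ) (fun θ => u 0 θ * ψ θ + v 0 θ * φ θ) where
  continuous s := (hu.continuous s).mul (hv.continuous s)
  uniform := hu.uniform.mul₀ hv.uniform (hu.continuous 0) (hv.continuous 0)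
  velocity := by
    have h1 := hv.velocity.mul hu.uniform' (Eventually.of_forall hu.continuous) (hu.continuous 0)
    have h2 := hu.velocity.const_mul (hv.continuous 0)
    refine (h1.add h2).congr (Eventually.of_forall fun s θ => ?_)
    ring

theorem L2Curve.inv {u : ℂ → ℝ → ℂ} {φ : ℝ → ℂ} (hu : L2Curve u φ) (h0 : ∀ s θ, u s θ ≠ 0) :
    L2Curve (fun s θ => (u s θ)⁻¹) (fun θ => -((u 0 θ)⁻¹ * (u 0 θ)⁻¹) * φ θ) := by
  have hc : ∀ s, Continuous fun θ => (u s θ)⁻¹ := fun s => (hu.continuous s).inv₀ (h0 s)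
  have hun : TendstoLocallyUniformly (fun s θ => (u s θ)⁻¹) (fun θ => (u 0 θ)⁻¹) (𝓝 0) :=
    hu.uniform.inv₀ (hu.continuous 0) (h0 0)
  refine ⟨hc, hun, ?_⟩
  have hun' : TendstoLocallyUniformly (fun s θ => (u s θ)⁻¹) (fun θ => (u 0 θ)⁻¹) (𝓝[≠] 0) :=
    fun v hv x => by
      obtain ⟨t, ht, H⟩ := hun v hv x
      exact ⟨t, ht, nhdsWithin_le_nhds H⟩
  have h1 := (hu.velocity.mul hun' (Eventually.of_forall hc) (hc 0)).const_mul (hc 0).neg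
  have h2 : (fun θ => -((u 0 θ)⁻¹ * (u 0 θ)⁻¹) * φ θ) =
      fun θ => -(u 0 θ)⁻¹ * ((u 0 θ)⁻¹ * φ θ) := by funext θ; ring
  rw [h2]
  refine h1.congr (Eventually.of_forall fun s θ => ?_)
  have := h0 0 θ
  have := h0 s θ
  -- At `s = 0` both quotients are divisions by zero, hence both sides vanish.
  by_cases hs : s = 0
  · simp [hs]
  · simp only [Pi.neg_apply]
    field_simp
    ring

theorem l2Curve_const {K : ℝ → ℂ} (hK : Continuous K) : L2Curve (fun _ => K) (fun _ => 0) where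
  continuous _ := hK
  uniform := tendstoLocallyUniformly_const _ K
  velocity := by simp [TendstoL2]

theorem L2Curve.congr {u v : ℂ → ℝ → ℂ} {φ ψ : ℝ → ℂ} (hu : L2Curve u φ)
    (huv : ∀ s θ, u s θ = v s θ) (hφ : ∀ θ, φ θ = ψ θ) : L2Curve v ψ := by
  obtain rfl : u = v := funext fun s => funext (huv s)
  obtain rfl : φ = ψ := funext hφ
  exact hu

theorem L2Curve.pow {u : ℂ → ℝ → ℂ} {φ : ℝ → ℂ} (hu : L2Curve u φ) (n : ℕ) :
    L2Curve (fun s θ => u s θ ^ n) (fun θ => n * u 0 θ ^ (n - 1) * φ θ) := by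
  induction n with
  | zero => exact (l2Curve_const continuous_const).congr (fun s θ => (pow_zero _).symm) (by simp)
  | succ n ih =>
    refine (ih.mul hu).congr (fun s θ => (pow_succ _ _).symm) fun θ => ?_
    rcases n with _ | n
    · simp
    · simp only [Nat.add_sub_cancel, pow_succ, Nat.cast_add, Nat.cast_one]
      ring

theorem L2Curve.hasDerivAt_integral {u : ℂ → ℝ → ℂ} {φ : ℝ → ℂ} (hu : L2Curve u φ) :
    HasDerivAt (fun s => ∫ θ, u s θ ∂angleMeasure) (∫ θ, φ θ ∂angleMeasure) 0 := by
  rw [hasDerivAt_iff_tendsto_slope]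
  refine hu.velocity.integral.congr fun s => ?_
  have hi : ∀ s, Integrable (u s) angleMeasure := fun s =>
    integrable_angle (memLp_of_continuous (hu.continuous s) 2)
  rw [slope_def_field, sub_zero, integral_div, integral_sub (hi s) (hi 0)]

theorem L2Curve.mul_const {u : ℂ → ℝ → ℂ} {φ K : ℝ → ℂ} (hu : L2Curve u φ) (hK : Continuous K) :
    L2Curve (fun s θ => u s θ * K θ) (fun θ => φ θ * K θ) :=
  (hu.mul (l2Curve_const hK)).congr (fun _ _ => rfl) fun θ => by ring

theorem L2Curve.hasDerivAt_fc {u : ℂ → ℝ → ℂ} {φ : ℝ → ℂ} (hu : L2Curve u φ) (k : ℤ) :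
    HasDerivAt (fun s => fc k (u s)) (fc k φ) 0 :=
  (hu.mul_const (continuous_circ (-k))).hasDerivAt_integral.const_mul _

/-! ### Products and projections -/

/-- The convolution formula for the coefficients of a product. Multiplication by a continuous
function followed by a Fourier coefficient is `L²`-continuous, so the Fourier sums of `φ` can be
inserted for `φ`; symmetric partial sums avoid any question of summability. -/
theorem continuous_mul_fc_tendsto {α φ : ℝ → ℂ} (hα : Continuous α)
    (hφ : MemLp φ 2 angleMeasure) (k : ℤ) :
    Tendsto (fun N : ℕ => ∑ j ∈ Finset.Icc (-(N : ℤ)) N, fc j φ * fc (k - j) α) atTop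
      (𝓝 (fc k (fun θ => α θ * φ θ))) := by
  have h0 : TendstoL2 atTop (fourierSum φ) φ :=
    ⟨Eventually.of_forall fun N => memLp_of_continuous (continuous_fourierSum φ N) 2, hφ,
      tendsto_fourierSum hφ⟩
  have h1 := ((h0.const_mul (hα.mul (continuous_circ (-k)))).integral).const_mul
    (2 * Real.pi : ℂ)⁻¹
  have e2 : (2 * Real.pi : ℂ)⁻¹ * ∫ θ, α θ * circ (-k) θ * φ θ ∂angleMeasure =
      fc k (fun θ => α θ * φ θ) := by
    unfold fc
    congr 2
    funext θ
    ring
  simp only [Pi.mul_apply] at h1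
  rw [e2] at h1
  refine h1.congr fun N => ?_
  have h2 : fc k (fun θ => ∑ j ∈ Finset.Icc (-(N : ℤ)) N, fc j φ * (circ j θ * α θ)) =
      ∑ j ∈ Finset.Icc (-(N : ℤ)) N, fc j φ * fc (k - j) α := by
    rw [fc_sum _ (fun j θ => fc j φ * (circ j θ * α θ)) fun j _ => memLp_of_continuous
      (continuous_const.mul ((continuous_circ j).mul hα)) 2]
    refine Finset.sum_congr rfl fun j _ => ?_
    rw [fc_const_mul, fc_circ_mul]
  rw [← h2, fc]
  congr 2
  funext θ
  rw [fourierSum, Finset.mul_sum, Finset.sum_mul]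
  exact Finset.sum_congr rfl fun j _ => by ring

/-- If the Fourier coefficients of `α` and `φ` vanish below `p`, respectively `q` (in the
direction given by the sign `ε`), then those of the product vanish below `p + q`. -/
theorem fc_mul_eq_zero {ε : ℤ} (hε : ε = 1 ∨ ε = -1) {α φ : ℝ → ℂ} (hα : Continuous α)
    (hφ : MemLp φ 2 angleMeasure) {p q : ℤ} (hp : ∀ k < p, fc (ε * k) α = 0)
    (hq : ∀ k < q, fc (ε * k) φ = 0) {k : ℤ} (hk : k < p + q) :
    fc (ε * k) (fun θ => α θ * φ θ) = 0 := by
  have h1 := continuous_mul_fc_tendsto hα hφ (ε * k)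
  refine tendsto_nhds_unique h1 (tendsto_const_nhds.congr fun N => (Finset.sum_eq_zero ?_).symm)
  intro j _
  have hεε : ε * ε = 1 := by rcases hε with rfl | rfl <;> norm_num
  by_cases hj : ε * j < q
  · have := hq _ hj
    rw [← mul_assoc, hεε, one_mul] at this
    rw [this, zero_mul]
  · have := hp (k - ε * j) (by omega)
    rw [mul_sub, ← mul_assoc, hεε, one_mul] at this
    rw [this, mul_zero]

/-- Lowest terms multiply: in the convolution only the index `j = ε q` contributes. -/
theorem fc_mul_eq_mul {ε : ℤ} (hε : ε = 1 ∨ ε = -1) {α φ : ℝ → ℂ} (hα : Continuous α)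
    (hφ : MemLp φ 2 angleMeasure) {p q : ℤ} (hp : ∀ k < p, fc (ε * k) α = 0)
    (hq : ∀ k < q, fc (ε * k) φ = 0) :
    fc (ε * (p + q)) (fun θ => α θ * φ θ) = fc (ε * p) α * fc (ε * q) φ := by
  have h1 := continuous_mul_fc_tendsto hα hφ (ε * (p + q))
  have hεε : ε * ε = 1 := by rcases hε with rfl | rfl <;> norm_num
  refine tendsto_nhds_unique h1 (tendsto_const_nhds.congr' ?_)
  filter_upwards [eventually_ge_atTop (ε * q).natAbs] with N hN
  rw [Finset.sum_eq_single (ε * q)]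
  · rw [mul_comm]
    congr 2
    ring
  · intro j _ hjq
    by_cases hj : ε * j < q
    · have := hq _ hj
      rw [← mul_assoc, hεε, one_mul] at this
      rw [this, zero_mul]
    · have hj' : ε * j ≠ q := fun h => hjq (by rw [← h, ← mul_assoc, hεε, one_mul])
      have := hp (p + q - ε * j) (by omega)
      rw [mul_sub, ← mul_assoc, hεε, one_mul] at this
      rw [this, mul_zero]
  · intro hj
    exact absurd (Finset.mem_Icc.2 ⟨by omega, by omega⟩) hj

/-- The Fourier projection of an `L²` function onto a set of frequencies. -/
theorem exists_fc_projection {φ : ℝ → ℂ} (hφ : MemLp φ 2 angleMeasure) (S : Set ℤ) :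
    ∃ ψ : ℝ → ℂ, MemLp ψ 2 angleMeasure ∧
      (∀ k ∈ S, fc k ψ = fc k φ) ∧ ∀ k ∉ S, fc k ψ = 0 := by
  classical
  have : Fact (0 < 2 * Real.pi) := ⟨by positivity⟩
  have hs : Summable fun k => ‖if k ∈ S then fc k φ else 0‖ ^ 2 := by
    refine (hasSum_sq_fc hφ).summable.of_nonneg_of_le (fun _ => by positivity) fun k => ?_
    split_ifs <;> simp
  have hmem : Memℓp (fun k : ℤ => if k ∈ S then fc k φ else 0) 2 := by
    refine memℓp_gen ?_
    simpa using hs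
  set x : lp (fun _ : ℤ => ℂ) 2 := ⟨_, hmem⟩
  -- Riesz–Fischer: the truncated coefficient sequence is square summable, so it comes from an `L²`
  -- function on the circle.
  set Ψ : Lp ℂ 2 (@AddCircle.haarAddCircle (2 * Real.pi) _) := fourierBasis.repr.symm x
  have hΨ : ∀ k, fourierCoeff Ψ k = if k ∈ S then fc k φ else 0 := by
    intro k
    rw [← fourierBasis_repr, LinearIsometryEquiv.apply_symm_apply]
  have hm : MemLp Ψ 2 (volume : Measure (AddCircle (2 * Real.pi))) :=
    memLp_haarAddCircle_iff.1 (Lp.memLp Ψ)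
  have hmp := AddCircle.measurePreserving_mk (2 * Real.pi) 0
  rw [zero_add] at hmp
  have hψ : MemLp (fun θ : ℝ => Ψ (θ : AddCircle (2 * Real.pi))) 2 angleMeasure :=
    hm.comp_measurePreserving hmp
  have hk : ∀ k, fc k (fun θ : ℝ => Ψ (θ : AddCircle (2 * Real.pi))) =
      if k ∈ S then fc k φ else 0 := by
    intro k
    rw [← hΨ, fc_eq_fourierCoeffOn, fourierCoeffOn_eq_integral, fourierCoeff_eq_intervalIntegral _ _ 0]
    simp
  exact ⟨_, hψ, fun k h => by rw [hk, if_pos h], fun k h => by rw [hk, if_neg h]⟩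
/-! ### The Cauchy transform of a function of the angle -/

/-- Circle averages are invariant under `w ↦ w⁻¹`. This is what lets the disc and the exterior be
treated together, with a sign `ε`. -/
theorem average_circ {ε : ℤ} (hε : ε = 1 ∨ ε = -1) (F : ℂ → ℂ) :
    (2 * Real.pi : ℂ)⁻¹ * ∫ θ, F (circ ε θ) ∂angleMeasure = Real.circleAverage F 0 1 := by
  have h : ∀ G : ℂ → ℂ, (2 * Real.pi : ℂ)⁻¹ * ∫ θ, G (circleMap 0 1 θ) ∂angleMeasure =
      Real.circleAverage G 0 1 := by
    intro G
    rw [Real.circleAverage_def, ← intervalIntegral_eq_angleMeasure, Complex.real_smul]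
    push_cast
    rfl
  rcases hε with rfl | rfl
  · simp only [circ_one]
    exact h F
  · rw [← Real.circleAverage_zero_one_congr_inv, ← h]
    simp only [circ, zpow_neg, zpow_one]

/-- The Cauchy transform, at a point of the unit disc, of a function on the unit circle
parametrized by `θ ↦ e^{iεθ}`. -/
def cauchyExt (ε : ℤ) (φ : ℝ → ℂ) (ζ : ℂ) : ℂ :=
  (2 * Real.pi : ℂ)⁻¹ * ∫ θ, φ θ * (1 - ζ * circ (-ε) θ)⁻¹ ∂angleMeasure

theorem one_sub_mul_circ_ne_zero {ζ : ℂ} (hζ : ‖ζ‖ < 1) (ε : ℤ) (θ : ℝ) :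
    1 - ζ * circ ε θ ≠ 0 := by
  intro h
  have h1 : ‖ζ * circ ε θ‖ = 1 := by rw [← sub_eq_zero.1 h, norm_one]
  rw [norm_mul, norm_circ, mul_one] at h1
  exact hζ.ne h1

theorem continuous_cauchyKernel {ζ : ℂ} (hζ : ‖ζ‖ < 1) (ε : ℤ) :
    Continuous fun θ => (1 - ζ * circ ε θ)⁻¹ :=
  (continuous_const.sub (continuous_const.mul (continuous_circ ε))).inv₀
    (one_sub_mul_circ_ne_zero hζ ε)

/-- For fixed `ζ` inside the disc the Cauchy kernel is continuous in the angle, so an `L²` velocity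
on the boundary already gives genuine derivatives of interior values. -/
theorem L2Curve.hasDerivAt_cauchyExt {u : ℂ → ℝ → ℂ} {φ : ℝ → ℂ} (hu : L2Curve u φ) (ε : ℤ)
    {ζ : ℂ} (hζ : ‖ζ‖ < 1) :
    HasDerivAt (fun s => cauchyExt ε (u s) ζ) (cauchyExt ε φ ζ) 0 :=
  (hu.mul_const (continuous_cauchyKernel hζ (-ε))).hasDerivAt_integral.const_mul _

theorem diffContOnCl_unit_iff {a : ℂ → ℂ} : DiffContOnCl ℂ a (Metric.ball 0 1) ↔
    DifferentiableOn ℂ a (Metric.ball 0 1) ∧ ContinuousOn a (Metric.closedBall 0 1) := by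
  rw [← closure_ball (0 : ℂ) one_ne_zero]
  exact ⟨fun h => ⟨h.1, h.2⟩, fun h => ⟨h.1, h.2⟩⟩

theorem circ_mem_closedBall (ε : ℤ) (θ : ℝ) : circ ε θ ∈ Metric.closedBall (0 : ℂ) 1 := by
  rw [mem_closedBall_zero_iff, norm_circ]

theorem DiffContOnCl_continuous_circ {a : ℂ → ℂ} (ha : DiffContOnCl ℂ a (Metric.ball 0 1))
    (ε : ℤ) : Continuous fun θ => a (circ ε θ) :=
  (diffContOnCl_unit_iff.1 ha).2.comp_continuous (continuous_circ ε) (circ_mem_closedBall ε)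

theorem cauchyExt_boundary {ε : ℤ} (hε : ε = 1 ∨ ε = -1) {a : ℂ → ℂ}
    (ha : DiffContOnCl ℂ a (Metric.ball 0 1)) {ζ : ℂ} (hζ : ‖ζ‖ < 1) :
    cauchyExt ε (fun θ => a (circ ε θ)) ζ = a ζ := by
  have h := DiffContOnCl.circleAverage_smul_div (c := 0) (R := 1) (f := a) (w := ζ)
    (by simpa using ha) (by simpa using hζ)
  rw [← average_circ hε] at h
  rw [← h, cauchyExt]
  congr 2
  funext θ
  have h1 := circ_ne_zero ε θ
  have h2 := one_sub_mul_circ_ne_zero hζ (-ε) θ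
  rw [circ_neg] at h2 ⊢
  have h3 : circ ε θ - ζ ≠ 0 := by
    intro h4
    apply h2
    rw [← sub_eq_zero.1 h4, mul_inv_cancel₀ h1, sub_self]
  have h5 : 1 - ζ * (circ ε θ)⁻¹ = (circ ε θ - ζ) / circ ε θ := by field_simp
  rw [h5, inv_div, smul_eq_mul, sub_zero, mul_comm]

/-- The coefficient is the mean over the circle of `w^(-k) a(w)`, which vanishes at the centre. -/
theorem fc_boundary_of_neg {ε : ℤ} (hε : ε = 1 ∨ ε = -1) {a : ℂ → ℂ}
    (ha : DiffContOnCl ℂ a (Metric.ball 0 1)) {k : ℤ} (hk : k < 0) :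
    fc (ε * k) (fun θ => a (circ ε θ)) = 0 := by
  obtain ⟨n, rfl⟩ : ∃ n : ℕ, k = -((n + 1 : ℕ) : ℤ) := ⟨(-k - 1).toNat, by omega⟩
  have h1 : DiffContOnCl ℂ (fun w : ℂ => w ^ (n + 1) • a w) (Metric.ball 0 1) :=
    (Differentiable.diffContOnCl (by fun_prop)).smul ha
  have h2 := cauchyExt_boundary hε h1 (ζ := 0) (by simp)
  simp only [ne_eq, Nat.add_eq_zero_iff, one_ne_zero, and_false, not_false_eq_true, zero_pow,
    zero_smul] at h2
  rw [← h2, fc, cauchyExt]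
  congr 2
  funext θ
  rw [show -(ε * -((n + 1 : ℕ) : ℤ)) = ε * ((n + 1 : ℕ) : ℤ) by ring, circ_mul, zpow_natCast]
  simp only [zero_mul, sub_zero, inv_one, mul_one, smul_eq_mul]
  ring

theorem fc_zero_boundary {ε : ℤ} (hε : ε = 1 ∨ ε = -1) {a : ℂ → ℂ}
    (ha : DiffContOnCl ℂ a (Metric.ball 0 1)) : fc 0 (fun θ => a (circ ε θ)) = a 0 := by
  rw [← cauchyExt_boundary hε ha (ζ := 0) (by simp), fc, cauchyExt]
  simp [circ_zero]

theorem hasSum_of_eq {ι : Type*} {f g : ι → ℂ} {a : ℂ} (h : HasSum f a) (e : ∀ k, g k = f k) :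
    HasSum g a := by
  obtain rfl : g = f := funext e
  exact h

theorem hasSum_cauchyExt (ε : ℤ) {φ : ℝ → ℂ} (hφ : MemLp φ 2 angleMeasure) {ζ : ℂ} (hζ : ‖ζ‖ < 1) :
    HasSum (fun k : ℕ => fc (ε * k) φ * ζ ^ k) (cauchyExt ε φ ζ) := by
  have hF : ∀ k : ℕ, Integrable (fun θ => φ θ * (ζ * circ (-ε) θ) ^ k) angleMeasure := fun k =>
    (integrable_angle (memLp_continuous_mul hφ
      ((continuous_const.mul (continuous_circ (-ε))).pow k))).congr
      (Eventually.of_forall fun θ => mul_comm _ _)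
  have hn : ∀ k : ℕ, ∫ θ, ‖φ θ * (ζ * circ (-ε) θ) ^ k‖ ∂angleMeasure =
      (∫ θ, ‖φ θ‖ ∂angleMeasure) * ‖ζ‖ ^ k := fun k => by
    simp only [norm_mul, norm_pow, norm_circ, mul_one, integral_mul_const]
  have hs : Summable fun k : ℕ => ∫ θ, ‖φ θ * (ζ * circ (-ε) θ) ^ k‖ ∂angleMeasure := by
    simp only [hn]
    exact (summable_geometric_of_lt_one (norm_nonneg _) hζ).mul_left _
  have h := hasSum_integral_of_summable_integral_norm hF hs
  have h2 := h.mul_left (2 * Real.pi : ℂ)⁻¹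
  have e1 : (2 * Real.pi : ℂ)⁻¹ * ∫ θ, ∑' k : ℕ, φ θ * (ζ * circ (-ε) θ) ^ k ∂angleMeasure =
      cauchyExt ε φ ζ := by
    rw [cauchyExt]
    congr 2
    funext θ
    rw [tsum_mul_left, tsum_geometric_of_norm_lt_one]
    rwa [norm_mul, norm_circ, mul_one]
  rw [e1] at h2
  refine hasSum_of_eq h2 fun k => ?_
  rw [fc, mul_assoc, ← integral_mul_const]
  congr 2
  funext θ
  rw [mul_pow, ← zpow_natCast (circ (-ε) θ), ← circ_mul, neg_mul]
  ring

/-- Indexing by all integers makes the series comparable with its products by Laurent polynomials,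
whose powers may have either sign. -/
theorem hasSum_cauchyExt_int {ε : ℤ} (hε : ε = 1 ∨ ε = -1) {φ : ℝ → ℂ}
    (hφ : MemLp φ 2 angleMeasure) (h0 : ∀ k < 0, fc (ε * k) φ = 0) {w : ℂ} (hw : ‖w ^ ε‖ < 1) :
    HasSum (fun k : ℤ => fc k φ * w ^ k) (cauchyExt ε φ (w ^ ε)) := by
  have h1 := hasSum_cauchyExt ε hφ hw
  have hinj : Function.Injective (fun k : ℕ => ε * (k : ℤ)) := by
    intro a b hab
    rcases hε with rfl | rfl <;> simpa using hab
  refine (hinj.hasSum_iff (f := fun k : ℤ => fc k φ * w ^ k) ?_).1 ?_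
  · intro k hk
    have hεε : ε * (ε * k) = k := by rcases hε with rfl | rfl <;> ring
    have : ε * k < 0 := by
      by_contra h
      exact hk ⟨(ε * k).toNat, by simp only [Int.toNat_of_nonneg (not_lt.1 h), hεε]⟩
    have h2 := h0 _ this
    rw [hεε] at h2
    rw [h2, zero_mul]
  · refine hasSum_of_eq h1 fun k => ?_
    simp only [Function.comp, zpow_mul, zpow_natCast]

theorem hasSum_fc_circ_mul {φ : ℝ → ℂ} {w A : ℂ} (hw : w ≠ 0)
    (h : HasSum (fun k : ℤ => fc k φ * w ^ k) A) (j : ℤ) :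
    HasSum (fun k : ℤ => fc k (fun θ => circ j θ * φ θ) * w ^ k) (w ^ j * A) := by
  have h1 := (Equiv.subRight j).hasSum_iff.2 (h.mul_left (w ^ j))
  refine hasSum_of_eq h1 fun k => ?_
  simp only [Function.comp, Equiv.subRight_apply, fc_circ_mul]
  rw [show w ^ k = w ^ j * w ^ (k - j) by rw [← zpow_add₀ hw]; congr 1; ring]
  ring

theorem hasSum_fc_laurent_mul {ι : Type*} {φ : ℝ → ℂ} (hφ : MemLp φ 2 angleMeasure) {w A : ℂ}
    (hw : w ≠ 0) (h : HasSum (fun k : ℤ => fc k φ * w ^ k) A) (s : Finset ι) (c : ι → ℂ)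
    (e : ι → ℤ) :
    HasSum (fun k : ℤ => fc k (fun θ => (∑ j ∈ s, c j * circ (e j) θ) * φ θ) * w ^ k)
      ((∑ j ∈ s, c j * w ^ e j) * A) := by
  have h1 := hasSum_sum (s := s) fun j _ => (hasSum_fc_circ_mul hw h (e j)).mul_left (c j)
  have h3 : (∑ j ∈ s, c j * w ^ e j) * A = ∑ j ∈ s, c j * (w ^ e j * A) := by
    rw [Finset.sum_mul]
    exact Finset.sum_congr rfl fun j _ => by ring
  rw [h3]
  refine hasSum_of_eq h1 fun k => ?_
  have h2 : (fun θ => (∑ j ∈ s, c j * circ (e j) θ) * φ θ) =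
      fun θ => ∑ j ∈ s, c j * (circ (e j) θ * φ θ) := by
    funext θ
    rw [Finset.sum_mul]
    exact Finset.sum_congr rfl fun j _ => by ring
  rw [h2, fc_sum _ (fun j θ => c j * (circ (e j) θ * φ θ)), Finset.sum_mul]
  · exact Finset.sum_congr rfl fun j _ => by rw [fc_const_mul]; ring
  · exact fun j _ => (memLp_continuous_mul hφ (continuous_circ (e j))).const_mul (c j)

theorem diffContOnCl_dslope {a : ℂ → ℂ} (ha : DiffContOnCl ℂ a (Metric.ball 0 1)) {c : ℂ}
    (hc : ‖c‖ < 1) : DiffContOnCl ℂ (dslope a c) (Metric.ball 0 1) := by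
  rw [diffContOnCl_unit_iff] at ha ⊢
  have hc' : Metric.ball (0 : ℂ) 1 ∈ 𝓝 c := Metric.isOpen_ball.mem_nhds (by simpa using hc)
  refine ⟨(Complex.differentiableOn_dslope hc').2 ha.1, ?_⟩
  exact (continuousOn_dslope (mem_of_superset hc' Metric.ball_subset_closedBall)).2
    ⟨ha.2, ha.1.differentiableAt hc'⟩
/-! ### The Cauchy–Pompeiu formula -/

/-- The Wirtinger derivative `∂Q/∂z̄`. -/
def dbar (Q : ℂ → ℂ) (ζ : ℂ) : ℂ :=
  1 / 2 * (fderiv ℝ Q ζ 1 + Complex.I * fderiv ℝ Q ζ Complex.I)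

theorem continuous_dbar {Q : ℂ → ℂ} (hQ : ContDiff ℝ 1 Q) : Continuous (dbar Q) := by
  have h := hQ.continuous_fderiv one_ne_zero
  exact continuous_const.mul ((h.clm_apply continuous_const).add
    (continuous_const.mul (h.clm_apply continuous_const)))

theorem dbar_eq_zero_of_fderiv {Q : ℂ → ℂ} {ζ : ℂ} (h : fderiv ℝ Q ζ = 0) : dbar Q ζ = 0 := by
  simp [dbar, h]

theorem dbar_eq_zero_of_differentiableAt {Q : ℂ → ℂ} {ζ : ℂ} (h : DifferentiableAt ℂ Q ζ) :
    dbar Q ζ = 0 := by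
  have h1 : fderiv ℝ Q ζ = (fderiv ℂ Q ζ).restrictScalars ℝ :=
    (h.hasFDerivAt.restrictScalars ℝ).fderiv
  rw [dbar, h1]
  simp only [ContinuousLinearMap.coe_restrictScalars']
  have h2 : fderiv ℂ Q ζ Complex.I = Complex.I * fderiv ℂ Q ζ 1 := by
    rw [← smul_eq_mul, ← map_smul, smul_eq_mul, mul_one]
  rw [h2, ← mul_assoc, Complex.I_mul_I]
  ring

theorem exists_fderiv_eq_zero_of_hasCompactSupport {Q : ℂ → ℂ} (hc : HasCompactSupport Q) :
    ∃ R : ℝ, 0 < R ∧ ∀ ζ, R < ‖ζ‖ → fderiv ℝ Q ζ = 0 := by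
  obtain ⟨R, hR⟩ := (hc.fderiv ℝ).isCompact.isBounded.subset_closedBall 0
  refine ⟨max R 1, by positivity, fun ζ hζ => ?_⟩
  by_contra h
  have h1 := hR (subset_tsupport _ h)
  rw [mem_closedBall_zero_iff] at h1
  exact absurd (lt_of_le_of_lt (le_max_left R 1) hζ) (not_lt.2 h1)

/-- In polar coordinates the integrand, including the Jacobian `r`, is `(∂_r P + (i/r) ∂_θ P) / 2`.
The radial term integrates to `-P 0 / 2` on each ray, and the angular term to `0` on each circle. -/
theorem integral_dbar_div_self {P : ℂ → ℂ} (hP : ContDiff ℝ 1 P) (hc : HasCompactSupport P) :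
    ∫ ζ, dbar P ζ / ζ = -(Real.pi * P 0) := by
  obtain ⟨R, hR0, hR⟩ := exists_fderiv_eq_zero_of_hasCompactSupport hc
  set E : ℝ → ℂ := fun θ => Complex.exp (θ * Complex.I) with hE
  have hEc : Continuous E := by fun_prop
  have hE0 : ∀ θ, E θ ≠ 0 := fun θ => Complex.exp_ne_zero _
  have hEd : ∀ θ, HasDerivAt E (Complex.I * E θ) θ := by
    intro θ
    have := ((Complex.ofRealCLM.hasDerivAt (x := θ)).mul_const Complex.I).cexp
    refine this.congr_deriv ?_
    simp [hE, mul_comm]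
  -- For `r ≠ 0`, `A` is `∂_r P` and `B` is `(1/r) ∂_θ P`. Written through `fderiv` they are
  -- continuous also at `r = 0`.
  set A : ℝ × ℝ → ℂ := fun p => fderiv ℝ P (p.1 * E p.2) (E p.2) with hA
  set B : ℝ × ℝ → ℂ := fun p => fderiv ℝ P (p.1 * E p.2) (Complex.I * E p.2) with hB
  have hDc := hP.continuous_fderiv one_ne_zero
  have hpt : Continuous fun p : ℝ × ℝ => (p.1 : ℂ) * E p.2 := by fun_prop
  have hAc : Continuous A := (hDc.comp hpt).clm_apply (hEc.comp continuous_snd)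
  have hBc : Continuous B :=
    (hDc.comp hpt).clm_apply (continuous_const.mul (hEc.comp continuous_snd))
  have hnorm : ∀ p : ℝ × ℝ, ‖(p.1 : ℂ) * E p.2‖ = |p.1| := fun p => by
    simp [hE, Complex.norm_exp_ofReal_mul_I]
  have hInt : ∀ F : ℝ × ℝ → ℂ, Continuous F → (∀ p : ℝ × ℝ, R < |p.1| → F p = 0) →
      IntegrableOn F (Set.Ioi 0 ×ˢ Set.Ioo (-Real.pi) Real.pi) := by
    intro F hF h0
    have hk : IntegrableOn F (Set.Icc 0 R ×ˢ Set.Icc (-Real.pi) Real.pi) :=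
      hF.continuousOn.integrableOn_compact (isCompact_Icc.prod isCompact_Icc)
    refine hk.of_forall_sdiff_eq_zero (measurableSet_Ioi.prod measurableSet_Ioo) ?_
    rintro ⟨r, θ⟩ ⟨⟨h1, h2⟩, h3⟩
    refine h0 _ ?_
    by_contra h4
    have h1' : 0 < r := h1
    rw [not_lt, abs_of_pos h1'] at h4
    exact h3 ⟨⟨h1'.le, h4⟩, Set.Ioo_subset_Icc_self h2⟩
  have hAi := hInt A hAc fun p hp => by
    simp only [hA]; rw [hR _ (by rwa [hnorm])]; rfl
  have hBi := hInt B hBc fun p hp => by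
    simp only [hB]; rw [hR _ (by rwa [hnorm])]; rfl
  have hAI : ∫ p in Set.Ioi 0 ×ˢ Set.Ioo (-Real.pi) Real.pi, A p = -(2 * Real.pi * P 0) := by
    have hAi' := hAi.swap
    rw [Measure.volume_eq_prod]
    rw [← setIntegral_prod_swap, setIntegral_prod (fun z => A z.swap) hAi']
    have hin : ∀ θ : ℝ, ∫ r in Set.Ioi (0 : ℝ), A (Prod.swap (θ, r)) = - P 0 := by
      intro θ
      set L : ℝ → ℂ := fun r => r * E θ with hL
      have hLd : ∀ r, HasDerivAt L (E θ) r := fun r => by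
        simpa using (Complex.ofRealCLM.hasDerivAt (x := r)).mul_const (E θ)
      have hLC : ContDiff ℝ 1 L := Complex.ofRealCLM.contDiff.mul contDiff_const
      have hcl : Topology.IsClosedEmbedding L := by
        have hiso : Isometry L := by
          refine Isometry.of_dist_eq fun x y => ?_
          simp only [hL, dist_eq_norm, ← sub_mul, norm_mul, hE, Complex.norm_exp_ofReal_mul_I,
            mul_one]
          rw [← Complex.ofReal_sub, Complex.norm_real]
        exact hiso.isClosedEmbedding
      have hcs : HasCompactSupport (P ∘ L) := hc.comp_isClosedEmbedding hcl
      have hd : ∀ r, deriv (P ∘ L) r = A (Prod.swap (θ, r)) := fun r =>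
        ((hP.differentiable one_ne_zero _).hasFDerivAt.comp_hasDerivAt r (hLd r)).deriv
      have h := hcs.integral_Ioi_deriv_eq (hP.comp hLC) 0
      simp only [hd] at h
      rw [h]
      simp [hL]
    simp only [hin]
    rw [setIntegral_const]
    simp only [Measure.real, Real.volume_Ioo]
    rw [ENNReal.toReal_ofReal (by linarith [Real.pi_pos])]
    rw [Complex.real_smul]
    push_cast
    ring
  have hBI : ∫ p in Set.Ioi 0 ×ˢ Set.Ioo (-Real.pi) Real.pi, B p = 0 := by
    rw [Measure.volume_eq_prod] at hBi ⊢
    rw [setIntegral_prod _ hBi]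
    refine setIntegral_eq_zero_of_forall_eq_zero fun r hr => ?_
    have hr' : (r : ℂ) ≠ 0 := by exact_mod_cast (show (0 : ℝ) < r from hr).ne'
    rw [← integral_Ioc_eq_integral_Ioo,
      ← intervalIntegral.integral_of_le (by linarith [Real.pi_pos])]
    have hd : ∀ θ, HasDerivAt (fun θ => (r : ℂ)⁻¹ * P (r * E θ)) (B (r, θ)) θ := by
      intro θ
      have h1 := ((hP.differentiable one_ne_zero _).hasFDerivAt.comp_hasDerivAt θ
        ((hEd θ).const_mul (r : ℂ))).const_mul (r : ℂ)⁻¹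
      refine h1.congr_deriv ?_
      have h2 : fderiv ℝ P (r * E θ) (r * (Complex.I * E θ)) = r * B (r, θ) := by
        rw [← Complex.real_smul (z := Complex.I * E θ), map_smul, Complex.real_smul]
      rw [h2, inv_mul_cancel_left₀ hr']
    rw [intervalIntegral.integral_eq_sub_of_hasDerivAt (fun θ _ => hd θ)
      ((hBc.comp (by fun_prop : Continuous fun θ : ℝ => (r, θ))).intervalIntegrable _ _)]
    have : E Real.pi = E (-Real.pi) := by
      simp only [hE]
      push_cast
      rw [Complex.exp_pi_mul_I, neg_mul, Complex.exp_neg, Complex.exp_pi_mul_I]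
      norm_num
    rw [this, sub_self]
  rw [← Complex.integral_comp_polarCoord_symm, polarCoord_target]
  have hpt2 : ∀ p ∈ Set.Ioi (0 : ℝ) ×ˢ Set.Ioo (-Real.pi) Real.pi,
      p.1 • (dbar P (Complex.polarCoord.symm p) / Complex.polarCoord.symm p) =
        1 / 2 * A p + 1 / 2 * Complex.I * B p := by
    rintro ⟨r, θ⟩ ⟨hr, -⟩
    have hr' : (r : ℂ) ≠ 0 := by exact_mod_cast (show (0 : ℝ) < r from hr).ne'
    have e1 : Complex.polarCoord.symm (r, θ) = r * E θ := by
      rw [Complex.polarCoord_symm_apply, hE]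
      simp only [Complex.exp_mul_I, Complex.ofReal_cos, Complex.ofReal_sin]
    simp only [hA, hB, e1, dbar]
    set D := fderiv ℝ P (r * E θ)
    have hlin : ∀ v : ℂ, D v = v.re * D 1 + v.im * D Complex.I := by
      intro v
      conv_lhs => rw [← Complex.re_add_im v]
      have : (v.re : ℂ) + v.im * Complex.I = v.re • (1 : ℂ) + v.im • Complex.I := by
        simp [Complex.real_smul]
      rw [this, map_add, map_smul, map_smul, Complex.real_smul, Complex.real_smul]
    rw [hlin (E θ), hlin (Complex.I * E θ)]
    have e2 : (E θ)⁻¹ = Complex.cos θ - Complex.sin θ * Complex.I := by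
      rw [hE]
      simp only
      rw [← Complex.exp_neg, ← neg_mul, Complex.exp_mul_I, Complex.cos_neg, Complex.sin_neg]
      ring
    have e3 : E θ = Complex.cos θ + Complex.sin θ * Complex.I := Complex.exp_mul_I _
    have r1 : ((E θ).re : ℂ) = Complex.cos θ := by
      rw [hE]; simp [Complex.exp_ofReal_mul_I_re]
    have r2 : ((E θ).im : ℂ) = Complex.sin θ := by
      rw [hE]; simp [Complex.exp_ofReal_mul_I_im]
    have r3 : ((Complex.I * E θ).re : ℂ) = - Complex.sin θ := by
      rw [← r2]; simp
    have r4 : ((Complex.I * E θ).im : ℂ) = Complex.cos θ := by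
      rw [← r1]; simp
    rw [r1, r2, r3, r4, Complex.real_smul, div_eq_mul_inv, mul_inv, e2]
    have : (r : ℂ) * (1 / 2 * (D 1 + Complex.I * D Complex.I) *
        ((r : ℂ)⁻¹ * (Complex.cos θ - Complex.sin θ * Complex.I))) =
        1 / 2 * (D 1 + Complex.I * D Complex.I) *
          (Complex.cos θ - Complex.sin θ * Complex.I) := by
      field_simp
    rw [this]
    linear_combination (-(1 : ℂ) / 2 * D Complex.I * Complex.sin θ) * Complex.I_sq
  rw [setIntegral_congr_fun (measurableSet_Ioi.prod measurableSet_Ioo) hpt2,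
    integral_add (hAi.const_mul _) (hBi.const_mul _), integral_const_mul, integral_const_mul,
    hAI, hBI]
  ring

theorem integral_dbar_div_sub {Q : ℂ → ℂ} (hQ : ContDiff ℝ 1 Q) (hc : HasCompactSupport Q)
    (z : ℂ) : ∫ ζ, dbar Q ζ / (ζ - z) = -(Real.pi * Q z) := by
  have hP : ContDiff ℝ 1 fun ζ => Q (ζ + z) := hQ.comp (contDiff_id.add contDiff_const)
  have hcP : HasCompactSupport fun ζ => Q (ζ + z) :=
    hc.comp_homeomorph (Homeomorph.addRight z)
  have h := integral_dbar_div_self hP hcP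
  rw [zero_add] at h
  rw [← h, ← integral_add_right_eq_self _ z]
  congr 1
  funext ζ
  have : dbar (fun ζ => Q (ζ + z)) ζ = dbar Q (ζ + z) := by
    rw [dbar, dbar, fderiv_comp_add_right]
  rw [this, add_sub_cancel_right]

theorem locallyIntegrable_inv_norm : LocallyIntegrable (fun ζ : ℂ => ‖ζ‖⁻¹) := by
  refine locallyIntegrable_of_norm_le_rpow (C := 1) (α := 1) ?_ ?_ ?_ ?_
  · rw [Complex.finrank_real_complex]; norm_num
  · rw [Complex.finrank_real_complex]; norm_num
  · exact Eventually.of_forall fun ζ => by simp [Real.rpow_neg_one]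
  · exact measurable_norm.inv.aestronglyMeasurable

/-- A measure whose Cauchy transform vanishes where `∂Q/∂z̄ ≠ 0` annihilates `Q`. -/
theorem integral_mul_eq_zero_of_cauchyTransform {X : Type*} [MeasurableSpace X] {μ : Measure X}
    [IsFiniteMeasure μ] {Y p : X → ℂ} (hY : Integrable Y μ) (hp : Measurable p) {T : ℝ}
    (hT : ∀ x, ‖p x‖ ≤ T) {Q : ℂ → ℂ} (hQ : ContDiff ℝ 1 Q) (hc : HasCompactSupport Q)
    (h0 : ∀ ζ, dbar Q ζ ≠ 0 → ∫ x, Y x / (ζ - p x) ∂μ = 0) :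
    ∫ x, Y x * Q (p x) ∂μ = 0 := by
  obtain ⟨R, hR0, hR⟩ := exists_fderiv_eq_zero_of_hasCompactSupport hc
  have hdc := continuous_dbar hQ
  obtain ⟨M, hM⟩ := (isCompact_closedBall (0 : ℂ) R).exists_bound_of_continuousOn
    hdc.continuousOn
  have hM0 : 0 ≤ M := (norm_nonneg _).trans (hM 0 (by simp [hR0.le]))
  have hMall : ∀ ζ, ‖dbar Q ζ‖ ≤ M := by
    intro ζ
    by_cases hζ : ‖ζ‖ ≤ R
    · exact hM ζ (by simpa using hζ)
    · rw [dbar_eq_zero_of_fderiv (hR ζ (not_le.1 hζ)), norm_zero]; exact hM0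
  -- An integrable majorant of the kernel for Fubini: where `dbar Q ζ ≠ 0` one has `‖ζ‖ ≤ R` and `‖p
  -- x‖ ≤ T`, so truncation at radius `R + T` loses nothing.
  set k : ℂ → ℝ := (Metric.closedBall (0 : ℂ) (R + T)).indicator fun ζ => ‖ζ‖⁻¹ with hk
  have hki : Integrable k := by
    rw [hk, integrable_indicator_iff Metric.isClosed_closedBall.measurableSet]
    exact locallyIntegrable_inv_norm.integrableOn_isCompact (isCompact_closedBall _ _)
  have hk0 : ∀ ζ, 0 ≤ k ζ := fun ζ => Set.indicator_nonneg (fun _ _ => by positivity) _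
  set F : X × ℂ → ℂ := fun q => Y q.1 * (dbar Q q.2 / (q.2 - p q.1)) with hF
  have hle : ∀ x ζ, ‖F (x, ζ)‖ ≤ ‖Y x‖ * (M * k (ζ - p x)) := by
    intro x ζ
    simp only [hF, norm_mul, norm_div]
    gcongr
    by_cases hζ : ‖ζ‖ ≤ R
    · have : ζ - p x ∈ Metric.closedBall (0 : ℂ) (R + T) := by
        rw [mem_closedBall_zero_iff]
        exact (norm_sub_le _ _).trans (add_le_add hζ (hT x))
      rw [hk, Set.indicator_of_mem this, div_eq_mul_inv]
      gcongr
      exact hMall ζ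
    · rw [dbar_eq_zero_of_fderiv (hR ζ (not_le.1 hζ)), norm_zero, zero_div]
      exact mul_nonneg hM0 (hk0 _)
  have hFm : AEStronglyMeasurable F (μ.prod volume) := by
    have h1 : AEStronglyMeasurable (fun q : X × ℂ => Y q.1) (μ.prod volume) := hY.1.comp_fst
    have h2 : Measurable fun q : X × ℂ => dbar Q q.2 / (q.2 - p q.1) :=
      (hdc.measurable.comp measurable_snd).div (measurable_snd.sub (hp.comp measurable_fst))
    exact h1.mul h2.aestronglyMeasurable
  have hFi : Integrable F (μ.prod volume) := by
    rw [integrable_prod_iff hFm]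
    have hdom : ∀ x, Integrable (fun ζ => ‖Y x‖ * (M * k (ζ - p x))) := fun x =>
      ((hki.comp_sub_right (p x)).const_mul M).const_mul _
    have hsec : ∀ x, Integrable fun ζ => F (x, ζ) := by
      intro x
      refine (hdom x).mono' ?_ (Eventually.of_forall (hle x))
      have hm : Measurable fun ζ => dbar Q ζ / (ζ - p x) :=
        hdc.measurable.div (measurable_id.sub measurable_const)
      exact (hm.const_mul (Y x)).aestronglyMeasurable
    refine ⟨Eventually.of_forall hsec, ?_⟩
    refine (hY.norm.mul_const (M * ∫ ζ, k ζ)).mono' hFm.norm.integral_prod_right'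
      (Eventually.of_forall fun x => ?_)
    rw [Real.norm_of_nonneg (integral_nonneg fun _ => norm_nonneg _)]
    calc ∫ ζ, ‖F (x, ζ)‖ ≤ ∫ ζ, ‖Y x‖ * (M * k (ζ - p x)) :=
          integral_mono (hsec x).norm (hdom x) (hle x)
      _ = ‖Y x‖ * (M * ∫ ζ, k ζ) := by
          rw [integral_const_mul, integral_const_mul, integral_sub_right_eq_self]
  -- Integrating in `ζ` first reproduces `-π Q (p x)`; integrating in `x` first gives the Cauchy
  -- transform times `dbar Q`, which is zero everywhere.
  have hsw := integral_integral_swap (f := fun x ζ => F (x, ζ)) hFi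
  have h1 : ∫ x, ∫ ζ, F (x, ζ) ∂volume ∂μ = -(Real.pi * ∫ x, Y x * Q (p x) ∂μ) := by
    simp only [hF, integral_const_mul, integral_dbar_div_sub hQ hc]
    rw [← integral_const_mul, ← integral_neg]
    congr 1
    funext x
    ring
  have h2 : ∫ ζ, ∫ x, F (x, ζ) ∂μ = 0 := by
    refine integral_eq_zero_of_ae (Eventually.of_forall fun ζ => ?_)
    have e : ∀ x, F (x, ζ) = dbar Q ζ * (Y x / (ζ - p x)) := fun x => by
      simp only [hF]; ring
    simp only [e, integral_const_mul]
    by_cases h : dbar Q ζ = 0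
    · rw [h, zero_mul]; rfl
    · rw [h0 ζ h, mul_zero]; rfl
  rw [h1, h2] at hsw
  have hpi : (Real.pi : ℂ) ≠ 0 := by exact_mod_cast Real.pi_ne_zero
  simpa [hpi] using hsw
/-! ### The Riemann sphere -/

theorem sphereInv_infty : sphereInv ∞ = ((0 : ℂ) : OnePoint ℂ) := rfl

theorem sphereInv_zero : sphereInv ((0 : ℂ) : OnePoint ℂ) = ∞ := by
  simp [sphereInv]

theorem sphereInv_coe {z : ℂ} (hz : z ≠ 0) : sphereInv (z : OnePoint ℂ) = ((z⁻¹ : ℂ) : OnePoint ℂ) := by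
  simp [sphereInv, hz]

theorem sphereCoord_coe (z : ℂ) : sphereCoord (z : OnePoint ℂ) = z := rfl

theorem coe_sphereCoord {x : OnePoint ℂ} (hx : x ≠ ∞) : (sphereCoord x : OnePoint ℂ) = x := by
  obtain ⟨z, rfl⟩ := OnePoint.ne_infty_iff_exists.1 hx
  rfl

theorem sphereInv_sphereInv (x : OnePoint ℂ) : sphereInv (sphereInv x) = x := by
  induction x using OnePoint.rec with
  | infty => rw [sphereInv_infty, sphereInv_zero]
  | coe z =>
    by_cases hz : z = 0
    · rw [hz, sphereInv_zero, sphereInv_infty]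
    · rw [sphereInv_coe hz, sphereInv_coe (inv_ne_zero hz), inv_inv]

theorem continuous_sphereInv : Continuous sphereInv := by
  rw [OnePoint.continuous_iff]
  constructor
  · rw [sphereInv_infty, OnePoint.nhds_coe_eq, Filter.coclosedCompact_eq_cocompact]
    have h1 : Tendsto (fun z : ℂ => z⁻¹) (cocompact ℂ) (𝓝 0) := tendsto_inv₀_cobounded.mono_left
      (Metric.cobounded_eq_cocompact (α := ℂ)).symm.le
    have h2 : ∀ᶠ z : ℂ in cocompact ℂ, z ≠ 0 := by
      have := (isCompact_singleton (x := (0 : ℂ))).compl_mem_cocompact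
      filter_upwards [this] with z hz using hz
    refine ((tendsto_map (f := ((↑) : ℂ → OnePoint ℂ))).comp h1).congr' ?_
    filter_upwards [h2] with z hz
    rw [sphereInv_coe hz]
    rfl
  · rw [continuous_iff_continuousAt]
    intro z
    by_cases hz : z = 0
    · rw [hz, ContinuousAt, sphereInv_zero, OnePoint.nhds_infty_eq,
        Filter.coclosedCompact_eq_cocompact, ← Metric.cobounded_eq_cocompact]
      intro s hs
      obtain ⟨h1, h2⟩ := mem_sup.1 hs
      have h3 := tendsto_inv₀_nhdsNE_zero (α := ℂ) h1
      rw [mem_map, mem_nhdsWithin_iff_eventually] at h3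
      refine mem_map.2 ?_
      filter_upwards [h3] with w hw
      by_cases hw0 : w = 0
      · rw [Set.mem_preimage, hw0, sphereInv_zero]; exact h2
      · rw [Set.mem_preimage, sphereInv_coe hw0]; exact hw hw0
    · have h1 : ContinuousAt (fun w : ℂ => ((w⁻¹ : ℂ) : OnePoint ℂ)) z :=
        OnePoint.continuous_coe.continuousAt.comp (continuousAt_inv₀ hz)
      refine h1.congr ?_
      filter_upwards [isOpen_ne.mem_nhds hz] with w hw
      rw [sphereInv_coe hw]

/-- The inversion as a homeomorphism. -/
def sphereInvHomeo : OnePoint ℂ ≃ₜ OnePoint ℂ where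
  toFun := sphereInv
  invFun := sphereInv
  left_inv := sphereInv_sphereInv
  right_inv := sphereInv_sphereInv
  continuous_toFun := continuous_sphereInv
  continuous_invFun := continuous_sphereInv

theorem comp_sphereInv_mem {σ : OnePoint ℂ → OnePoint ℂ}
    (hσ : σ ∈ ({id, sphereInv} : Set (OnePoint ℂ → OnePoint ℂ))) :
    ∃ σ' ∈ ({id, sphereInv} : Set (OnePoint ℂ → OnePoint ℂ)),
      (∀ x, sphereInv (σ x) = σ' x) ∧ ∀ x, σ (sphereInv x) = σ' x := by
  rcases hσ with rfl | rfl
  · exact ⟨sphereInv, Or.inr rfl, fun _ => rfl, fun _ => rfl⟩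
  · exact ⟨id, Or.inl rfl, sphereInv_sphereInv, sphereInv_sphereInv⟩

theorem chart_involutive {σ : OnePoint ℂ → OnePoint ℂ}
    (hσ : σ ∈ ({id, sphereInv} : Set (OnePoint ℂ → OnePoint ℂ))) (x : OnePoint ℂ) :
    σ (σ x) = x := by
  rcases hσ with rfl | rfl
  · rfl
  · exact sphereInv_sphereInv x

theorem chart_continuous {σ : OnePoint ℂ → OnePoint ℂ}
    (hσ : σ ∈ ({id, sphereInv} : Set (OnePoint ℂ → OnePoint ℂ))) : Continuous σ := by
  rcases hσ with rfl | rfl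
  · exact continuous_id
  · exact continuous_sphereInv

theorem IsC1.conj_sphereInv {F : OnePoint ℂ → OnePoint ℂ} (hF : IsC1 F) :
    IsC1 fun x => sphereInv (F (sphereInv x)) := by
  intro σ hσ τ hτ z hz
  obtain ⟨σ', hσ', h1, -⟩ := comp_sphereInv_mem hσ
  obtain ⟨τ', hτ', -, h2⟩ := comp_sphereInv_mem hτ
  simp only [h1, h2] at hz ⊢
  exact hF σ' hσ' τ' hτ' z hz

theorem IsC1.comp {F G : OnePoint ℂ → OnePoint ℂ} (hG : IsC1 G) (hF : IsC1 F)
    (hFc : Continuous F) : IsC1 fun x => G (F x) := by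
  intro σ hσ τ hτ z hz
  -- An intermediate chart in which the middle point `F (σ z)` is finite.
  obtain ⟨κ, hκ, hκz⟩ : ∃ κ ∈ ({id, sphereInv} : Set (OnePoint ℂ → OnePoint ℂ)),
      κ (F (σ z)) ≠ ∞ := by
    by_cases h : F (σ z) = ∞
    · exact ⟨sphereInv, Or.inr rfl, by rw [h, sphereInv_infty]; exact OnePoint.coe_ne_infty _⟩
    · exact ⟨id, Or.inl rfl, h⟩
  have h1 := hF σ hσ κ hκ z hκz
  have e1 : κ ((sphereCoord (κ (F (σ z))) : ℂ) : OnePoint ℂ) = F (σ z) := by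
    rw [coe_sphereCoord hκz, chart_involutive hκ]
  have h2 := hG κ hκ τ hτ (sphereCoord (κ (F (σ z)))) (by rw [e1]; exact hz)
  refine (h2.comp z h1).congr_of_eventuallyEq ?_
  have hc : Continuous fun ζ : ℂ => κ (F (σ (ζ : OnePoint ℂ))) :=
    (chart_continuous hκ).comp (hFc.comp ((chart_continuous hσ).comp OnePoint.continuous_coe))
  have hop : IsOpen ({∞}ᶜ : Set (OnePoint ℂ)) := isClosed_singleton.isOpen_compl
  filter_upwards [(hop.preimage hc).mem_nhds hκz] with ζ hζ
  simp only [Function.comp]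
  rw [coe_sphereCoord hζ, chart_involutive hκ]

theorem IsC1Homeo.trans {F G : OnePoint ℂ ≃ₜ OnePoint ℂ} (hF : IsC1Homeo F) (hG : IsC1Homeo G) :
    IsC1Homeo (F.trans G) :=
  ⟨hG.1.comp hF.1 F.continuous, hF.2.comp hG.2 G.symm.continuous⟩

/-- The conjugate of a homeomorphism of the sphere by the inversion. -/
def sphereConj (F : OnePoint ℂ ≃ₜ OnePoint ℂ) : OnePoint ℂ ≃ₜ OnePoint ℂ :=
  (sphereInvHomeo.trans F).trans sphereInvHomeo

theorem sphereConj_apply (F : OnePoint ℂ ≃ₜ OnePoint ℂ) (x : OnePoint ℂ) :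
    sphereConj F x = sphereInv (F (sphereInv x)) := rfl

theorem IsC1Homeo.sphereConj {F : OnePoint ℂ ≃ₜ OnePoint ℂ} (hF : IsC1Homeo F) :
    IsC1Homeo (sphereConj F) :=
  ⟨hF.1.conj_sphereInv, hF.2.conj_sphereInv⟩

/-- The only delicate point is `∞`. There the map is the identity on a neighbourhood, hence also the
identity near `0` in the inverted charts. -/
theorem isC1_onePointCongr {Ψ : ℂ ≃ₜ ℂ} (hΨ : ContDiff ℝ 1 Ψ) {R : ℝ}
    (hR : ∀ z, R < ‖z‖ → Ψ z = z) : IsC1 Ψ.onePointCongr := by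
  have hinf : Ψ.onePointCongr ∞ = ∞ := rfl
  have hcoe : ∀ z : ℂ, Ψ.onePointCongr (z : OnePoint ℂ) = ((Ψ z : ℂ) : OnePoint ℂ) := fun _ => rfl
  have hinv : ∀ z : ℂ, z ≠ 0 → ContDiffAt ℝ 1 (fun ζ : ℂ => ζ⁻¹) z := fun z hz =>
    contDiffAt_inv ℝ hz
  rintro σ (rfl | rfl) τ (rfl | rfl) z hz
  · simp only [id, hcoe, sphereCoord_coe]
    exact hΨ.contDiffAt
  · have hz' : Ψ z ≠ 0 := by
      intro h
      rw [id, hcoe, h, sphereInv_zero] at hz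
      exact hz rfl
    refine ((hinv _ hz').comp z hΨ.contDiffAt).congr_of_eventuallyEq ?_
    filter_upwards [(isOpen_ne.preimage Ψ.continuous).mem_nhds hz'] with ζ hζ
    simp only [id, hcoe, Function.comp]
    rw [sphereInv_coe hζ, sphereCoord_coe]
  · have hz' : z ≠ 0 := by
      rintro rfl
      rw [id, sphereInv_zero, hinf] at hz
      exact hz rfl
    refine (hΨ.contDiffAt.comp z (hinv _ hz')).congr_of_eventuallyEq ?_
    filter_upwards [isOpen_ne.mem_nhds hz'] with ζ hζ
    simp only [id, Function.comp]
    rw [sphereInv_coe hζ, hcoe, sphereCoord_coe]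
  · by_cases hz' : z = 0
    · subst hz'
      refine contDiffAt_id.congr_of_eventuallyEq ?_
      filter_upwards [Metric.ball_mem_nhds (0 : ℂ) (inv_pos.2 (show (0 : ℝ) < max R 1 by positivity))]
        with ζ hζ
      by_cases hζ0 : ζ = 0
      · rw [hζ0, sphereInv_zero, hinf, sphereInv_infty, sphereCoord_coe, id]
      · have h1 : R < ‖ζ⁻¹‖ := by
          rw [mem_ball_zero_iff] at hζ
          rw [norm_inv]
          refine (le_max_left R 1).trans_lt ?_
          rwa [lt_inv_comm₀ (by positivity) (norm_pos_iff.2 hζ0)]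
        rw [sphereInv_coe hζ0, hcoe, hR _ h1, sphereInv_coe (inv_ne_zero hζ0), inv_inv,
          sphereCoord_coe, id]
    · have hz2 : Ψ z⁻¹ ≠ 0 := by
        intro h
        rw [sphereInv_coe hz', hcoe, h, sphereInv_zero] at hz
        exact hz rfl
      refine ((hinv _ hz2).comp z (hΨ.contDiffAt.comp z (hinv _ hz'))).congr_of_eventuallyEq ?_
      have hc : ContinuousAt (fun ζ : ℂ => Ψ ζ⁻¹) z :=
        Ψ.continuous.continuousAt.comp (continuousAt_inv₀ hz')
      filter_upwards [isOpen_ne.mem_nhds hz', hc.eventually (isOpen_ne.mem_nhds hz2)] with ζ hζ hζ2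
      simp only [Function.comp]
      rw [sphereInv_coe hζ, hcoe, sphereInv_coe hζ2, sphereCoord_coe]

/-- A small compactly supported perturbation of the identity of the plane extends to a
`C¹` homeomorphism of the sphere. -/
theorem exists_isC1Homeo_id_add {h : ℂ → ℂ} (hh : ContDiff ℝ 1 h) (hc : HasCompactSupport h)
    (hd : ∀ z, ‖fderiv ℝ h z‖ ≤ 1 / 2) :
    ∃ F : OnePoint ℂ ≃ₜ OnePoint ℂ, IsC1Homeo F ∧
      ∀ z : ℂ, F (z : OnePoint ℂ) = ((z + h z : ℂ) : OnePoint ℂ) := by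
  have hlip : LipschitzWith (1 / 2) h :=
    lipschitzWith_of_nnnorm_fderiv_le (hh.differentiable one_ne_zero) fun z => by
      rw [← NNReal.coe_le_coe, coe_nnnorm]; simpa using hd z
  have happ : ApproximatesLinearOn (fun z => z + h z)
      ((ContinuousLinearEquiv.refl ℝ ℂ : ℂ ≃L[ℝ] ℂ) : ℂ →L[ℝ] ℂ) Set.univ (1 / 2) := by
    intro x _ y _
    have h1 := hlip.norm_sub_le x y
    have h2 : x + h x - (y + h y) -
        ((ContinuousLinearEquiv.refl ℝ ℂ : ℂ ≃L[ℝ] ℂ) : ℂ →L[ℝ] ℂ) (x - y) = h x - h y := by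
      simp only [ContinuousLinearEquiv.coe_refl, ContinuousLinearMap.coe_id', id]; ring
    rw [h2]
    exact h1
  -- The perturbation has Lipschitz constant `1/2`, smaller than the inverse norm of the inverse of
  -- the identity; this makes `z + h z` a global homeomorphism.
  have hN : Subsingleton ℂ ∨ (1 / 2 : NNReal) <
      ‖(((ContinuousLinearEquiv.refl ℝ ℂ : ℂ ≃L[ℝ] ℂ).symm : ℂ ≃L[ℝ] ℂ) : ℂ →L[ℝ] ℂ)‖₊⁻¹ := by
    right
    have : ‖(((ContinuousLinearEquiv.refl ℝ ℂ : ℂ ≃L[ℝ] ℂ).symm : ℂ ≃L[ℝ] ℂ) : ℂ →L[ℝ] ℂ)‖₊ = 1 := by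
      rw [ContinuousLinearEquiv.refl_symm, ContinuousLinearEquiv.coe_refl]
      exact ContinuousLinearMap.nnnorm_id
    rw [this, inv_one]
    exact NNReal.half_lt_self one_ne_zero
  set Ψ : ℂ ≃ₜ ℂ := happ.toHomeomorph _ hN with hΨ
  have hΨa : ∀ z, Ψ z = z + h z := fun _ => rfl
  have hΨc : ContDiff ℝ 1 Ψ := contDiff_id.add hh
  have hder : ∀ z, ∃ e : ℂ ≃L[ℝ] ℂ, HasFDerivAt Ψ (e : ℂ →L[ℝ] ℂ) z := by
    intro z
    -- The derivative `1 + h'` is invertible by the Neumann series, so the inverse homeomorphism is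
    -- again `C¹`.
    have hlt : ‖-fderiv ℝ h z‖ < 1 := by rw [norm_neg]; exact (hd z).trans_lt (by norm_num)
    refine ⟨ContinuousLinearEquiv.unitsEquiv ℝ ℂ (Units.oneSub _ hlt), ?_⟩
    have h1 := (hasFDerivAt_id (𝕜 := ℝ) z).add (hh.differentiable one_ne_zero z).hasFDerivAt
    refine h1.congr_fderiv ?_
    ext v
    simp
  choose e he using hder
  have hΨs : ContDiff ℝ 1 Ψ.symm := Ψ.contDiff_symm he hΨc
  obtain ⟨R, hR⟩ := hc.isCompact.isBounded.subset_closedBall 0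
  have hΨR : ∀ z, R < ‖z‖ → Ψ z = z := by
    intro z hz
    rw [hΨa]
    have : h z = 0 := by
      by_contra h0
      have := hR (subset_tsupport h h0)
      rw [mem_closedBall_zero_iff] at this
      exact absurd hz (not_lt.2 this)
    rw [this, add_zero]
  refine ⟨Ψ.onePointCongr, ⟨isC1_onePointCongr hΨc hΨR, ?_⟩, fun z => rfl⟩
  refine isC1_onePointCongr (Ψ := Ψ.symm) (R := R) hΨs fun z hz => ?_
  rw [Homeomorph.symm_apply_eq, hΨR z hz]
/-! ### Maps of the disc which extend to `C¹` homeomorphisms of the sphere -/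

/-- The finite part of a self-map of the sphere, as a self-map of the plane. -/
def planeMap (F : OnePoint ℂ ≃ₜ OnePoint ℂ) (w : ℂ) : ℂ := sphereCoord (F w)

/-- The set of points of the plane where a self-map of the sphere is finite. -/
def planeDom (F : OnePoint ℂ ≃ₜ OnePoint ℂ) : Set ℂ := {w | F (w : OnePoint ℂ) ≠ ∞}

theorem isOpen_planeDom (F : OnePoint ℂ ≃ₜ OnePoint ℂ) : IsOpen (planeDom F) :=
  (isClosed_singleton (x := (∞ : OnePoint ℂ))).isOpen_compl.preimage
    (F.continuous.comp OnePoint.continuous_coe)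

theorem coe_planeMap {F : OnePoint ℂ ≃ₜ OnePoint ℂ} {w : ℂ} (hw : w ∈ planeDom F) :
    (planeMap F w : OnePoint ℂ) = F w := coe_sphereCoord hw

theorem planeMap_mem_planeDom {F : OnePoint ℂ ≃ₜ OnePoint ℂ} {w : ℂ} (hw : w ∈ planeDom F) :
    planeMap F w ∈ planeDom F.symm := by
  rw [planeDom, Set.mem_ofPred_eq, coe_planeMap hw, F.symm_apply_apply]
  exact OnePoint.coe_ne_infty _

theorem planeMap_symm_planeMap {F : OnePoint ℂ ≃ₜ OnePoint ℂ} {w : ℂ} (hw : w ∈ planeDom F) :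
    planeMap F.symm (planeMap F w) = w := by
  rw [planeMap, coe_planeMap hw, F.symm_apply_apply, sphereCoord_coe]

theorem IsC1.contDiffAt_planeMap {F : OnePoint ℂ ≃ₜ OnePoint ℂ} (hF : IsC1 F) {w : ℂ}
    (hw : w ∈ planeDom F) : ContDiffAt ℝ 1 (planeMap F) w :=
  hF id (Or.inl rfl) id (Or.inl rfl) w hw

/-- A holomorphic map of the unit disc with `a(0) = 0` which is the restriction of a `C¹`
homeomorphism of the sphere that is finite on the closed disc. -/
structure IsDiscMap (a : ℂ → ℂ) : Prop where
  holo : DifferentiableOn ℂ a (Metric.ball 0 1)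
  ext : ∃ F : OnePoint ℂ ≃ₜ OnePoint ℂ, IsC1Homeo F ∧
    ∀ w : ℂ, ‖w‖ ≤ 1 → F (w : OnePoint ℂ) = (a w : OnePoint ℂ)
  zero : a 0 = 0

theorem mem_planeDom_of_ext {a : ℂ → ℂ} {F : OnePoint ℂ ≃ₜ OnePoint ℂ}
    (hF : ∀ w : ℂ, ‖w‖ ≤ 1 → F (w : OnePoint ℂ) = (a w : OnePoint ℂ)) {w : ℂ} (hw : ‖w‖ ≤ 1) :
    w ∈ planeDom F := by
  rw [planeDom, Set.mem_ofPred_eq, hF w hw]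
  exact OnePoint.coe_ne_infty _

theorem planeMap_eq_of_ext {a : ℂ → ℂ} {F : OnePoint ℂ ≃ₜ OnePoint ℂ}
    (hF : ∀ w : ℂ, ‖w‖ ≤ 1 → F (w : OnePoint ℂ) = (a w : OnePoint ℂ)) {w : ℂ} (hw : ‖w‖ ≤ 1) :
    planeMap F w = a w := by
  rw [planeMap, hF w hw, sphereCoord_coe]

theorem IsDiscMap.diffContOnCl {a : ℂ → ℂ} (ha : IsDiscMap a) :
    DiffContOnCl ℂ a (Metric.ball 0 1) := by
  obtain ⟨F, hF, hFa⟩ := ha.ext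
  refine diffContOnCl_unit_iff.2 ⟨ha.holo, ?_⟩
  intro w hw
  rw [mem_closedBall_zero_iff] at hw
  have h1 := (hF.1.contDiffAt_planeMap (mem_planeDom_of_ext hFa hw)).continuousAt.continuousWithinAt
    (s := Metric.closedBall 0 1)
  refine h1.congr (fun y hy => ?_) (planeMap_eq_of_ext hFa hw).symm
  rw [mem_closedBall_zero_iff] at hy
  exact (planeMap_eq_of_ext hFa hy).symm

theorem IsDiscMap.injOn {a : ℂ → ℂ} (ha : IsDiscMap a) {w v : ℂ} (hw : ‖w‖ ≤ 1) (hv : ‖v‖ ≤ 1)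
    (h : a w = a v) : w = v := by
  obtain ⟨F, -, hFa⟩ := ha.ext
  have h1 := hFa w hw
  rw [h, ← hFa v hv] at h1
  exact OnePoint.coe_injective (F.injective h1)

theorem IsDiscMap.ne_zero {a : ℂ → ℂ} (ha : IsDiscMap a) {w : ℂ} (hw : ‖w‖ ≤ 1) (h0 : w ≠ 0) :
    a w ≠ 0 := fun h =>
  h0 (ha.injOn hw (by simp) (h.trans ha.zero.symm))

/-- The complex derivative of a disc map extends continuously, without zeros, to the closed disc,
and gives there the derivative along the circle. -/
theorem IsDiscMap.exists_deriv {a : ℂ → ℂ} (ha : IsDiscMap a) :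
    ∃ a₁ : ℂ → ℂ, DiffContOnCl ℂ a₁ (Metric.ball 0 1) ∧ (∀ w, ‖w‖ ≤ 1 → a₁ w ≠ 0) ∧
      (∀ w, ‖w‖ < 1 → HasDerivAt a (a₁ w) w) ∧
      ∀ ε θ, HasDerivAt (fun θ => a (circ ε θ)) (ε * Complex.I * circ ε θ * a₁ (circ ε θ)) θ := by
  obtain ⟨F, hF, hFa⟩ := ha.ext
  set A := planeMap F with hA
  set D : ℂ → ℂ →L[ℝ] ℂ := fderiv ℝ A with hD
  have hCD : ∀ w ∈ planeDom F, ContDiffAt ℝ 1 A w := fun w hw => hF.1.contDiffAt_planeMap hw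
  have hdom : ∀ w : ℂ, ‖w‖ ≤ 1 → w ∈ planeDom F := fun w hw => mem_planeDom_of_ext hFa hw
  have hAd : ∀ w ∈ planeDom F, HasFDerivAt A (D w) w := fun w hw =>
    ((hCD w hw).differentiableAt one_ne_zero).hasFDerivAt
  have hDc : ∀ w ∈ planeDom F, ContinuousAt D w := fun w hw =>
    (hCD w hw).continuousAt_fderiv one_ne_zero
  have hAa : ∀ w : ℂ, ‖w‖ ≤ 1 → A w = a w := fun w hw => planeMap_eq_of_ext hFa hw
  have hin : ∀ w : ℂ, ‖w‖ < 1 → HasDerivAt a (deriv a w) w := fun w hw =>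
    (ha.holo.differentiableAt (Metric.isOpen_ball.mem_nhds (by simpa using hw))).hasDerivAt
  have hDin : ∀ w : ℂ, ‖w‖ < 1 → ∀ v, D w v = deriv a w * v := by
    intro w hw v
    have h1 : A =ᶠ[𝓝 w] a := by
      filter_upwards [Metric.isOpen_ball.mem_nhds (show w ∈ Metric.ball (0 : ℂ) 1 by simpa using hw)]
        with y hy
      rw [mem_ball_zero_iff] at hy
      exact hAa y hy.le
    have h2 := ((hin w hw).hasFDerivAt.restrictScalars ℝ).congr_of_eventuallyEq h1
    rw [hD, h2.fderiv]
    simp [mul_comm]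
  have hDcl : ∀ v : ℂ, ContinuousOn (fun w => D w v) (Metric.closedBall 0 1) := fun v w hw =>
    ((hDc w (hdom w (by simpa using hw))).clm_apply continuousAt_const).continuousWithinAt
  -- Complex linearity of the real differential holds in the open disc and passes to the boundary by
  -- continuity. The required derivative is then `w ↦ D w 1`.
  have hlin : ∀ v w : ℂ, ‖w‖ ≤ 1 → D w v = D w 1 * v := by
    intro v w hw
    have h1 : Set.EqOn (fun w => D w v) (fun w => D w 1 * v) (closure (Metric.ball 0 1)) := by
      refine Set.EqOn.of_subset_closure (s := Metric.ball 0 1) ?_ ?_ ?_ subset_closure le_rfl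
      · intro w hw
        rw [mem_ball_zero_iff] at hw
        simp only [hDin w hw, mul_one]
      · rw [closure_ball _ one_ne_zero]; exact hDcl v
      · rw [closure_ball _ one_ne_zero]; exact (hDcl 1).mul continuousOn_const
    exact h1 (by rw [closure_ball _ one_ne_zero]; simpa using hw)
  refine ⟨fun w => D w 1, ?_, ?_, ?_, ?_⟩
  · refine diffContOnCl_unit_iff.2 ⟨?_, hDcl 1⟩
    refine (ha.holo.deriv Metric.isOpen_ball).congr fun w hw => ?_
    rw [mem_ball_zero_iff] at hw
    simp only [hDin w hw, mul_one]
  -- The `C¹` inverse of the extension forbids critical points, also on the circle: the chain rule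
  -- would give `0 = 1`.
  · intro w hw h0
    have hB := (hF.2.contDiffAt_planeMap (planeMap_mem_planeDom (hdom w hw))).differentiableAt
      one_ne_zero
    have h1 := hB.hasFDerivAt.comp w (hAd w (hdom w hw))
    have h2 : planeMap F.symm ∘ A =ᶠ[𝓝 w] id := by
      filter_upwards [(isOpen_planeDom F).mem_nhds (hdom w hw)] with y hy
      exact planeMap_symm_planeMap hy
    have h3 := (h1.congr_of_eventuallyEq h2.symm).unique (hasFDerivAt_id w)
    have h4 := congrArg (fun L : ℂ →L[ℝ] ℂ => L 1) h3
    simp only [ContinuousLinearMap.comp_apply, h0, map_zero, ContinuousLinearMap.coe_id', id] at h4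
    exact zero_ne_one h4
  · intro w hw
    have := hin w hw
    rwa [← mul_one (deriv a w), ← hDin w hw] at this
  · intro ε θ
    have hn : ‖circ ε θ‖ ≤ 1 := (norm_circ ε θ).le
    have h1 := (hAd _ (hdom _ hn)).comp_hasDerivAt θ (hasDerivAt_circ ε θ)
    have h2 : A ∘ circ ε = fun θ => a (circ ε θ) := by
      funext θ
      exact hAa _ (norm_circ ε θ).le
    rw [h2, hlin _ _ hn, mul_comm] at h1
    exact h1

/-! ### Stability of disc maps under small holomorphic perturbations -/

theorem exists_bump {K O : Set ℂ} (hK : IsCompact K) (hO : IsOpen O) (h : K ⊆ O) :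
    ∃ χ : ℂ → ℝ, ContDiff ℝ 1 χ ∧ HasCompactSupport χ ∧ tsupport χ ⊆ O ∧
      (∀ᶠ x in 𝓝ˢ K, χ x = 1) ∧ ∀ x, |χ x| ≤ 1 := by
  obtain ⟨L, hL, hKL, hLO⟩ := exists_compact_between hK hO h
  obtain ⟨f, h1, h0, hf⟩ := exists_contMDiffMap_one_nhds_of_subset_interior
    (modelWithCornersSelf ℝ ℂ) (n := 1) hK.isClosed hKL
  have hs : tsupport f ⊆ L := by
    refine closure_minimal (fun x hx => ?_) hL.isClosed
    by_contra hxL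
    exact hx (h0 x hxL)
  exact ⟨f, f.contMDiff.contDiff, hL.of_isClosed_subset (isClosed_tsupport f) hs, hs.trans hLO, h1,
    fun x => by rw [abs_of_nonneg (hf x).1]; exact (hf x).2⟩

/-- A disc map stays a disc map after a small holomorphic perturbation. -/
theorem IsDiscMap.exists_perturbation {a : ℂ → ℂ} (ha : IsDiscMap a) :
    ∃ δ > 0, ∃ R : ℝ, 1 ≤ R ∧ ∀ η : ℂ → ℂ, Differentiable ℂ η → η 0 = 0 →
      (∀ w, ‖w‖ ≤ R → ‖η w‖ ≤ δ ∧ ‖deriv η w‖ ≤ δ) → IsDiscMap fun w => a w + η w := by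
  obtain ⟨F, hF, hFa⟩ := ha.ext
  obtain ⟨χ, hχ, hχc, hχO, hχ1, hχle⟩ := exists_bump (isCompact_closedBall (0 : ℂ) 1)
    (isOpen_planeDom F) (fun w hw => mem_planeDom_of_ext hFa (by simpa using hw))
  set S := tsupport χ with hS
  have hSc : IsCompact S := hχc
  obtain ⟨R, hR⟩ := hSc.isBounded.subset_closedBall 0
  obtain ⟨M, hM⟩ := hSc.exists_bound_of_continuousOn
    (hχ.continuous_fderiv one_ne_zero).continuousOn
  have hAc : ContinuousOn (planeMap F) S := fun w hw =>
    (hF.1.contDiffAt_planeMap (hχO hw)).continuousAt.continuousWithinAt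
  set S' := planeMap F '' S with hS'
  have hS'c : IsCompact S' := hSc.image_of_continuousOn hAc
  have hS'dom : S' ⊆ planeDom F.symm := by
    rintro _ ⟨w, hw, rfl⟩
    exact planeMap_mem_planeDom (hχO hw)
  have hBcd : ∀ z ∈ planeDom F.symm, ContDiffAt ℝ 1 (planeMap F.symm) z := fun z hz =>
    hF.2.contDiffAt_planeMap hz
  obtain ⟨L, hL⟩ := hS'c.exists_bound_of_continuousOn (f := fderiv ℝ (planeMap F.symm))
    fun z hz => ((hBcd z (hS'dom hz)).continuousAt_fderiv one_ne_zero).continuousWithinAt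
  -- Chosen so that the derivative bound `(1 + |M|) C⁻¹` of the cut-off perturbation, times the
  -- bound `1 + |L|` for the derivative of the inverse map, equals `1/2`.
  set C : ℝ := 2 * ((1 + |M|) * (1 + |L|)) with hC
  have hCpos : 0 < C := by positivity
  refine ⟨C⁻¹, inv_pos.2 hCpos, max R 1, le_max_right _ _, fun η hη hη0 hηb => ?_⟩
  have hηb' : ∀ w ∈ S, ‖η w‖ ≤ C⁻¹ ∧ ‖deriv η w‖ ≤ C⁻¹ := fun w hw =>
    hηb w (by have := hR hw; rw [mem_closedBall_zero_iff] at this; exact this.trans (le_max_left _ _))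
  set ρ : ℂ → ℂ := fun w => χ w • η w with hρ
  have hηR : ContDiff ℝ 1 η := (hη.contDiff (n := 1)).restrict_scalars ℝ
  have hρcd : ContDiff ℝ 1 ρ := hχ.smul hηR
  have hρ0 : ∀ w ∉ S, ρ w = 0 := fun w hw => by
    simp only [hρ, image_eq_zero_of_notMem_tsupport hw, zero_smul]
  -- The perturbation is moved to the target: `h = ρ ∘ F⁻¹`, so that `(id + h) ∘ F` equals `a + η`
  -- on the closed disc and is a composition of two `C¹` homeomorphisms.
  set h : ℂ → ℂ := fun z => (F.symm (z : OnePoint ℂ)).elim 0 ρ with hh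
  have hhB : ∀ z ∈ planeDom F.symm, h z = ρ (planeMap F.symm z) := by
    intro z hz
    simp only [hh]
    rw [← coe_planeMap hz, OnePoint.elim_some]
  have hh0 : ∀ z ∉ S', h z = 0 := by
    intro z hz
    by_cases hzd : z ∈ planeDom F.symm
    · rw [hhB z hzd]
      refine hρ0 _ fun hw => hz ⟨_, hw, ?_⟩
      have := planeMap_symm_planeMap hzd
      rwa [Homeomorph.symm_symm] at this
    · have : F.symm (z : OnePoint ℂ) = ∞ := by
        by_contra h1
        exact hzd h1
      simp only [hh, this, OnePoint.elim_infty]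
  have hout : ∀ z ∉ S', h =ᶠ[𝓝 z] fun _ => 0 := fun z hz => by
    filter_upwards [hS'c.isClosed.isOpen_compl.mem_nhds hz] with y hy using hh0 y hy
  have hins : ∀ z ∈ S', h =ᶠ[𝓝 z] ρ ∘ planeMap F.symm := fun z hz => by
    filter_upwards [(isOpen_planeDom F.symm).mem_nhds (hS'dom hz)] with y hy using hhB y hy
  have hhcd : ContDiff ℝ 1 h := by
    refine contDiff_iff_contDiffAt.2 fun z => ?_
    by_cases hz : z ∈ S'
    · exact (hρcd.contDiffAt.comp z (hBcd z (hS'dom hz))).congr_of_eventuallyEq (hins z hz)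
    · exact contDiffAt_const.congr_of_eventuallyEq (hout z hz)
  have hhc : HasCompactSupport h := HasCompactSupport.intro hS'c hh0
  have hρd : ∀ w ∈ S, ‖fderiv ℝ ρ w‖ ≤ (1 + |M|) * C⁻¹ := by
    intro w hw
    obtain ⟨e1, e2⟩ := hηb' w hw
    have hη' : fderiv ℝ η w = (fderiv ℂ η w).restrictScalars ℝ :=
      ((hη w).hasFDerivAt.restrictScalars ℝ).fderiv
    have hηn : ‖fderiv ℝ η w‖ ≤ C⁻¹ := by
      rw [hη', ContinuousLinearMap.norm_restrictScalars, ← norm_deriv_eq_norm_fderiv]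
      exact e2
    have hd := ((hχ.differentiable one_ne_zero w).hasFDerivAt.smul
      (hηR.differentiable one_ne_zero w).hasFDerivAt).fderiv
    have hd' : fderiv ℝ ρ w = χ w • fderiv ℝ η w + (fderiv ℝ χ w).smulRight (η w) := hd
    rw [hd']
    calc ‖χ w • fderiv ℝ η w + (fderiv ℝ χ w).smulRight (η w)‖
        ≤ ‖χ w • fderiv ℝ η w‖ + ‖(fderiv ℝ χ w).smulRight (η w)‖ := norm_add_le _ _
      _ = |χ w| * ‖fderiv ℝ η w‖ + ‖fderiv ℝ χ w‖ * ‖η w‖ := by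
          rw [norm_smul, ContinuousLinearMap.norm_smulRight_apply, Real.norm_eq_abs]
      _ ≤ 1 * C⁻¹ + |M| * C⁻¹ := by
          gcongr
          · exact hχle w
          · exact (hM w hw).trans (le_abs_self M)
      _ = (1 + |M|) * C⁻¹ := by ring
  have hhd : ∀ z, ‖fderiv ℝ h z‖ ≤ 1 / 2 := by
    intro z
    by_cases hz : z ∈ S'
    · obtain ⟨w, hw, rfl⟩ := hz
      have hz : planeMap F w ∈ S' := ⟨w, hw, rfl⟩
      have hB := (hBcd _ (hS'dom hz)).differentiableAt one_ne_zero
      have e1 : planeMap F.symm (planeMap F w) = w := planeMap_symm_planeMap (hχO hw)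
      have hd := (hρcd.differentiable one_ne_zero _).hasFDerivAt.comp _ hB.hasFDerivAt
      rw [(hins _ hz).fderiv_eq, hd.fderiv, e1]
      calc _ ≤ ‖fderiv ℝ ρ w‖ * ‖fderiv ℝ (planeMap F.symm) (planeMap F w)‖ :=
            ContinuousLinearMap.opNorm_comp_le _ _
        _ ≤ ((1 + |M|) * C⁻¹) * (1 + |L|) := by
            gcongr
            · exact hρd w hw
            · exact (hL _ hz).trans ((le_abs_self L).trans (by linarith))
        _ = 1 / 2 := by
            rw [hC]
            field_simp
    · rw [(hout z hz).fderiv_eq]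
      simp
  obtain ⟨G, hG, hGz⟩ := exists_isC1Homeo_id_add hhcd hhc hhd
  refine ⟨ha.holo.add hη.differentiableOn, ⟨F.trans G, hF.trans hG, fun w hw => ?_⟩, ?_⟩
  · rw [Homeomorph.trans_apply, hFa w hw, hGz]
    have hwd := mem_planeDom_of_ext hFa hw
    have e1 := planeMap_eq_of_ext hFa hw
    have e2 : h (a w) = η w := by
      rw [← e1, hhB _ (planeMap_mem_planeDom hwd), planeMap_symm_planeMap hwd]
      have : χ w = 1 := hχ1.self_of_nhdsSet w (by simpa using hw)
      simp only [hρ, this, one_smul]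
    rw [e2]
  · simp only [ha.zero, hη0, add_zero]
/-! ### Density of the polynomials in a disc map -/

/-- The Cauchy transform of `Y dθ` pushed forward to the plane by `q`. -/
def cauchyTransform (Y q : ℝ → ℂ) (z : ℂ) : ℂ := ∫ θ, Y θ / (z - q θ) ∂angleMeasure

theorem differentiableOn_cauchyTransform {Y q : ℝ → ℂ} (hY : Integrable Y angleMeasure)
    (hq : Continuous q) {K : Set ℂ} (hK : IsClosed K) (hqK : ∀ θ, q θ ∈ K) :
    DifferentiableOn ℂ (cauchyTransform Y q) Kᶜ := by
  intro z hz
  obtain ⟨r, hr, hball⟩ := Metric.isOpen_iff.1 hK.isOpen_compl z hz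
  have hdist : ∀ y ∈ Metric.ball z (r / 2), ∀ θ, r / 2 ≤ ‖y - q θ‖ := by
    intro y hy θ
    by_contra hlt
    rw [not_le] at hlt
    refine hball (?_ : q θ ∈ Metric.ball z r) (hqK θ)
    rw [Metric.mem_ball] at hy ⊢
    rw [← dist_eq_norm] at hlt
    calc dist (q θ) z ≤ dist (q θ) y + dist y z := dist_triangle _ _ _
      _ < r / 2 + r / 2 := by rw [dist_comm (q θ)]; gcongr
      _ = r := by ring
  have hne : ∀ y ∈ Metric.ball z (r / 2), ∀ θ, y - q θ ≠ 0 := fun y hy θ h => by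
    have := hdist y hy θ
    rw [h, norm_zero] at this
    linarith
  have hz' : z ∈ Metric.ball z (r / 2) := Metric.mem_ball_self (by positivity)
  have hb : ∀ y ∈ Metric.ball z (r / 2), ∀ θ, ‖(y - q θ)⁻¹‖ ≤ (r / 2)⁻¹ := fun y hy θ => by
    rw [norm_inv]
    exact inv_anti₀ (by positivity) (hdist y hy θ)
  have hm : ∀ y : ℂ, AEStronglyMeasurable (fun θ => (y - q θ)⁻¹) angleMeasure := fun y =>
    (continuous_const.sub hq).measurable.inv.aestronglyMeasurable
  have h := hasDerivAt_integral_of_dominated_loc_of_deriv_le (𝕜 := ℂ) (μ := angleMeasure)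
    (F := fun y θ => Y θ / (y - q θ)) (F' := fun y θ => -(Y θ * ((y - q θ)⁻¹ * (y - q θ)⁻¹)))
    (x₀ := z) (s := Metric.ball z (r / 2)) (bound := fun θ => ‖Y θ‖ * ((r / 2)⁻¹ * (r / 2)⁻¹))
    (Metric.ball_mem_nhds z (by positivity)) ?_ ?_ ?_ ?_ ?_ ?_
  · exact h.2.differentiableAt.differentiableWithinAt
  · exact Eventually.of_forall fun y => by
      simp only [div_eq_mul_inv]
      exact hY.1.mul (hm y)
  · refine (hY.norm.mul_const (r / 2)⁻¹).mono' ?_ (Eventually.of_forall fun θ => ?_)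
    · simp only [div_eq_mul_inv]
      exact hY.1.mul (hm z)
    · rw [div_eq_mul_inv, norm_mul]
      gcongr
      exact hb z hz' θ
  · exact (hY.1.mul ((hm z).mul (hm z))).neg
  · refine Eventually.of_forall fun θ y hy => ?_
    rw [norm_neg, norm_mul, norm_mul]
    gcongr <;> exact hb y hy θ
  · exact hY.norm.mul_const _
  · refine Eventually.of_forall fun θ y hy => ?_
    have h1 := ((hasDerivAt_id y).sub_const (q θ)).inv (hne y hy θ)
    have h2 := h1.const_mul (Y θ)
    refine h2.congr_deriv ?_
    have := hne y hy θ
    simp only [id]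
    field_simp

/-- Far out, `1 / (z - q)` is the geometric series `∑ q^m z^(-m-1)`, whose terms integrate to the
vanishing moments of `Y`. -/
theorem cauchyTransform_eq_zero_of_lt {Y q : ℝ → ℂ} (hY : Integrable Y angleMeasure)
    (hq : Continuous q) {T : ℝ} (hT0 : 0 ≤ T) (hT : ∀ θ, ‖q θ‖ ≤ T)
    (h0 : ∀ m : ℕ, ∫ θ, Y θ * q θ ^ m ∂angleMeasure = 0) {z : ℂ} (hz : T < ‖z‖) :
    cauchyTransform Y q z = 0 := by
  have hz0 : z ≠ 0 := norm_pos_iff.1 (hT0.trans_lt hz)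
  have hr : T / ‖z‖ < 1 := (div_lt_one (norm_pos_iff.2 hz0)).2 hz
  have hb : ∀ (m : ℕ) θ, ‖Y θ * q θ ^ m * z⁻¹ ^ (m + 1)‖ ≤ ‖Y θ‖ * (‖z‖⁻¹ * (T / ‖z‖) ^ m) := by
    intro m θ
    rw [norm_mul, norm_mul, norm_pow, norm_pow, norm_inv]
    calc ‖Y θ‖ * ‖q θ‖ ^ m * ‖z‖⁻¹ ^ (m + 1) ≤ ‖Y θ‖ * T ^ m * ‖z‖⁻¹ ^ (m + 1) := by
          gcongr
          exact hT θ
      _ = ‖Y θ‖ * (‖z‖⁻¹ * (T / ‖z‖) ^ m) := by rw [div_eq_mul_inv, mul_pow]; ring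
  have hi : ∀ m : ℕ, Integrable (fun θ => Y θ * q θ ^ m * z⁻¹ ^ (m + 1)) angleMeasure := fun m =>
    (hY.norm.mul_const _).mono' ((hY.1.mul (hq.pow m).aestronglyMeasurable).mul
      aestronglyMeasurable_const) (Eventually.of_forall (hb m))
  have hs : Summable fun m : ℕ => ∫ θ, ‖Y θ * q θ ^ m * z⁻¹ ^ (m + 1)‖ ∂angleMeasure := by
    refine Summable.of_nonneg_of_le (fun m => integral_nonneg fun _ => norm_nonneg _) (fun m => ?_)
      ((summable_geometric_of_lt_one (by positivity) hr).mul_left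
        ((∫ θ, ‖Y θ‖ ∂angleMeasure) * ‖z‖⁻¹))
    rw [mul_assoc, ← integral_mul_const]
    exact integral_mono (hi m).norm (hY.norm.mul_const _) (hb m)
  have h1 := hasSum_integral_of_summable_integral_norm hi hs
  have h2 : ∀ m : ℕ, ∫ θ, Y θ * q θ ^ m * z⁻¹ ^ (m + 1) ∂angleMeasure = 0 := fun m => by
    rw [integral_mul_const, h0 m, zero_mul]
  have h3 := h1.unique (hasSum_of_eq hasSum_zero h2)
  rw [← h3, cauchyTransform]
  congr 1
  funext θ
  have hlt : ‖q θ / z‖ < 1 := by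
    rw [norm_div]
    refine lt_of_le_of_lt ?_ hr
    gcongr
    exact hT θ
  have h4 := (hasSum_geometric_of_norm_lt_one hlt).mul_left (Y θ * z⁻¹)
  have h5 : (1 : ℂ) - q θ / z ≠ 0 := by
    intro h
    rw [← sub_eq_zero.1 h, norm_one] at hlt
    exact lt_irrefl _ hlt
  have h6 : Y θ * z⁻¹ * (1 - q θ / z)⁻¹ = Y θ / (z - q θ) := by
    have : (1 : ℂ) - q θ / z = (z - q θ) / z := by field_simp
    rw [this, inv_div]
    field_simp
  rw [h6] at h4
  refine ((hasSum_of_eq h4 fun m => ?_).tsum_eq).symm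
  rw [div_eq_mul_inv, mul_pow]
  ring

theorem isPreconnected_sphere_compl_closedBall :
    IsPreconnected (sphereInv '' (((↑) : ℂ → OnePoint ℂ) '' Metric.ball 0 1)) :=
  (((convex_ball (0 : ℂ) 1).isPreconnected.image _
    OnePoint.continuous_coe.continuousOn).image _ continuous_sphereInv.continuousOn)

theorem mem_sphere_exterior {x : OnePoint ℂ} :
    x ∈ sphereInv '' (((↑) : ℂ → OnePoint ℂ) '' Metric.ball 0 1) ↔
      ∀ w : ℂ, ‖w‖ ≤ 1 → (w : OnePoint ℂ) ≠ x := by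
  constructor
  · rintro ⟨_, ⟨v, hv, rfl⟩, rfl⟩ w hw h
    rw [mem_ball_zero_iff] at hv
    by_cases hv0 : v = 0
    · rw [hv0, sphereInv_zero] at h
      exact OnePoint.coe_ne_infty _ h
    · rw [sphereInv_coe hv0] at h
      have := OnePoint.coe_injective h
      rw [this, norm_inv] at hw
      exact absurd hw (not_le.2 ((one_lt_inv₀ (norm_pos_iff.2 hv0)).2 hv))
  · intro h
    induction x using OnePoint.rec with
    | infty => exact ⟨_, ⟨0, by simp, rfl⟩, sphereInv_zero⟩
    | coe z =>
      have hz : 1 < ‖z‖ := by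
        by_contra h1
        exact h z (not_lt.1 h1) rfl
      have hz0 : z ≠ 0 := norm_pos_iff.1 (one_pos.trans hz)
      refine ⟨_, ⟨z⁻¹, ?_, rfl⟩, ?_⟩
      · rw [mem_ball_zero_iff, norm_inv]
        exact inv_lt_one_of_one_lt₀ hz
      · rw [sphereInv_coe (inv_ne_zero hz0), inv_inv]

/-- The complement of the image of the closed disc under a disc map has no bounded component:
a function that is holomorphic on it and vanishes near infinity vanishes identically. -/
theorem IsDiscMap.eq_zero_of_vanish_near_infty {a : ℂ → ℂ} (ha : IsDiscMap a) {C : ℂ → ℂ}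
    (hC : DifferentiableOn ℂ C (a '' Metric.closedBall 0 1)ᶜ) {T : ℝ}
    (hT : ∀ z, T < ‖z‖ → C z = 0) {z : ℂ} (hz : z ∉ a '' Metric.closedBall 0 1) : C z = 0 := by
  obtain ⟨F, -, hFa⟩ := ha.ext
  have hKc : IsCompact (a '' Metric.closedBall 0 1) :=
    (isCompact_closedBall _ _).image_of_continuousOn (diffContOnCl_unit_iff.1 ha.diffContOnCl).2
  set K := a '' Metric.closedBall 0 1 with hK
  -- The complement of `K` in the sphere is the homeomorphic image of the exterior disc with `∞`,
  -- hence connected. It contains `∞` because `a` is finite on the closed disc.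
  set U := F '' (sphereInv '' (((↑) : ℂ → OnePoint ℂ) '' Metric.ball 0 1)) with hU
  have hUpre : IsPreconnected U :=
    isPreconnected_sphere_compl_closedBall.image _ F.continuous.continuousOn
  have hmemU : ∀ x : OnePoint ℂ, x ∈ U ↔ ∀ w : ℂ, ‖w‖ ≤ 1 → (a w : OnePoint ℂ) ≠ x := by
    intro x
    have : x ∈ U ↔ F.symm x ∈ sphereInv '' (((↑) : ℂ → OnePoint ℂ) '' Metric.ball 0 1) := by
      constructor
      · rintro ⟨y, hy, rfl⟩
        rwa [F.symm_apply_apply]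
      · intro h
        exact ⟨_, h, F.apply_symm_apply x⟩
    rw [this, mem_sphere_exterior]
    refine forall₂_congr fun w hw => ?_
    rw [← hFa w hw, ne_eq, ne_eq, Homeomorph.eq_symm_apply]
  have hUcoe : ∀ z : ℂ, (z : OnePoint ℂ) ∈ U ↔ z ∉ K := by
    intro z
    rw [hmemU]
    constructor
    · rintro h ⟨w, hw, rfl⟩
      exact h w (by simpa using hw) rfl
    · intro h w hw hwz
      exact h ⟨w, by simpa using hw, OnePoint.coe_injective hwz⟩
  set Ĉ : OnePoint ℂ → ℂ := fun x => x.elim 0 C with hCh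
  -- The identity principle on the connected set `U`: `N` is open, contains `∞`, and by isolation of
  -- zeros contains every point of `U` in its closure. The value `0` given to `Ĉ` at `∞` is the
  -- right one, since `C` vanishes nearby.
  set N : Set (OnePoint ℂ) := {x | ∀ᶠ y in 𝓝 x, Ĉ y = 0} with hN
  have hNo : IsOpen N := isOpen_setOfPred_eventually_nhds
  have hNinf : ∞ ∈ N := by
    have h1 : ∀ᶠ y in 𝓝 (∞ : OnePoint ℂ), Ĉ y = 0 := by
      rw [OnePoint.nhds_infty_eq, Filter.coclosedCompact_eq_cocompact, eventually_sup]
      refine ⟨?_, rfl⟩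
      rw [eventually_map]
      filter_upwards [(isCompact_closedBall (0 : ℂ) T).compl_mem_cocompact] with y hy
      refine hT y ?_
      by_contra h
      exact hy (by simpa using h)
    exact h1
  have hNcoe : ∀ z : ℂ, (z : OnePoint ℂ) ∈ N ↔ ∀ᶠ y in 𝓝 z, C y = 0 := by
    intro z
    rw [hN, Set.mem_ofPred_eq, OnePoint.nhds_coe_eq, eventually_map]
    rfl
  have hsub : U ⊆ N := by
    refine hUpre.subset_of_closure_inter_subset hNo ⟨∞, ?_, hNinf⟩ ?_
    · rw [hmemU]
      exact fun w _ => OnePoint.coe_ne_infty _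
    · rintro x ⟨hxN, hxU⟩
      induction x using OnePoint.rec with
      | infty => exact hNinf
      | coe z =>
        rw [hUcoe] at hxU
        have han : AnalyticAt ℂ C z :=
          hC.analyticAt (hKc.isClosed.isOpen_compl.mem_nhds hxU)
        rw [hNcoe]
        refine han.eventually_eq_zero_or_eventually_ne_zero.resolve_right fun hne => ?_
        rw [eventually_nhdsWithin_iff] at hne
        obtain ⟨V, hV, hVo, hzV⟩ := eventually_nhds_iff.1 hne
        obtain ⟨y, hyV, hyN⟩ := mem_closure_iff.1 hxN _ (OnePoint.isOpenMap_coe V hVo)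
          ⟨z, hzV, rfl⟩
        obtain ⟨y, hyV, rfl⟩ := hyV
        rw [hNcoe] at hyN
        have h2 : ∀ᶠ x in 𝓝[≠] y, C x = 0 ∧ x ∈ V := by
          refine nhdsWithin_le_nhds ?_
          filter_upwards [hyN, hVo.mem_nhds hyV] with x h1 h2 using ⟨h1, h2⟩
        by_cases hyz : y = z
        · subst hyz
          obtain ⟨x, ⟨hx1, hx2⟩, hx3⟩ := (h2.and self_mem_nhdsWithin).exists
          exact hV x hx2 hx3 hx1
        · exact hV y hyV hyz hyN.self_of_nhds
  have hzN := hsub ((hUcoe z).2 hz)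
  rw [hNcoe] at hzN
  exact hzN.self_of_nhds

/-- A function on the circle that is orthogonal to the powers of a disc map is orthogonal to the
powers of the coordinate. -/
theorem IsDiscMap.integral_mul_circ_pow_eq_zero {a : ℂ → ℂ} (ha : IsDiscMap a) {ε : ℤ} {Y : ℝ → ℂ}
    (hY : Integrable Y angleMeasure)
    (h0 : ∀ m : ℕ, ∫ θ, Y θ * a (circ ε θ) ^ m ∂angleMeasure = 0) (k : ℕ) :
    ∫ θ, Y θ * circ ε θ ^ k ∂angleMeasure = 0 := by
  obtain ⟨F, hF, hFa⟩ := ha.ext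
  obtain ⟨a₁, -, ha₁0, ha₁, -⟩ := ha.exists_deriv
  have hac := (diffContOnCl_unit_iff.1 ha.diffContOnCl).2
  have hKc : IsCompact (a '' Metric.closedBall 0 1) :=
    (isCompact_closedBall _ _).image_of_continuousOn hac
  set K := a '' Metric.closedBall 0 1 with hK
  set q : ℝ → ℂ := fun θ => a (circ ε θ) with hq
  have hqc : Continuous q := DiffContOnCl_continuous_circ ha.diffContOnCl ε
  have hqK : ∀ θ, q θ ∈ K := fun θ => ⟨_, circ_mem_closedBall ε θ, rfl⟩
  obtain ⟨T, hT⟩ := hKc.isBounded.exists_norm_le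
  have hT0 : 0 ≤ T := (norm_nonneg _).trans (hT _ (hqK 0))
  have hvan : ∀ z ∉ K, cauchyTransform Y q z = 0 := fun z hz =>
    ha.eq_zero_of_vanish_near_infty (differentiableOn_cauchyTransform hY hqc hKc.isClosed hqK)
      (fun z hz => cauchyTransform_eq_zero_of_lt hY hqc hT0 (fun θ => hT _ (hqK θ)) h0 hz) hz
  have hKdom : K ⊆ planeDom F.symm := by
    rintro _ ⟨w, hw, rfl⟩
    rw [mem_closedBall_zero_iff] at hw
    rw [← planeMap_eq_of_ext hFa hw]
    exact planeMap_mem_planeDom (mem_planeDom_of_ext hFa hw)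
  have hBa : ∀ w : ℂ, ‖w‖ ≤ 1 → planeMap F.symm (a w) = w := fun w hw => by
    rw [← planeMap_eq_of_ext hFa hw]
    exact planeMap_symm_planeMap (mem_planeDom_of_ext hFa hw)
  obtain ⟨χ, hχ, hχc, hχO, hχ1, -⟩ := exists_bump hKc (isOpen_planeDom F.symm) hKdom
  set B := planeMap F.symm with hB
  have hBcd : ∀ z ∈ planeDom F.symm, ContDiffAt ℝ 1 B z := fun z hz =>
    hF.2.contDiffAt_planeMap hz
  -- A compactly supported `C¹` function which on `K` is the `k`-th power of the inverse map; its
  -- value at `q θ` is `circ ε θ ^ k`.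
  set Q : ℂ → ℂ := fun z => χ z • B z ^ k with hQ
  have hQcd : ContDiff ℝ 1 Q := by
    refine contDiff_iff_contDiffAt.2 fun z => ?_
    by_cases hz : z ∈ planeDom F.symm
    · exact hχ.contDiffAt.smul ((hBcd z hz).pow k)
    · have hz' : z ∉ tsupport χ := fun h => hz (hχO h)
      refine contDiffAt_const (c := 0).congr_of_eventuallyEq ?_
      filter_upwards [(isClosed_tsupport χ).isOpen_compl.mem_nhds hz'] with y hy
      simp only [hQ, image_eq_zero_of_notMem_tsupport hy, zero_smul]
  have hQc : HasCompactSupport Q := hχc.smul_right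
  have hdb0 : ∀ z ∈ a '' Metric.ball 0 1, dbar Q z = 0 := by
    rintro _ ⟨w, hw, rfl⟩
    rw [mem_ball_zero_iff] at hw
    have hawK : a w ∈ K := ⟨w, by simpa using hw.le, rfl⟩
    have hBc : ContinuousAt B (a w) := (hBcd _ (hKdom hawK)).continuousAt
    have hBw : B (a w) = w := hBa w hw.le
    have hleft : ∀ᶠ y in 𝓝 (a w), a (B y) = y := by
      have h1 : ∀ᶠ y in 𝓝 (a w), B y ∈ Metric.ball (0 : ℂ) 1 :=
        hBc.eventually (Metric.isOpen_ball.mem_nhds (by rw [hBw]; simpa using hw))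
      filter_upwards [h1, (isOpen_planeDom F.symm).mem_nhds (hKdom hawK)] with y hy1 hy2
      rw [mem_ball_zero_iff] at hy1
      rw [← planeMap_eq_of_ext hFa hy1.le]
      have := planeMap_symm_planeMap hy2
      rwa [Homeomorph.symm_symm] at this
    -- The inverse of `a` is holomorphic on the image of the open disc, so `∂Q/∂z̄ = 0` there.
    have hBd : HasDerivAt B (a₁ w)⁻¹ (a w) :=
      HasDerivAt.of_local_left_inverse hBc (by rw [hBw]; exact ha₁ w hw) (ha₁0 w hw.le) hleft
    refine dbar_eq_zero_of_differentiableAt ?_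
    refine (hBd.differentiableAt.pow k).congr_of_eventuallyEq ?_
    filter_upwards [hχ1.filter_mono (nhds_le_nhdsSet hawK)] with y hy
    simp only [hQ, hy, one_smul, Pi.pow_apply]
  -- Continuity of `dbar Q` extends the vanishing to the boundary. Thus `dbar Q` lives only off `K`,
  -- precisely where the Cauchy transform of `Y` is zero.
  have hdbK : ∀ z ∈ K, dbar Q z = 0 := by
    have hcl : K ⊆ closure (a '' Metric.ball 0 1) := by
      rw [hK, ← closure_ball (0 : ℂ) one_ne_zero]
      exact ContinuousOn.image_closure (by rwa [closure_ball _ one_ne_zero])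
    intro z hz
    exact closure_minimal (s := a '' Metric.ball 0 1) (t := {z | dbar Q z = 0}) hdb0
      (isClosed_eq (continuous_dbar hQcd) continuous_const) (hcl hz)
  have hfin := integral_mul_eq_zero_of_cauchyTransform hY hqc.measurable
    (fun θ => hT _ (hqK θ)) hQcd hQc (fun ζ hζ => hvan ζ fun hζK => hζ (hdbK ζ hζK))
  rw [← hfin]
  congr 1
  funext θ
  have h1 : χ (a (circ ε θ)) = 1 := hχ1.self_of_nhdsSet _ (hqK θ)
  simp only [hQ, hq, h1, one_smul, hBa _ (norm_circ ε θ).le]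
/-! ### Conformal pairs as pairs of disc maps -/

theorem setOf_norm_lt_one : {w : ℂ | ‖w‖ < 1} = Metric.ball 0 1 := by
  ext w
  simp

/-- The disc map `ζ ↦ 1 / g(1 / ζ)`. -/
def ConformalPair.ginv (p : ConformalPair) (ζ : ℂ) : ℂ := if ζ = 0 then 0 else (p.g ζ⁻¹)⁻¹

theorem ConformalPair.ginv_of_ne (p : ConformalPair) {ζ : ℂ} (hζ : ζ ≠ 0) :
    p.ginv ζ = (p.g ζ⁻¹)⁻¹ := if_neg hζ

theorem ConformalPair.isDiscMap_f (p : ConformalPair) : IsDiscMap p.f where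
  holo := by rw [← setOf_norm_lt_one]; exact p.f_holo
  ext := p.f_ext
  zero := p.f_zero

theorem one_le_norm_inv {w : ℂ} (hw : ‖w‖ ≤ 1) (h0 : w ≠ 0) : 1 ≤ ‖w⁻¹‖ := by
  rw [norm_inv]
  exact (one_le_inv₀ (norm_pos_iff.2 h0)).2 hw

theorem norm_inv_le_one {w : ℂ} (hw : 1 ≤ ‖w‖) : ‖w⁻¹‖ ≤ 1 := by
  rw [norm_inv]
  exact inv_le_one_of_one_le₀ hw

theorem ConformalPair.isDiscMap_ginv (p : ConformalPair) : IsDiscMap p.ginv := by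
  obtain ⟨G, hG, hGinf, hGg⟩ := p.g_ext
  have hext : ∀ w : ℂ, ‖w‖ ≤ 1 → sphereConj G (w : OnePoint ℂ) = (p.ginv w : OnePoint ℂ) := by
    intro w hw
    rw [sphereConj_apply]
    by_cases h0 : w = 0
    · rw [h0, sphereInv_zero, hGinf, sphereInv_infty, ginv, if_pos rfl]
    · rw [sphereInv_coe h0, hGg _ (one_le_norm_inv hw h0),
        sphereInv_coe (p.g_ne_zero _ (one_le_norm_inv hw h0)), p.ginv_of_ne h0]
  refine ⟨?_, ⟨sphereConj G, hG.sphereConj, hext⟩, if_pos rfl⟩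
  have h0 : Metric.ball (0 : ℂ) 1 ∈ 𝓝 0 := Metric.ball_mem_nhds _ one_pos
  -- The singularity of `1 / g(1/ζ)` at `0` is removable: continuity there comes from the extension
  -- of `g` fixing `∞`.
  refine (Complex.differentiableOn_compl_singleton_and_continuousAt_iff h0).1 ⟨?_, ?_⟩
  · intro w hw
    have hw0 : w ≠ 0 := hw.2
    have hw1 : ‖w‖ < 1 := by simpa using hw.1
    have hlt : 1 < ‖w⁻¹‖ := by
      rw [norm_inv]
      exact (one_lt_inv₀ (norm_pos_iff.2 hw0)).2 hw1
    have hop : IsOpen {w : ℂ | 1 < ‖w‖} := isOpen_lt continuous_const continuous_norm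
    have hgd : DifferentiableAt ℂ p.g w⁻¹ := p.g_holo.differentiableAt (hop.mem_nhds hlt)
    have h1 : DifferentiableAt ℂ (fun w => (p.g w⁻¹)⁻¹) w :=
      (hgd.comp w (differentiableAt_inv hw0)).inv (p.g_ne_zero _ hlt.le)
    refine (h1.congr_of_eventuallyEq ?_).differentiableWithinAt
    filter_upwards [isOpen_ne.mem_nhds hw0] with y hy using p.ginv_of_ne hy
  · have h1 := (hG.sphereConj.1.contDiffAt_planeMap
      (mem_planeDom_of_ext hext (w := 0) (by simp))).continuousAt
    refine h1.congr ?_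
    filter_upwards [h0] with y hy
    rw [mem_ball_zero_iff] at hy
    exact planeMap_eq_of_ext hext hy.le

theorem IsDiscMap.hasDerivAt_zero {a : ℂ → ℂ} (ha : IsDiscMap a) : HasDerivAt a (deriv a 0) 0 :=
  (ha.holo.differentiableAt (Metric.ball_mem_nhds _ one_pos)).hasDerivAt

theorem IsDiscMap.deriv_zero_ne_zero {a : ℂ → ℂ} (ha : IsDiscMap a) : deriv a 0 ≠ 0 := by
  obtain ⟨a₁, -, h0, h1, -⟩ := ha.exists_deriv
  rw [(h1 0 (by simp)).deriv]
  exact h0 0 (by simp)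

theorem IsDiscMap.tendsto_div {a : ℂ → ℂ} (ha : IsDiscMap a) :
    Tendsto (fun w : ℂ => a w⁻¹ / w⁻¹) (Bornology.cobounded ℂ) (𝓝 (deriv a 0)) := by
  have h1 := (hasDerivAt_iff_tendsto_slope.1 ha.hasDerivAt_zero).comp
    (Filter.tendsto_inv₀_cobounded' (α := ℂ))
  refine h1.congr fun w => ?_
  simp [slope_def_field, ha.zero]

/-- The form taken by the normalization `f'(0) g'(∞) = 1`. It is later responsible for the balance
of constant terms in the velocities. -/
theorem ConformalPair.deriv_ginv_zero (p : ConformalPair) : deriv p.ginv 0 = deriv p.f 0 := by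
  obtain ⟨b, hb, hab⟩ := p.normalized
  have hb0 : b ≠ 0 := right_ne_zero_of_mul_eq_one hab
  have h1 := p.isDiscMap_ginv.tendsto_div
  have h2 := hb.inv₀ hb0
  have h3 : deriv p.ginv 0 = b⁻¹ := by
    refine tendsto_nhds_unique h1 (h2.congr' ?_)
    have h4 : ∀ᶠ w : ℂ in Bornology.cobounded ℂ, w ≠ 0 := by
      rw [Metric.cobounded_eq_cocompact]
      filter_upwards [(isCompact_singleton (x := (0 : ℂ))).compl_mem_cocompact] with z hz using hz
    filter_upwards [h4] with w hw
    rw [p.ginv_of_ne (inv_ne_zero hw), inv_inv, inv_div, div_inv_eq_mul]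
    field_simp
  rw [h3, eq_comm, eq_inv_of_mul_eq_one_left hab]

/-- The conformal pair made of two disc maps with the same derivative at the origin. -/
def mkPair (a b : ℂ → ℂ) (ha : IsDiscMap a) (hb : IsDiscMap b) (hab : deriv a 0 = deriv b 0) :
    ConformalPair where
  f := a
  g := fun w => (b w⁻¹)⁻¹
  f_holo := by rw [setOf_norm_lt_one]; exact ha.holo
  f_ext := ha.ext
  f_zero := ha.zero
  g_holo := by
    intro w hw
    have hw1 : 1 < ‖w‖ := hw
    have hw0 : w ≠ 0 := norm_pos_iff.1 (one_pos.trans hw1)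
    have hlt : ‖w⁻¹‖ < 1 := by
      rw [norm_inv]
      exact inv_lt_one_of_one_lt₀ hw1
    have h1 : DifferentiableAt ℂ b w⁻¹ :=
      hb.holo.differentiableAt (Metric.isOpen_ball.mem_nhds (by simpa using hlt))
    exact ((h1.comp w (differentiableAt_inv hw0)).inv
      (hb.ne_zero hlt.le (inv_ne_zero hw0))).differentiableWithinAt
  g_ext := by
    obtain ⟨F, hF, hFb⟩ := hb.ext
    refine ⟨sphereConj F, hF.sphereConj, ?_, fun w hw => ?_⟩
    · rw [sphereConj_apply, sphereInv_infty, hFb 0 (by simp), hb.zero, sphereInv_zero]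
    · have hw0 : w ≠ 0 := norm_pos_iff.1 (one_pos.trans_le hw)
      rw [sphereConj_apply, sphereInv_coe hw0, hFb _ (norm_inv_le_one hw),
        sphereInv_coe (hb.ne_zero (norm_inv_le_one hw) (inv_ne_zero hw0))]
  g_ne_zero := fun w hw => inv_ne_zero (hb.ne_zero (norm_inv_le_one hw)
    (inv_ne_zero (norm_pos_iff.1 (one_pos.trans_le hw))))
  normalized := by
    refine ⟨(deriv b 0)⁻¹, ?_, ?_⟩
    · refine (hb.tendsto_div.inv₀ hb.deriv_zero_ne_zero).congr fun w => ?_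
      rw [inv_div, div_eq_mul_inv, mul_comm, div_eq_mul_inv]
    · rw [hab, mul_inv_cancel₀ hb.deriv_zero_ne_zero]

/-! ### Boundary values -/

theorem ConformalPair.fb_eq (p : ConformalPair) (θ : ℝ) : p.fb θ = p.f (circ 1 θ) := by
  rw [circ_one]; rfl

theorem ConformalPair.gb_eq (p : ConformalPair) (θ : ℝ) : p.gb θ = (p.ginv (circ (-1) θ))⁻¹ := by
  rw [p.ginv_of_ne (circ_ne_zero _ _), inv_inv, circ_neg, inv_inv, circ_one]; rfl

theorem ConformalPair.ginv_circ (p : ConformalPair) (θ : ℝ) :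
    p.ginv (circ (-1) θ) = (p.gb θ)⁻¹ := by rw [p.gb_eq, inv_inv]

theorem ConformalPair.fb_ne_zero (p : ConformalPair) (θ : ℝ) : p.fb θ ≠ 0 := by
  rw [p.fb_eq]
  exact p.isDiscMap_f.ne_zero (norm_circ 1 θ).le (circ_ne_zero 1 θ)

theorem ConformalPair.gb_ne_zero (p : ConformalPair) (θ : ℝ) : p.gb θ ≠ 0 :=
  p.g_ne_zero _ (by rw [← circ_one, norm_circ])

/-- The boundary values of a disc map form a `C¹` immersed curve. -/
theorem IsDiscMap.boundary {a : ℂ → ℂ} (ha : IsDiscMap a) {ε : ℤ} (hε : ε = 1 ∨ ε = -1) :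
    Differentiable ℝ (fun θ => a (circ ε θ)) ∧ Continuous (deriv fun θ => a (circ ε θ)) ∧
      ∀ θ, deriv (fun θ => a (circ ε θ)) θ ≠ 0 := by
  obtain ⟨a₁, h1, h2, -, h3⟩ := ha.exists_deriv
  have hd : deriv (fun θ => a (circ ε θ)) =
      fun θ => ε * Complex.I * circ ε θ * a₁ (circ ε θ) := funext fun θ => (h3 ε θ).deriv
  refine ⟨fun θ => (h3 ε θ).differentiableAt, ?_, fun θ => ?_⟩
  · rw [hd]
    exact (continuous_const.mul (continuous_circ ε)).mul (DiffContOnCl_continuous_circ h1 ε)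
  · rw [hd]
    have : (ε : ℂ) ≠ 0 := by rcases hε with rfl | rfl <;> norm_num
    exact mul_ne_zero (mul_ne_zero (mul_ne_zero this Complex.I_ne_zero) (circ_ne_zero ε θ))
      (h2 _ (norm_circ ε θ).le)

theorem ConformalPair.fb_eq_fun (p : ConformalPair) : p.fb = fun θ => p.f (circ 1 θ) :=
  funext p.fb_eq

theorem ConformalPair.gb_eq_fun (p : ConformalPair) :
    p.gb = fun θ => (p.ginv (circ (-1) θ))⁻¹ := funext p.gb_eq

theorem ConformalPair.differentiable_fb (p : ConformalPair) : Differentiable ℝ p.fb := by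
  rw [p.fb_eq_fun]; exact (p.isDiscMap_f.boundary (Or.inl rfl)).1

theorem ConformalPair.continuous_deriv_fb (p : ConformalPair) : Continuous (deriv p.fb) := by
  rw [p.fb_eq_fun]; exact (p.isDiscMap_f.boundary (Or.inl rfl)).2.1

theorem ConformalPair.deriv_fb_ne_zero (p : ConformalPair) (θ : ℝ) : deriv p.fb θ ≠ 0 := by
  rw [p.fb_eq_fun]; exact (p.isDiscMap_f.boundary (Or.inl rfl)).2.2 θ

theorem ConformalPair.ginv_circ_ne_zero (p : ConformalPair) (θ : ℝ) : p.ginv (circ (-1) θ) ≠ 0 := by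
  rw [p.ginv_circ]; exact inv_ne_zero (p.gb_ne_zero θ)

theorem ConformalPair.hasDerivAt_gb (p : ConformalPair) (θ : ℝ) :
    HasDerivAt p.gb (-(deriv (fun θ => p.ginv (circ (-1) θ)) θ) / p.ginv (circ (-1) θ) ^ 2) θ := by
  rw [p.gb_eq_fun]
  exact ((p.isDiscMap_ginv.boundary (Or.inr rfl)).1 θ).hasDerivAt.inv (p.ginv_circ_ne_zero θ)

theorem ConformalPair.differentiable_gb (p : ConformalPair) : Differentiable ℝ p.gb :=
  fun θ => (p.hasDerivAt_gb θ).differentiableAt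

theorem ConformalPair.deriv_gb (p : ConformalPair) (θ : ℝ) :
    deriv p.gb θ = -(deriv (fun θ => p.ginv (circ (-1) θ)) θ) * p.gb θ ^ 2 := by
  rw [(p.hasDerivAt_gb θ).deriv, p.ginv_circ, inv_pow, div_inv_eq_mul]

theorem ConformalPair.continuous_deriv_gb (p : ConformalPair) : Continuous (deriv p.gb) := by
  rw [funext p.deriv_gb]
  exact (p.isDiscMap_ginv.boundary (Or.inr rfl)).2.1.neg.mul (p.differentiable_gb.continuous.pow 2)

theorem ConformalPair.deriv_gb_ne_zero (p : ConformalPair) (θ : ℝ) : deriv p.gb θ ≠ 0 := by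
  rw [p.deriv_gb]
  exact mul_ne_zero (neg_ne_zero.2 ((p.isDiscMap_ginv.boundary (Or.inr rfl)).2.2 θ))
    (pow_ne_zero _ (p.gb_ne_zero θ))

theorem ConformalPair.fb_two_pi (p : ConformalPair) : p.fb (2 * Real.pi) = p.fb 0 := by
  have := circ_periodic 1 0
  rw [zero_add] at this
  rw [p.fb_eq, p.fb_eq, this]

theorem ConformalPair.gb_two_pi (p : ConformalPair) : p.gb (2 * Real.pi) = p.gb 0 := by
  have := circ_periodic (-1) 0
  rw [zero_add] at this
  rw [p.gb_eq, p.gb_eq, this]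

/-! ### The derivatives of the time variables -/

theorem L2Curve.zpow {u : ℂ → ℝ → ℂ} {φ : ℝ → ℂ} (hu : L2Curve u φ) (h0 : ∀ s θ, u s θ ≠ 0)
    (k : ℤ) : L2Curve (fun s θ => u s θ ^ k) (fun θ => k * u 0 θ ^ (k - 1) * φ θ) := by
  obtain ⟨n, rfl | rfl⟩ := k.eq_nat_or_neg
  · refine (hu.pow n).congr (fun s θ => (zpow_natCast _ n).symm) fun θ => ?_
    rcases n with _ | n
    · simp
    · rw [show ((n + 1 : ℕ) : ℤ) - 1 = (n : ℕ) by push_cast; ring, zpow_natCast]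
      simp
  · refine ((hu.inv h0).pow n).congr (fun s θ => by rw [zpow_neg, zpow_natCast, inv_pow]) fun θ => ?_
    rcases n with _ | n
    · simp
    · rw [show -((n + 1 : ℕ) : ℤ) - 1 = -((n + 2 : ℕ) : ℤ) by push_cast; ring, zpow_neg,
        zpow_natCast, Nat.add_sub_cancel]
      have := h0 0 θ
      rw [inv_pow]
      push_cast
      field_simp
      ring

/-- The velocity of `B` is only in `L²` and need not be differentiable along the circle. Integration
by parts puts that derivative on `A 0`: the increment is the integral of `(A_s - A_0) dB_s - (B_s -
B_0) dA_0`. Uniform convergence of `dB_s` takes care of the first term. -/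
theorem hasDerivAt_lineIntegral {A B : ℂ → ℝ → ℂ} {α β A' : ℝ → ℂ} (hA : L2Curve A α)
    (hB : L2Curve B β) (hA' : ∀ θ, HasDerivAt (A 0) (A' θ) θ) (hA'c : Continuous A')
    (hBd : ∀ s, Differentiable ℝ (B s)) (hBc : ∀ s, Continuous (deriv (B s)))
    (hBu : TendstoUniformly (fun s => deriv (B s)) (deriv (B 0)) (𝓝 0))
    (hAp : A 0 (2 * Real.pi) = A 0 0) (hBp : ∀ s, B s (2 * Real.pi) = B s 0) :
    HasDerivAt (fun s => lineIntegral (A s) (B s))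
      ((2 * Real.pi * Complex.I)⁻¹ *
        ∫ θ, (α θ * deriv (B 0) θ - β θ * A' θ) ∂angleMeasure) 0 := by
  refine HasDerivAt.const_mul _ ?_
  rw [hasDerivAt_iff_tendsto_slope]
  have hBu' : TendstoLocallyUniformly (fun s => deriv (B s)) (deriv (B 0)) (𝓝[≠] 0) := by
    intro v hv x
    exact ⟨Set.univ, univ_mem, nhdsWithin_le_nhds ((hBu v hv).mono fun s hs y _ => hs y)⟩
  have h1 := (hA.velocity.mul hBu' (Eventually.of_forall hBc) (hBc 0)).integral
  have h2 := (hB.velocity.const_mul hA'c).integral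
  have h3 := h1.sub h2
  have i1 : Integrable (fun θ => deriv (B 0) θ * α θ) angleMeasure :=
    integrable_angle (memLp_continuous_mul hA.memLp (hBc 0))
  have i2 : Integrable (fun θ => A' θ * β θ) angleMeasure :=
    integrable_angle (memLp_continuous_mul hB.memLp hA'c)
  rw [← integral_sub i1 i2] at h3
  have e1 : (fun θ => α θ * deriv (B 0) θ - β θ * A' θ) =
      fun θ => deriv (B 0) θ * α θ - A' θ * β θ := by funext θ; ring
  rw [e1]
  refine h3.congr fun s => ?_
  have ci : ∀ {φ : ℝ → ℂ}, Continuous φ → Integrable φ angleMeasure := fun h =>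
    integrable_angle (memLp_of_continuous h 2)
  have parts : ∀ s, ∫ θ, A 0 θ * deriv (B s) θ ∂angleMeasure =
      -∫ θ, A' θ * B s θ ∂angleMeasure := by
    intro s
    have := intervalIntegral.integral_mul_deriv_eq_deriv_mul (a := 0) (b := 2 * Real.pi)
      (u := A 0) (v := B s) (u' := A') (v' := deriv (B s)) (fun θ _ => hA' θ)
      (fun θ _ => (hBd s θ).hasDerivAt) (hA'c.intervalIntegrable _ _)
      ((hBc s).intervalIntegrable _ _)
    rw [hAp, hBp s, sub_self, zero_sub] at this
    rwa [intervalIntegral_eq_angleMeasure, intervalIntegral_eq_angleMeasure] at this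
  have f1 : ∫ θ, deriv (B s) θ * ((A s θ - A 0 θ) / s) ∂angleMeasure =
      (∫ θ, A s θ * deriv (B s) θ ∂angleMeasure - ∫ θ, A 0 θ * deriv (B s) θ ∂angleMeasure) / s := by
    have j : ∀ t, Integrable (fun θ => A t θ * deriv (B s) θ) angleMeasure := fun t =>
      ci ((hA.continuous t).mul (hBc s))
    rw [← integral_sub (j s) (j 0), ← integral_div]
    congr 1
    funext θ
    ring
  have f2 : ∫ θ, A' θ * ((B s θ - B 0 θ) / s) ∂angleMeasure =
      (∫ θ, A' θ * B s θ ∂angleMeasure - ∫ θ, A' θ * B 0 θ ∂angleMeasure) / s := by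
    have j : ∀ t, Integrable (fun θ => A' θ * B t θ) angleMeasure := fun t =>
      ci (hA'c.mul (hB.continuous t))
    rw [← integral_sub (j s) (j 0), ← integral_div]
    congr 1
    funext θ
    ring
  rw [f1, f2, parts s, slope_def_field, intervalIntegral_eq_angleMeasure,
    intervalIntegral_eq_angleMeasure, parts 0, sub_zero]
  ring

theorem IsCurveThrough.exists_l2Curve {p : ConformalPair} {c : ℂ → ConformalPair}
    (h : IsCurveThrough p c) :
    ∃ φ γ : ℝ → ℂ, L2Curve (fun s => (c s).fb) φ ∧ L2Curve (fun s => (c s).gb) γ := by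
  obtain ⟨rfl, hf, hg, ⟨φ, hφ, hφt⟩, ⟨γ, hγ, hγt⟩⟩ := h
  have hm : ∀ (u : ℂ → ℝ → ℂ), (∀ s, Continuous (u s)) →
      ∀ᶠ s in 𝓝[≠] (0 : ℂ), MemLp (fun θ => (u s θ - u 0 θ) / s) 2 angleMeasure := fun u hu =>
    Eventually.of_forall fun s => memLp_of_continuous (((hu s).sub (hu 0)).div_const s) 2
  have hfc : ∀ s, Continuous (c s).fb := fun s => (c s).differentiable_fb.continuous
  have hgc : ∀ s, Continuous (c s).gb := fun s => (c s).differentiable_gb.continuous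
  exact ⟨φ, γ, ⟨hfc, hf.1.tendstoLocallyUniformly, hm _ hfc, hφ, hφt⟩,
    ⟨hgc, hg.1.tendstoLocallyUniformly, hm _ hgc, hγ, hγt⟩⟩

/-- The weight against which the variation of the pair is integrated in `δ t_m`. -/
def timeWeight (m : ℤ) (p : ConformalPair) (θ : ℝ) : ℂ :=
  if 0 ≤ m then p.gb θ ^ (-m) else p.fb θ ^ (-m)

/-- The density of the variation of a pair with boundary variations `φ` and `γ`. -/
def variation (p : ConformalPair) (φ γ : ℝ → ℂ) (θ : ℝ) : ℂ :=
  -Complex.I * (γ θ * deriv p.fb θ - φ θ * deriv p.gb θ) / p.fb θ ^ 2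

/-- In `δA dB - δB dA` the contributions of differentiating the power of `g` (if `m ≥ 0`) or of `f`
(if `m < 0`) cancel. What is left is a weight depending on `m` times a density that does not depend
on `m`, which turns the determination of velocities into a linear duality problem. -/
theorem hasDerivAt_time {c : ℂ → ConformalPair} (h : IsCurveThrough (c 0) c)
    {φ γ : ℝ → ℂ} (hφ : L2Curve (fun s => (c s).fb) φ) (hγ : L2Curve (fun s => (c s).gb) γ) (m : ℤ) :
    HasDerivAt (fun s => time m (c s)) ((if m = 0 then 1 else (m : ℂ)⁻¹) *
      fc 0 (fun θ => timeWeight m (c 0) θ * variation (c 0) φ γ θ)) 0 := by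
  obtain ⟨-, hf, hg, -, -⟩ := h
  have hf0 : ∀ s θ, (c s).fb θ ≠ 0 := fun s θ => (c s).fb_ne_zero θ
  have hg0 : ∀ s θ, (c s).gb θ ≠ 0 := fun s θ => (c s).gb_ne_zero θ
  have hfd : ∀ θ, HasDerivAt (c 0).fb (deriv (c 0).fb θ) θ := fun θ =>
    ((c 0).differentiable_fb θ).hasDerivAt
  have hgd : ∀ θ, HasDerivAt (c 0).gb (deriv (c 0).gb θ) θ := fun θ =>
    ((c 0).differentiable_gb θ).hasDerivAt
  have zder : ∀ {u : ℝ → ℂ} {u' : ℂ} {θ : ℝ} (k : ℤ), HasDerivAt u u' θ → u θ ≠ 0 →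
      HasDerivAt (fun θ => u θ ^ k) (k * u θ ^ (k - 1) * u') θ := fun k hu h0 =>
    (hasDerivAt_zpow k _ (Or.inl h0)).comp _ hu
  have hfcont := (c 0).differentiable_fb.continuous
  have hgcont := (c 0).differentiable_gb.continuous
  have hfi : Continuous fun θ => ((c 0).fb θ)⁻¹ := hfcont.inv₀ (hf0 0)
  have hfz : ∀ k : ℤ, Continuous fun θ => (c 0).fb θ ^ k := fun k =>
    hfcont.zpow₀ k fun θ => Or.inl (hf0 0 θ)
  have hgz : ∀ k : ℤ, Continuous fun θ => (c 0).gb θ ^ k := fun k =>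
    hgcont.zpow₀ k fun θ => Or.inl (hg0 0 θ)
  have h2π : (2 * Real.pi : ℂ) ≠ 0 := by exact_mod_cast (by positivity : 2 * Real.pi ≠ 0)
  -- Conversion from `(2πi)⁻¹ ∫` to the mean value; it explains the factor `-i` in `variation`.
  have key : ∀ {Z W : ℝ → ℂ}, (∀ θ, Z θ = Complex.I * W θ) →
      (2 * Real.pi * Complex.I)⁻¹ * ∫ θ, Z θ ∂angleMeasure = fc 0 W := by
    intro Z W hZW
    simp only [hZW, integral_const_mul, fc, neg_zero, circ_zero, mul_one, mul_inv]
    rw [mul_assoc, ← mul_assoc _ Complex.I, inv_mul_cancel₀ Complex.I_ne_zero, one_mul]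
  have hI := Complex.I_mul_I
  rcases le_or_gt 0 m with hm | hm
  · have hA := (hγ.zpow hg0 (-m)).mul (hφ.inv hf0)
    have hA' : ∀ θ, HasDerivAt (fun θ => (c 0).gb θ ^ (-m) * ((c 0).fb θ)⁻¹)
        (((-m : ℤ) : ℂ) * (c 0).gb θ ^ (-m - 1) * deriv (c 0).gb θ * ((c 0).fb θ)⁻¹ +
          (c 0).gb θ ^ (-m) * (-(((c 0).fb θ)⁻¹ * ((c 0).fb θ)⁻¹) * deriv (c 0).fb θ)) θ := by
      intro θ
      refine ((zder (-m) (hgd θ) (hg0 0 θ)).mul ((hfd θ).inv (hf0 0 θ))).congr_deriv ?_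
      have := hf0 0 θ
      simp only [Pi.inv_apply]
      field_simp
    have hL := hasDerivAt_lineIntegral hA hγ hA' ((((continuous_const.mul (hgz _)).mul
      (c 0).continuous_deriv_gb).mul hfi).add ((hgz _).mul ((hfi.mul hfi).neg.mul
      (c 0).continuous_deriv_fb))) (fun s => (c s).differentiable_gb)
      (fun s => (c s).continuous_deriv_gb) hg.2
      (by simp only [(c 0).fb_two_pi, (c 0).gb_two_pi]) (fun s => (c s).gb_two_pi)
    have hval := key (Z := fun θ => ((c 0).gb θ ^ (-m) *
        (-(((c 0).fb θ)⁻¹ * ((c 0).fb θ)⁻¹) * φ θ) +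
        ((c 0).fb θ)⁻¹ * (((-m : ℤ) : ℂ) * (c 0).gb θ ^ (-m - 1) * γ θ)) * deriv (c 0).gb θ -
        γ θ * (((-m : ℤ) : ℂ) * (c 0).gb θ ^ (-m - 1) * deriv (c 0).gb θ * ((c 0).fb θ)⁻¹ +
          (c 0).gb θ ^ (-m) * (-(((c 0).fb θ)⁻¹ * ((c 0).fb θ)⁻¹) * deriv (c 0).fb θ)))
      (W := fun θ => timeWeight m (c 0) θ * variation (c 0) φ γ θ) (fun θ => by
        rw [timeWeight, if_pos hm, variation]
        have := hf0 0 θ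
        field_simp
        linear_combination (γ θ * deriv (c 0).fb θ - φ θ * deriv (c 0).gb θ) *
          (c 0).gb θ ^ (-m) * hI)
    rw [hval] at hL
    refine (hL.const_mul (if m = 0 then 1 else (m : ℂ)⁻¹)).congr_of_eventuallyEq
      (Eventually.of_forall fun s => ?_)
    unfold time
    rcases eq_or_lt_of_le hm with rfl | hm'
    · simp
    · simp only [hm'.ne', if_false, hm', if_true, div_eq_mul_inv]
  · have hA := hγ.mul (hφ.zpow hf0 (-m - 2))
    have hA' : ∀ θ, HasDerivAt (fun θ => (c 0).gb θ * (c 0).fb θ ^ (-m - 2))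
        (deriv (c 0).gb θ * (c 0).fb θ ^ (-m - 2) + (c 0).gb θ * (((-m - 2 : ℤ) : ℂ) *
          (c 0).fb θ ^ (-m - 2 - 1) * deriv (c 0).fb θ)) θ := fun θ =>
      (hgd θ).mul (zder (-m - 2) (hfd θ) (hf0 0 θ))
    have hL := hasDerivAt_lineIntegral hA hφ hA' (((c 0).continuous_deriv_gb.mul (hfz _)).add
      (hgcont.mul ((continuous_const.mul (hfz _)).mul (c 0).continuous_deriv_fb)))
      (fun s => (c s).differentiable_fb) (fun s => (c s).continuous_deriv_fb) hf.2
      (by simp only [(c 0).fb_two_pi, (c 0).gb_two_pi]) (fun s => (c s).fb_two_pi)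
    have hval := key (Z := fun θ => ((c 0).gb θ * (((-m - 2 : ℤ) : ℂ) *
          (c 0).fb θ ^ (-m - 2 - 1) * φ θ) + (c 0).fb θ ^ (-m - 2) * γ θ) * deriv (c 0).fb θ -
        φ θ * (deriv (c 0).gb θ * (c 0).fb θ ^ (-m - 2) + (c 0).gb θ * (((-m - 2 : ℤ) : ℂ) *
          (c 0).fb θ ^ (-m - 2 - 1) * deriv (c 0).fb θ)))
      (W := fun θ => timeWeight m (c 0) θ * variation (c 0) φ γ θ) (fun θ => by
        rw [timeWeight, if_neg (not_le.2 hm), variation]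
        have h0 := hf0 0 θ
        have : (c 0).fb θ ^ (-m - 2) = (c 0).fb θ ^ (-m) / (c 0).fb θ ^ 2 := by
          rw [zpow_sub₀ h0]; norm_cast
        rw [this]
        field_simp
        linear_combination (γ θ * deriv (c 0).fb θ - φ θ * deriv (c 0).gb θ) *
          (c 0).fb θ ^ (-m) * hI)
    rw [hval] at hL
    refine (hL.const_mul (if m = 0 then 1 else (m : ℂ)⁻¹)).congr_of_eventuallyEq
      (Eventually.of_forall fun s => ?_)
    unfold time
    simp only [hm.ne, if_false, not_lt.2 hm.le]

/-! ### Fourier coefficients of boundary values -/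

theorem fc_deriv {B B' : ℝ → ℂ} (hB : ∀ θ, HasDerivAt B (B' θ) θ) (hB' : Continuous B')
    (hp : B (2 * Real.pi) = B 0) (k : ℤ) : fc k B' = k * Complex.I * fc k B := by
  have h := intervalIntegral.integral_mul_deriv_eq_deriv_mul (a := 0) (b := 2 * Real.pi)
    (u := circ (-k)) (v := B) (u' := fun θ => ((-k : ℤ) : ℂ) * Complex.I * circ (-k) θ) (v' := B')
    (fun θ _ => hasDerivAt_circ (-k) θ) (fun θ _ => hB θ)
    ((continuous_const.mul (continuous_circ (-k))).intervalIntegrable _ _)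
    (hB'.intervalIntegrable _ _)
  have hcp := circ_periodic (-k) 0
  rw [zero_add] at hcp
  rw [hcp, hp, sub_self, zero_sub, intervalIntegral_eq_angleMeasure,
    intervalIntegral_eq_angleMeasure] at h
  have e1 : ∫ θ, ((-k : ℤ) : ℂ) * Complex.I * circ (-k) θ * B θ ∂angleMeasure =
      -(k * Complex.I) * ∫ θ, B θ * circ (-k) θ ∂angleMeasure := by
    rw [← integral_const_mul]
    congr 1
    funext θ
    push_cast
    ring
  unfold fc
  simp only [mul_comm (B' _)]
  rw [h, e1]
  ring

theorem IsDiscMap.exists_quotient {a : ℂ → ℂ} (ha : IsDiscMap a) :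
    ∃ q : ℂ → ℂ, DiffContOnCl ℂ q (Metric.ball 0 1) ∧ (∀ w, ‖w‖ ≤ 1 → q w ≠ 0) ∧
      (∀ w, a w = w * q w) ∧ q 0 = deriv a 0 := by
  have h : ∀ w, a w = w * dslope a 0 w := fun w => by
    have := sub_smul_dslope a 0 w
    rwa [sub_zero, ha.zero, sub_zero, smul_eq_mul, eq_comm] at this
  refine ⟨dslope a 0, diffContOnCl_dslope ha.diffContOnCl (by simp), fun w hw => ?_, h,
    dslope_same a 0⟩
  by_cases h0 : w = 0
  · rw [h0, dslope_same]
    exact ha.deriv_zero_ne_zero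
  · exact right_ne_zero_of_mul ((h w) ▸ ha.ne_zero hw h0)

theorem diffContOnCl_inv_of_ne_zero {q : ℂ → ℂ} (hq : DiffContOnCl ℂ q (Metric.ball 0 1))
    (h0 : ∀ w, ‖w‖ ≤ 1 → q w ≠ 0) : DiffContOnCl ℂ (fun w => (q w)⁻¹) (Metric.ball 0 1) := by
  rw [diffContOnCl_unit_iff] at hq ⊢
  exact ⟨hq.1.inv fun w hw => h0 w (mem_ball_zero_iff.1 hw).le,
    hq.2.inv₀ fun w hw => h0 w (mem_closedBall_zero_iff.1 hw)⟩

theorem diffContOnCl_pow {q : ℂ → ℂ} (hq : DiffContOnCl ℂ q (Metric.ball 0 1)) (n : ℕ) :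
    DiffContOnCl ℂ (fun w => q w ^ n) (Metric.ball 0 1) := by
  rw [diffContOnCl_unit_iff] at hq ⊢
  exact ⟨hq.1.pow n, hq.2.pow n⟩

theorem mul_self_of_sign {ε : ℤ} (hε : ε = 1 ∨ ε = -1) : ε * ε = 1 := by
  rcases hε with rfl | rfl <;> norm_num

theorem neg_sign {ε : ℤ} (hε : ε = 1 ∨ ε = -1) : -ε = 1 ∨ -ε = -1 := by
  rcases hε with rfl | rfl <;> norm_num

theorem IsDiscMap.fc_eq_zero {a : ℂ → ℂ} (ha : IsDiscMap a) {ε : ℤ} (hε : ε = 1 ∨ ε = -1)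
    {k : ℤ} (hk : k < 1) : fc (ε * k) (fun θ => a (circ ε θ)) = 0 := by
  rcases (Int.lt_add_one_iff.1 (show k < 0 + 1 by omega)).lt_or_eq with h | rfl
  · exact fc_boundary_of_neg hε ha.diffContOnCl h
  · rw [mul_zero, fc_zero_boundary hε ha.diffContOnCl, ha.zero]

theorem IsDiscMap.fc_eq_deriv {a : ℂ → ℂ} (ha : IsDiscMap a) {ε : ℤ} (hε : ε = 1 ∨ ε = -1) :
    fc ε (fun θ => a (circ ε θ)) = deriv a 0 := by
  obtain ⟨q, hq, -, haq, hq0⟩ := ha.exists_quotient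
  simp only [haq, fc_circ_mul, sub_self]
  rw [fc_zero_boundary hε hq, hq0]

/-- Since `a` has a simple zero at the centre and no other, `a^(-n)` is `w^(-n)` times a holomorphic
function. -/
theorem IsDiscMap.fc_inv_pow_eq_zero {a : ℂ → ℂ} (ha : IsDiscMap a) {ε : ℤ} (hε : ε = 1 ∨ ε = -1)
    {n : ℕ} {k : ℤ} (hk : k < -n) : fc (ε * k) (fun θ => (a (circ ε θ) ^ n)⁻¹) = 0 := by
  obtain ⟨q, hq, hq0, haq, -⟩ := ha.exists_quotient
  have h1 : (fun θ => (a (circ ε θ) ^ n)⁻¹) =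
      fun θ => circ (-(ε * n)) θ * ((q (circ ε θ) ^ n)⁻¹) := by
    funext θ
    rw [haq, mul_pow, mul_inv, circ_neg, circ_mul, zpow_natCast]
  rw [h1, fc_circ_mul, show ε * k - -(ε * n) = ε * (k + n) by ring]
  exact fc_boundary_of_neg hε (diffContOnCl_inv_of_ne_zero (diffContOnCl_pow hq n)
    fun w hw => pow_ne_zero n (hq0 w hw)) (by omega)

theorem IsDiscMap.continuous_boundary {a : ℂ → ℂ} (ha : IsDiscMap a) (ε : ℤ) :
    Continuous fun θ => a (circ ε θ) := DiffContOnCl_continuous_circ ha.diffContOnCl ε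

theorem IsDiscMap.boundary_ne_zero {a : ℂ → ℂ} (ha : IsDiscMap a) (ε : ℤ) (θ : ℝ) :
    a (circ ε θ) ≠ 0 := ha.ne_zero (norm_circ ε θ).le (circ_ne_zero ε θ)

theorem IsDiscMap.boundary_two_pi (a : ℂ → ℂ) (ε : ℤ) :
    a (circ ε (2 * Real.pi)) = a (circ ε 0) := by
  have := circ_periodic ε 0
  rw [zero_add] at this
  rw [this]

/-- The Laurent polynomial `w ∂_w 𝓑` on the circle, for the polynomial part `𝓑` of `B` of
degree `n` in `w^σ`. -/
def hamDeriv (σ : ℤ) (n : ℕ) (B : ℝ → ℂ) (θ : ℝ) : ℂ :=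
  ∑ k ∈ Finset.Icc 1 n, (((σ * k : ℤ) : ℂ) * fc (σ * k) B) * circ (σ * k) θ

theorem continuous_hamDeriv (σ : ℤ) (n : ℕ) (B : ℝ → ℂ) : Continuous (hamDeriv σ n B) := by
  unfold hamDeriv
  exact continuous_finsetSum _ fun j _ => continuous_const.mul (continuous_circ _)

theorem fc_laurent {σ : ℤ} (hσ : σ = 1 ∨ σ = -1) (n : ℕ) (c : ℤ → ℂ) (k : ℤ) :
    fc (σ * k) (fun θ => ∑ j ∈ Finset.Icc 1 n, c (σ * j) * circ (σ * j) θ) =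
      if 1 ≤ k ∧ k ≤ n then c (σ * k) else 0 := by
  have hσ0 : σ ≠ 0 := by rcases hσ with rfl | rfl <;> norm_num
  rw [fc_sum _ (fun (j : ℕ) θ => c (σ * j) * circ (σ * j) θ) fun j _ => memLp_of_continuous (continuous_const.mul (continuous_circ _)) 2]
  simp only [fc_const_mul, fc_circ, mul_right_inj' hσ0, mul_ite, mul_one, mul_zero]
  split_ifs with h
  · obtain ⟨m, rfl⟩ : ∃ m : ℕ, k = m := ⟨k.toNat, by omega⟩
    rw [Finset.sum_eq_single m]
    · rw [if_pos rfl]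
    · intro j _ hj
      rw [if_neg (by exact_mod_cast hj.symm)]
    · intro hm
      exact absurd (Finset.mem_Icc.2 ⟨by omega, by omega⟩) hm
  · refine Finset.sum_eq_zero fun j hj => if_neg ?_
    rintro rfl
    rw [Finset.mem_Icc] at hj
    exact h ⟨by omega, by omega⟩

theorem fc_hamDeriv {σ : ℤ} (hσ : σ = 1 ∨ σ = -1) (n : ℕ) (B : ℝ → ℂ) (k : ℤ) :
    fc (σ * k) (hamDeriv σ n B) =
      if 1 ≤ k ∧ k ≤ n then ((σ * k : ℤ) : ℂ) * fc (σ * k) B else 0 :=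
  fc_laurent hσ n (fun j => (j : ℂ) * fc j B) k

theorem IsDiscMap.fc_pow_eq_zero {a : ℂ → ℂ} (ha : IsDiscMap a) {ε : ℤ} (hε : ε = 1 ∨ ε = -1)
    (m : ℕ) {k : ℤ} (hk : k < 0) : fc (ε * k) (fun θ => a (circ ε θ) ^ m) = 0 :=
  fc_boundary_of_neg hε (diffContOnCl_pow ha.diffContOnCl m) hk

/-- Both factors have frequencies on the same side, and `w ∂_w` has removed the constant term of the
second. -/
theorem IsDiscMap.fc_pow_mul_hamDeriv_same {a : ℂ → ℂ} (ha : IsDiscMap a) {ε : ℤ}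
    (hε : ε = 1 ∨ ε = -1) (m n : ℕ) (B : ℝ → ℂ) :
    fc 0 (fun θ => a (circ ε θ) ^ m * hamDeriv ε n B θ) = 0 := by
  have h := fc_mul_eq_zero hε ((ha.continuous_boundary ε).pow m)
    (memLp_of_continuous (continuous_hamDeriv ε n B) 2) (p := 0) (q := 1) (k := 0)
    (fun k hk => ha.fc_pow_eq_zero hε m hk)
    (fun k hk => by rw [fc_hamDeriv hε, if_neg (by omega)]) (by norm_num)
  rwa [mul_zero] at h

/-- The boundary derivative of a negative power of a disc map, up to the factor `-i`. -/
theorem IsDiscMap.hasDerivAt_boundary_zpow {a a₁ : ℂ → ℂ} (ha : IsDiscMap a) {ε : ℤ}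
    (h : ∀ θ, HasDerivAt (fun θ => a (circ ε θ)) (ε * Complex.I * circ ε θ * a₁ (circ ε θ)) θ)
    (m : ℤ) (θ : ℝ) : HasDerivAt (fun θ => a (circ ε θ) ^ m)
      (m * a (circ ε θ) ^ (m - 1) * (ε * Complex.I * circ ε θ * a₁ (circ ε θ))) θ :=
  HasDerivAt.comp (h₂ := fun x : ℂ => x ^ m) θ
    (hasDerivAt_zpow m _ (Or.inl (ha.boundary_ne_zero ε θ))) (h θ)

/-- Against `b^m` the polynomial part of `w ∂_w b^(-n)` pairs like the whole of it, and the mean of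
`b^m w ∂_w b^(-n)` is a residue: zero for an exact derivative, and `-εn` when a logarithmic
derivative of `b` remains. -/
theorem IsDiscMap.fc_pow_mul_hamDeriv {b : ℂ → ℂ} (hb : IsDiscMap b) {ε : ℤ} (hε : ε = 1 ∨ ε = -1)
    (m n : ℕ) :
    fc 0 (fun θ => b (circ ε θ) ^ m * hamDeriv (-ε) n (fun θ => (b (circ ε θ) ^ n)⁻¹) θ) =
      if m = n then -((ε : ℂ) * n) else 0 := by
  obtain ⟨b₁, hb₁, -, hb₁d, hbd⟩ := hb.exists_deriv
  obtain ⟨q, hq, hq0, hbq, hq00⟩ := hb.exists_quotient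
  have hbc := hb.continuous_boundary ε
  have hb0 := hb.boundary_ne_zero ε
  have hcb : Continuous fun θ => (ε : ℂ) * Complex.I * circ ε θ * b₁ (circ ε θ) :=
    (continuous_const.mul (continuous_circ ε)).mul (DiffContOnCl_continuous_circ hb₁ ε)
  have hz : ∀ k : ℤ, Continuous fun θ => b (circ ε θ) ^ k := fun k =>
    hbc.zpow₀ k fun θ => Or.inl (hb0 θ)
  have hB : (fun θ => (b (circ ε θ) ^ n)⁻¹) = fun θ => b (circ ε θ) ^ (-(n : ℤ)) := by
    funext θ
    rw [zpow_neg, zpow_natCast]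
  set B := fun θ => (b (circ ε θ) ^ n)⁻¹ with hBdef
  set B' : ℝ → ℂ := fun θ => ((-(n : ℤ) : ℤ) : ℂ) * b (circ ε θ) ^ (-(n : ℤ) - 1) *
    (ε * Complex.I * circ ε θ * b₁ (circ ε θ)) with hB'
  have hB'c : Continuous B' := (continuous_const.mul (hz _)).mul hcb
  have hder : ∀ k : ℤ, fc k (fun θ => -Complex.I * B' θ) = k * fc k B := by
    intro k
    rw [fc_const_mul, fc_deriv (B := B) (fun θ => by
      rw [hB]; exact hb.hasDerivAt_boundary_zpow (hbd ε) _ θ) hB'c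
      (by simp only [hBdef, IsDiscMap.boundary_two_pi])]
    linear_combination -(k * fc k B) * Complex.I_mul_I
  -- Removing the polynomial part leaves only frequencies `ε k` with `k ≥ 1`: those with `k < -n`
  -- are absent from `b^(-n)`, and `k = 0` is killed by differentiation.
  have hsub : fc 0 (fun θ => b (circ ε θ) ^ m * ((-Complex.I * B' θ) - hamDeriv (-ε) n B θ)) = 0 := by
    have h := fc_mul_eq_zero hε (hbc.pow m) (φ := fun θ => (-Complex.I * B' θ) - hamDeriv (-ε) n B θ)
      (memLp_of_continuous ((continuous_const.mul hB'c).sub (continuous_hamDeriv _ n B)) 2)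
      (p := 0) (q := 1) (k := 0) (fun k hk => hb.fc_pow_eq_zero hε m hk) (fun k hk => ?_)
      (by norm_num)
    · rwa [mul_zero] at h
    · rw [fc_sub (φ := fun θ => -Complex.I * B' θ)
        (memLp_of_continuous (continuous_const.mul hB'c) 2)
        (memLp_of_continuous (continuous_hamDeriv _ n B) 2), hder,
        show ε * k = -ε * -k by ring, fc_hamDeriv (neg_sign hε)]
      split_ifs with h
      · exact sub_self _
      · by_cases h0 : k = 0
        · simp [h0]
        · rw [show -ε * -k = ε * k by ring, hBdef, hb.fc_inv_pow_eq_zero hε (by omega)]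
          simp
  have hexp : fc 0 (fun θ => b (circ ε θ) ^ m * hamDeriv (-ε) n B θ) =
      fc 0 (fun θ => b (circ ε θ) ^ m * (-Complex.I * B' θ)) := by
    have e := fc_sub (φ := fun θ => b (circ ε θ) ^ m * (-Complex.I * B' θ))
      (ψ := fun θ => b (circ ε θ) ^ m * hamDeriv (-ε) n B θ)
      (memLp_of_continuous ((hbc.pow m).mul (continuous_const.mul hB'c)) 2)
      (memLp_of_continuous ((hbc.pow m).mul (continuous_hamDeriv _ n B)) 2) 0
    simp only [← mul_sub] at e
    rw [hsub] at e
    exact (sub_eq_zero.1 e.symm).symm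
  rw [hexp]
  split_ifs with hmn
  -- For `m = n` the integrand is `-εn` times the boundary value of `w b'(w) / b(w)`, holomorphic in
  -- the disc with value `1` at the centre.
  · have e1 : (fun θ => b (circ ε θ) ^ m * (-Complex.I * B' θ)) =
        fun θ => -((ε : ℂ) * n) * ((fun w => b₁ w * (q w)⁻¹) (circ ε θ)) := by
      funext θ
      have h1 := hq0 _ (norm_circ ε θ).le
      have h2 := circ_ne_zero ε θ
      simp only [hB']
      rw [hmn, zpow_sub₀ (hb0 θ), zpow_neg, zpow_natCast, zpow_one]
      have h3 := hb0 θ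
      push_cast
      field_simp
      rw [hbq]
      linear_combination (n * ε * circ ε θ * b₁ (circ ε θ) * q (circ ε θ)) * Complex.I_sq
    rw [e1, fc_const_mul]
    have hdc : DiffContOnCl ℂ (fun w => b₁ w * (q w)⁻¹) (Metric.ball 0 1) :=
      hb₁.smul (diffContOnCl_inv_of_ne_zero hq hq0)
    rw [fc_zero_boundary hε hdc, hq00, (hb₁d 0 (by simp)).deriv, mul_inv_cancel₀, mul_one]
    rw [← (hb₁d 0 (by simp)).deriv]
    exact hb.deriv_zero_ne_zero
  -- For `m ≠ n` the integrand is a multiple of the angular derivative of `b^(m-n)`, which has mean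
  -- zero.
  · have hmn' : ((m : ℂ) - n) ≠ 0 := sub_ne_zero.2 (by exact_mod_cast hmn)
    have e1 : (fun θ => b (circ ε θ) ^ m * (-Complex.I * B' θ)) =
        fun θ => (Complex.I * n / (m - n)) * ((((m : ℤ) - n : ℤ) : ℂ) *
          b (circ ε θ) ^ ((m : ℤ) - n - 1) * (ε * Complex.I * circ ε θ * b₁ (circ ε θ))) := by
      funext θ
      simp only [hB']
      rw [show (m : ℤ) - n - 1 = m + (-n - 1) by ring, zpow_add₀ (hb0 θ), zpow_natCast]
      push_cast
      field_simp
    rw [e1, fc_const_mul, fc_deriv (B := fun θ => b (circ ε θ) ^ ((m : ℤ) - n))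
      (hb.hasDerivAt_boundary_zpow (hbd ε) _) ((continuous_const.mul (hz _)).mul hcb)
      (by simp only [IsDiscMap.boundary_two_pi])]
    simp

/-! ### Densities dual to the time variables -/

/-- The pairing of a density on the circle with the time variable `t_m`. -/
def timePairing (m : ℤ) (p : ConformalPair) (X : ℝ → ℂ) : ℂ :=
  (if m = 0 then 1 else (m : ℂ)⁻¹) * fc 0 (fun θ => timeWeight m p θ * X θ)

/-- `H` is the density of a variation in the direction of `t_n`. -/
structure IsTimeDensity (n : ℤ) (p : ConformalPair) (H : ℝ → ℂ) : Prop where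
  continuous : Continuous H
  pairing : ∀ m, timePairing m p H = if m = n then 1 else 0

theorem timeWeight_natCast (m : ℕ) (p : ConformalPair) (θ : ℝ) :
    timeWeight m p θ = p.ginv (circ (-1) θ) ^ m := by
  rw [timeWeight, if_pos (by positivity), p.ginv_circ, zpow_neg, zpow_natCast, inv_pow]

theorem timeWeight_neg_natCast (m : ℕ) (p : ConformalPair) (θ : ℝ) :
    timeWeight (-(m : ℤ)) p θ = p.f (circ 1 θ) ^ m := by
  rw [timeWeight]
  split_ifs with h
  · obtain rfl : m = 0 := by omega
    simp
  · rw [neg_neg, zpow_natCast, p.fb_eq]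

theorem isTimeDensity_one (p : ConformalPair) : IsTimeDensity 0 p (fun _ => 1) where
  continuous := continuous_const
  pairing m := by
    unfold timePairing
    simp only [mul_one]
    obtain ⟨n, rfl | rfl⟩ := m.eq_nat_or_neg
    · simp only [timeWeight_natCast]
      rw [fc_zero_boundary (Or.inr rfl) (diffContOnCl_pow p.isDiscMap_ginv.diffContOnCl n),
        p.isDiscMap_ginv.zero]
      rcases eq_or_ne n 0 with rfl | hn <;> simp [*]
    · simp only [timeWeight_neg_natCast]
      rw [fc_zero_boundary (Or.inl rfl) (diffContOnCl_pow p.isDiscMap_f.diffContOnCl n),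
        p.isDiscMap_f.zero]
      rcases eq_or_ne n 0 with rfl | hn <;> simp [*]

theorem isTimeDensity_hamDeriv {n : ℕ} (hn : 1 ≤ n) (p : ConformalPair) :
    IsTimeDensity n p (hamDeriv 1 n fun θ => p.gb θ ^ n) where
  continuous := continuous_hamDeriv _ _ _
  pairing m := by
    have hg : (fun θ => p.gb θ ^ n) = fun θ => (p.ginv (circ (-1) θ) ^ n)⁻¹ := by
      funext θ
      rw [p.ginv_circ, inv_pow, inv_inv]
    unfold timePairing
    obtain ⟨k, rfl | rfl⟩ := m.eq_nat_or_neg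
    · simp only [timeWeight_natCast, hg]
      have h := p.isDiscMap_ginv.fc_pow_mul_hamDeriv (Or.inr rfl) k n
      rw [neg_neg] at h
      rw [h]
      by_cases hk : k = n
      · have : (n : ℂ) ≠ 0 := by exact_mod_cast (by omega : n ≠ 0)
        subst hk
        simp [this, Nat.one_le_iff_ne_zero.1 hn]
      · simp [hk]
    · simp only [timeWeight_neg_natCast]
      rw [p.isDiscMap_f.fc_pow_mul_hamDeriv_same (Or.inl rfl), mul_zero, if_neg (by omega)]

theorem isTimeDensity_hamDeriv_neg {n : ℕ} (hn : 1 ≤ n) (p : ConformalPair) :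
    IsTimeDensity (-(n : ℤ)) p (hamDeriv (-1) n fun θ => (p.fb θ ^ n)⁻¹) where
  continuous := continuous_hamDeriv _ _ _
  pairing m := by
    have hf : (fun θ => (p.fb θ ^ n)⁻¹) = fun θ => (p.f (circ 1 θ) ^ n)⁻¹ := by
      funext θ
      rw [p.fb_eq]
    unfold timePairing
    obtain ⟨k, rfl | rfl⟩ := m.eq_nat_or_neg
    · simp only [timeWeight_natCast]
      rw [p.isDiscMap_ginv.fc_pow_mul_hamDeriv_same (Or.inr rfl), mul_zero, if_neg (by omega)]
    · simp only [timeWeight_neg_natCast, hf]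
      rw [p.isDiscMap_f.fc_pow_mul_hamDeriv (Or.inl rfl) k n]
      by_cases hk : k = n
      · have : (n : ℂ) ≠ 0 := by exact_mod_cast (by omega : n ≠ 0)
        subst hk
        simp [this, Nat.one_le_iff_ne_zero.1 hn]
      · simp [hk]

theorem timePairing_sub {p : ConformalPair} {X Y : ℝ → ℂ} (hX : MemLp X 2 angleMeasure)
    (hY : MemLp Y 2 angleMeasure) (m : ℤ) :
    timePairing m p (fun θ => X θ - Y θ) = timePairing m p X - timePairing m p Y := by
  have hw : Continuous (timeWeight m p) := by
    obtain ⟨n, rfl | rfl⟩ := m.eq_nat_or_neg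
    · rw [funext (timeWeight_natCast n p)]
      exact (p.isDiscMap_ginv.continuous_boundary _).pow n
    · rw [funext (timeWeight_neg_natCast n p)]
      exact (p.isDiscMap_f.continuous_boundary _).pow n
  have h := fc_sub (memLp_continuous_mul hX hw) (memLp_continuous_mul hY hw) 0
  simp only [← mul_sub] at h
  rw [timePairing, h, mul_sub]
  rfl

/-- The time variables are complete: orthogonality to the powers of `ginv` kills the coefficients of
index `≥ 0`, and orthogonality to the powers of `f` those of index `≤ 0`. -/
theorem ae_eq_zero_of_timePairing {p : ConformalPair} {Y : ℝ → ℂ} (hY : MemLp Y 2 angleMeasure)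
    (h : ∀ m, timePairing m p Y = 0) : Y =ᵐ[angleMeasure] 0 := by
  have h2π : (2 * Real.pi : ℂ)⁻¹ ≠ 0 :=
    inv_ne_zero (by exact_mod_cast (by positivity : 2 * Real.pi ≠ 0))
  have h' : ∀ m, ∫ θ, timeWeight m p θ * Y θ ∂angleMeasure = 0 := by
    intro m
    have h1 := h m
    rw [timePairing, fc, neg_zero] at h1
    simp only [circ_zero, mul_one] at h1
    refine (mul_eq_zero.1 ((mul_eq_zero.1 h1).resolve_left ?_)).resolve_left h2π
    split_ifs with hm
    · exact one_ne_zero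
    · exact inv_ne_zero (by exact_mod_cast hm)
  have hi := integrable_angle hY
  have hg := p.isDiscMap_ginv.integral_mul_circ_pow_eq_zero (ε := -1) hi fun m => by
    rw [← h' m]
    simp only [timeWeight_natCast, mul_comm]
  have hf := p.isDiscMap_f.integral_mul_circ_pow_eq_zero (ε := 1) hi fun m => by
    rw [← h' (-m)]
    simp only [timeWeight_neg_natCast, mul_comm]
  refine ae_eq_zero_of_fc hY fun k => ?_
  rw [fc]
  obtain ⟨n, rfl | rfl⟩ := k.eq_nat_or_neg
  · have := hg n
    simp only [← zpow_natCast, ← circ_mul, neg_one_mul] at this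
    rw [this, mul_zero]
  · have := hf n
    simp only [← zpow_natCast, ← circ_mul, one_mul] at this
    rw [neg_neg, this, mul_zero]

/-! ### Velocities and balanced splittings -/

theorem sign_cast_mul_self {ε : ℤ} (hε : ε = 1 ∨ ε = -1) : (ε : ℂ) * ε = 1 := by
  exact_mod_cast mul_self_of_sign hε

/-- The angular derivative of `a` is `iε w a'(w)` at `w = circ ε θ`, with `a'` free of zeros on the
closed disc. Its factor `w` is absorbed by the zero of the velocity at the centre, so the quotient
remains one-sided, with constant term read off from the lowest coefficients. -/
theorem IsDiscMap.fc_velocity_div {a : ℂ → ℂ} (ha : IsDiscMap a) {ε : ℤ} (hε : ε = 1 ∨ ε = -1)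
    {φ : ℝ → ℂ} (hφ : MemLp φ 2 angleMeasure) (h0 : ∀ k < 1, fc (ε * k) φ = 0) :
    MemLp (fun θ => Complex.I * φ θ / deriv (fun θ => a (circ ε θ)) θ) 2 angleMeasure ∧
      (∀ k < 0, fc (ε * k) (fun θ => Complex.I * φ θ / deriv (fun θ => a (circ ε θ)) θ) = 0) ∧
      fc 0 (fun θ => Complex.I * φ θ / deriv (fun θ => a (circ ε θ)) θ) =
        ε * ((deriv a 0)⁻¹ * fc ε φ) := by
  obtain ⟨a₁, h1, h2, h3, h4⟩ := ha.exists_deriv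
  have hεε := sign_cast_mul_self hε
  have h1' := diffContOnCl_inv_of_ne_zero h1 h2
  have hc := DiffContOnCl_continuous_circ h1' ε
  have e : (fun θ => Complex.I * φ θ / deriv (fun θ => a (circ ε θ)) θ) =
      fun θ => ε * (circ (-ε) θ * ((a₁ (circ ε θ))⁻¹ * φ θ)) := by
    funext θ
    have hε0 : (ε : ℂ) ≠ 0 := left_ne_zero_of_mul_eq_one hεε
    have := h2 _ (norm_circ ε θ).le
    have := circ_ne_zero ε θ
    rw [(h4 ε θ).deriv, circ_neg]
    field_simp
    linear_combination -φ θ * hεε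
  have hm := memLp_continuous_mul hφ hc
  have hk : ∀ k, fc (ε * k) (fun θ => ε * (circ (-ε) θ * ((a₁ (circ ε θ))⁻¹ * φ θ))) =
      ε * fc (ε * (k + 1)) (fun θ => (a₁ (circ ε θ))⁻¹ * φ θ) := fun k => by
    rw [fc_const_mul, fc_circ_mul, show ε * k - -ε = ε * (k + 1) by ring]
  rw [e]
  refine ⟨(memLp_continuous_mul hm (continuous_circ (-ε))).const_mul _, fun k hk0 => ?_, ?_⟩
  · rw [hk, fc_mul_eq_zero hε hc hφ (p := 0) (q := 1) (fun k hk => fc_boundary_of_neg hε h1' hk) h0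
      (by omega), mul_zero]
  · have := hk 0
    rw [mul_zero] at this
    rw [this, fc_mul_eq_mul hε hc hφ (p := 0) (q := 1) (fun k hk => fc_boundary_of_neg hε h1' hk) h0,
      mul_zero, fc_zero_boundary hε h1', mul_one, (h3 0 (by simp)).deriv]

/-- The inverse passage, from a one-sided function to an admissible velocity; it serves the
construction of curves. -/
theorem IsDiscMap.fc_velocity_mul {a : ℂ → ℂ} (ha : IsDiscMap a) {ε : ℤ} (hε : ε = 1 ∨ ε = -1)
    {v : ℝ → ℂ} (hv : MemLp v 2 angleMeasure) (h0 : ∀ k < 0, fc (ε * k) v = 0) :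
    MemLp (fun θ => -Complex.I * deriv (fun θ => a (circ ε θ)) θ * v θ) 2 angleMeasure ∧
      (∀ k < 1, fc (ε * k) (fun θ => -Complex.I * deriv (fun θ => a (circ ε θ)) θ * v θ) = 0) ∧
      fc ε (fun θ => -Complex.I * deriv (fun θ => a (circ ε θ)) θ * v θ) =
        ε * (deriv a 0 * fc 0 v) := by
  obtain ⟨a₁, h1, -, h3, h4⟩ := ha.exists_deriv
  have hc := DiffContOnCl_continuous_circ h1 ε
  have e : (fun θ => -Complex.I * deriv (fun θ => a (circ ε θ)) θ * v θ) =
      fun θ => ε * (circ ε θ * (a₁ (circ ε θ) * v θ)) := by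
    funext θ
    rw [(h4 ε θ).deriv]
    linear_combination -(ε * circ ε θ * a₁ (circ ε θ) * v θ) * Complex.I_mul_I
  have hm := memLp_continuous_mul hv hc
  have hk : ∀ k, fc (ε * k) (fun θ => ε * (circ ε θ * (a₁ (circ ε θ) * v θ))) =
      ε * fc (ε * (k - 1)) (fun θ => a₁ (circ ε θ) * v θ) := fun k => by
    rw [fc_const_mul, fc_circ_mul, show ε * k - ε = ε * (k - 1) by ring]
  rw [e]
  refine ⟨(memLp_continuous_mul hm (continuous_circ ε)).const_mul _, fun k hk0 => ?_, ?_⟩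
  · rw [hk, fc_mul_eq_zero hε hc hv (p := 0) (q := 0) (fun k hk => fc_boundary_of_neg hε h1 hk) h0
      (by omega), mul_zero]
  · have := hk 1
    rw [mul_one] at this
    rw [this, sub_self]
    have h5 := fc_mul_eq_mul hε hc hv (p := 0) (q := 0) (fun k hk => fc_boundary_of_neg hε h1 hk) h0
    rw [add_zero, mul_zero] at h5
    rw [mul_zero, h5, fc_zero_boundary hε h1, (h3 0 (by simp)).deriv]

/-- `R = u - v` with `u` having only powers `w^k`, `k ≤ 0`, and `v` only powers `k ≥ 0`, the
constant term being shared evenly. -/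
structure BalancedSplit (R u v : ℝ → ℂ) : Prop where
  left : MemLp u 2 angleMeasure
  right : MemLp v 2 angleMeasure
  left_zero : ∀ k < 0, fc (-1 * k) u = 0
  right_zero : ∀ k < 0, fc (1 * k) v = 0
  balance : fc 0 u + fc 0 v = 0
  sub_eq : (fun θ => u θ - v θ) =ᵐ[angleMeasure] R

theorem fc_const (c : ℂ) (k : ℤ) : fc k (fun _ => c) = if k = 0 then c else 0 := by
  have := fc_const_mul c (circ 0) k
  simp only [circ_zero, mul_one, fc_circ] at this
  simpa using this

/-- Give the negative frequencies of `R` to `u`, minus the positive ones to `v`, and half of the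
constant term to each, with opposite signs. -/
theorem exists_balancedSplit {R : ℝ → ℂ} (hR : MemLp R 2 angleMeasure) :
    ∃ u v, BalancedSplit R u v := by
  obtain ⟨U, hU, hU1, hU2⟩ := exists_fc_projection hR {k | k < 0}
  obtain ⟨V, hV, hV1, hV2⟩ := exists_fc_projection hR {k | 0 < k}
  have hcm : ∀ c : ℂ, MemLp (fun _ : ℝ => c) 2 angleMeasure := fun c => memLp_const c
  have hu : ∀ k, fc k (fun θ => U θ + fc 0 R / 2) = fc k U + if k = 0 then fc 0 R / 2 else 0 :=
    fun k => by rw [fc_add hU (hcm _), fc_const]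
  have hv : ∀ k, fc k (fun θ => -(V θ + fc 0 R / 2)) = -(fc k V + if k = 0 then fc 0 R / 2 else 0) :=
    fun k => by rw [fc_neg, fc_add hV (hcm _), fc_const]
  have hmu := hU.add (hcm (fc 0 R / 2))
  have hmv := (hV.add (hcm (fc 0 R / 2))).neg
  refine ⟨_, _, ⟨hmu, hmv, fun k hk => ?_, fun k hk => ?_, ?_, ae_eq_of_fc (hmu.sub hmv) hR ?_⟩⟩
  · exact (hu _).trans (by rw [hU2 _ (by simp; omega), if_neg (by omega), add_zero])
  · exact (hv _).trans (by rw [hV2 _ (by simp; omega), if_neg (by omega), add_zero, neg_zero])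
  · refine (congrArg₂ (· + ·) (hu 0) (hv 0)).trans ?_
    rw [hU2 0 (by simp), hV2 0 (by simp)]
    ring
  · intro k
    refine (fc_sub hmu hmv k).trans ((congrArg₂ (· - ·) (hu k) (hv k)).trans ?_)
    rcases lt_trichotomy k 0 with h | rfl | h
    · rw [hU1 k h, hV2 k (by simp; omega), if_neg h.ne]
      ring
    · rw [hU2 0 (by simp), hV2 0 (by simp), if_pos rfl]
      ring
    · rw [hU2 k (by simp; omega), hV1 k h, if_neg h.ne']
      ring

theorem BalancedSplit.fc_sub {R u v : ℝ → ℂ} (h : BalancedSplit R u v) (k : ℤ) :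
    fc k u - fc k v = fc k R := by
  rw [← DToda.fc_sub h.left h.right, fc_congr_ae h.sub_eq]

/-- Away from frequency `0` one of the two parts vanishes; at `0` both the difference and the sum of
the constant terms are prescribed. -/
theorem BalancedSplit.unique {R u v u' v' : ℝ → ℂ} (h : BalancedSplit R u v)
    (h' : BalancedSplit R u' v') : u =ᵐ[angleMeasure] u' ∧ v =ᵐ[angleMeasure] v' := by
  have key : ∀ k, fc k u = fc k u' ∧ fc k v = fc k v' := by
    intro k
    have e1 := h.fc_sub k
    have e2 := h'.fc_sub k
    rcases lt_trichotomy k 0 with hk | rfl | hk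
    · have e3 := h.right_zero k hk
      have e4 := h'.right_zero k hk
      rw [one_mul] at e3 e4
      exact ⟨by linear_combination e1 - e2 + e3 - e4, by rw [e3, e4]⟩
    · have e3 := h.balance
      have e4 := h'.balance
      exact ⟨by linear_combination (e1 - e2 + e3 - e4) / 2,
        by linear_combination (e2 - e1 + e3 - e4) / 2⟩
    · have e3 := h.left_zero (-k) (by omega)
      have e4 := h'.left_zero (-k) (by omega)
      rw [neg_mul_neg, one_mul] at e3 e4
      exact ⟨by rw [e3, e4], by linear_combination e2 - e1 + e3 - e4⟩
  exact ⟨ae_eq_of_fc h.left h'.left fun k => (key k).1,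
    ae_eq_of_fc h.right h'.right fun k => (key k).2⟩

/-! ### Velocities of curves in the direction of a time variable -/

/-- The boundary values of `ζ ↦ 1 / g(1 / ζ)`, as a function of the angle of `1 / ζ`. -/
def ConformalPair.ginvb (p : ConformalPair) (θ : ℝ) : ℂ := p.ginv (circ (-1) θ)

/-- The jump of the velocity ratios of a variation with density `1`. -/
def densityRatio (p : ConformalPair) (θ : ℝ) : ℂ :=
  -(p.fb θ ^ 2 / (deriv p.fb θ * deriv p.gb θ))

theorem continuous_densityRatio (p : ConformalPair) : Continuous (densityRatio p) :=
  ((p.differentiable_fb.continuous.pow 2).div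
    (p.continuous_deriv_fb.mul p.continuous_deriv_gb)
    fun θ => mul_ne_zero (p.deriv_fb_ne_zero θ) (p.deriv_gb_ne_zero θ)).neg

theorem densityRatio_ne_zero (p : ConformalPair) (θ : ℝ) : densityRatio p θ ≠ 0 :=
  neg_ne_zero.2 (div_ne_zero (pow_ne_zero 2 (p.fb_ne_zero θ))
    (mul_ne_zero (p.deriv_fb_ne_zero θ) (p.deriv_gb_ne_zero θ)))

theorem L2Curve.congr_ae {u : ℂ → ℝ → ℂ} {φ ψ : ℝ → ℂ} (hu : L2Curve u φ)
    (h : φ =ᵐ[angleMeasure] ψ) : L2Curve u ψ := by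
  refine ⟨hu.continuous, hu.uniform, hu.velocity.1, (memLp_congr_ae h).1 hu.velocity.2.1,
    hu.velocity.2.2.congr fun s => eLpNorm_congr_ae ?_⟩
  filter_upwards [h] with θ hθ
  rw [hθ]

theorem L2Curve.gb {c : ℂ → ConformalPair} {ψ : ℝ → ℂ}
    (h : L2Curve (fun s => (c s).ginvb) ψ) :
    L2Curve (fun s => (c s).gb) (fun θ => -(c 0).gb θ ^ 2 * ψ θ) := by
  refine (h.inv fun s θ => (c s).ginv_circ_ne_zero θ).congr (fun s θ => ((c s).gb_eq θ).symm)
    fun θ => ?_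
  rw [ConformalPair.ginvb, (c 0).ginv_circ, inv_inv]
  ring

theorem L2Curve.ginvb {c : ℂ → ConformalPair} {γ : ℝ → ℂ} (h : L2Curve (fun s => (c s).gb) γ) :
    L2Curve (fun s => (c s).ginvb) (fun θ => -((c 0).gb θ)⁻¹ ^ 2 * γ θ) :=
  (h.inv fun s θ => (c s).gb_ne_zero θ).congr (fun s θ => ((c s).ginv_circ θ).symm)
    fun θ => by ring

/-- A velocity inherits the vanishing of coefficients, each of them being differentiable along the
curve and constantly zero. -/
theorem L2Curve.fc_eq_zero {A : ℂ → ℂ → ℂ} (hA : ∀ s, IsDiscMap (A s)) {ε : ℤ}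
    (hε : ε = 1 ∨ ε = -1) {φ : ℝ → ℂ} (h : L2Curve (fun s θ => A s (circ ε θ)) φ) {k : ℤ}
    (hk : k < 1) : fc (ε * k) φ = 0 := by
  have h1 := h.hasDerivAt_fc (ε * k)
  simp only [(hA _).fc_eq_zero hε hk] at h1
  exact h1.unique (hasDerivAt_const _ _)

theorem L2Curve.hasDerivAt_deriv {A : ℂ → ℂ → ℂ} (hA : ∀ s, IsDiscMap (A s)) {ε : ℤ}
    (hε : ε = 1 ∨ ε = -1) {φ : ℝ → ℂ} (h : L2Curve (fun s θ => A s (circ ε θ)) φ) :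
    HasDerivAt (fun s => deriv (A s) 0) (fc ε φ) 0 := by
  have h1 := h.hasDerivAt_fc ε
  simpa only [(hA _).fc_eq_deriv hε] using h1

theorem ConformalPair.deriv_gb_eq (p : ConformalPair) (θ : ℝ) :
    deriv p.gb θ = -deriv p.ginvb θ * p.gb θ ^ 2 := p.deriv_gb θ

theorem ConformalPair.deriv_ginvb_ne_zero (p : ConformalPair) (θ : ℝ) : deriv p.ginvb θ ≠ 0 :=
  (p.isDiscMap_ginv.boundary (Or.inr rfl)).2.2 θ

/-- In terms of the velocity ratios `u` and `v`, prescribing the density of a variation amounts to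
prescribing the jump `u - v`. -/
theorem variation_eq (p : ConformalPair) (u v : ℝ → ℂ) (θ : ℝ) :
    variation p (fun θ => -Complex.I * deriv p.fb θ * v θ)
      (fun θ => -p.gb θ ^ 2 * (-Complex.I * deriv p.ginvb θ * u θ)) θ =
        (u θ - v θ) / densityRatio p θ := by
  have h1 := p.fb_ne_zero θ
  have h2 := p.deriv_fb_ne_zero θ
  have h3 := p.deriv_ginvb_ne_zero θ
  have h4 := p.gb_ne_zero θ
  rw [variation, densityRatio, p.deriv_gb_eq]
  field_simp
  linear_combination (v θ - u θ) * Complex.I_sq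

theorem memLp_variation {p : ConformalPair} {φ γ : ℝ → ℂ} (hφ : MemLp φ 2 angleMeasure)
    (hγ : MemLp γ 2 angleMeasure) : MemLp (variation p φ γ) 2 angleMeasure := by
  have h1 := (memLp_continuous_mul hγ p.continuous_deriv_fb).sub
    (memLp_continuous_mul hφ p.continuous_deriv_gb)
  have h2 : Continuous fun θ => -Complex.I / p.fb θ ^ 2 :=
    continuous_const.div (p.differentiable_fb.continuous.pow 2) fun θ =>
      pow_ne_zero 2 (p.fb_ne_zero θ)
  refine (memLp_congr_ae (Eventually.of_forall fun θ => ?_)).1 (memLp_continuous_mul h1 h2)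
  simp only [variation, Pi.sub_apply]
  ring

/-- Completeness of the time variables identifies the density of the curve with `H`; holomorphy and
the normalization then make its velocity ratios a balanced splitting. -/
theorem IsTimeCurve.exists_velocity {n : ℤ} {p : ConformalPair} {c : ℂ → ConformalPair}
    (h : IsTimeCurve n p c) {H : ℝ → ℂ} (hH : IsTimeDensity n p H) :
    ∃ u v, BalancedSplit (fun θ => densityRatio p θ * H θ) u v ∧
      L2Curve (fun s => (c s).fb) (fun θ => -Complex.I * deriv p.fb θ * v θ) ∧
      L2Curve (fun s => (c s).ginvb) (fun θ => -Complex.I * deriv p.ginvb θ * u θ) := by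
  obtain ⟨hc, ht⟩ := h
  obtain ⟨φ, γ, hφ, hγ⟩ := hc.exists_l2Curve
  obtain rfl : c 0 = p := hc.1
  set p := c 0 with hp
  have hψ := hγ.ginvb
  set ψ := fun θ => -((c 0).gb θ)⁻¹ ^ 2 * γ θ with hψdef
  have hfd : ∀ s, IsDiscMap (c s).f := fun s => (c s).isDiscMap_f
  have hgd : ∀ s, IsDiscMap (c s).ginv := fun s => (c s).isDiscMap_ginv
  have hφ' : L2Curve (fun s θ => (c s).f (circ 1 θ)) φ :=
    hφ.congr (fun s θ => (c s).fb_eq θ) fun _ => rfl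
  have hφ0 : ∀ k < 1, fc (1 * k) φ = 0 := fun k hk => L2Curve.fc_eq_zero hfd (Or.inl rfl) hφ' hk
  have hψ0 : ∀ k < 1, fc (-1 * k) ψ = 0 := fun k hk => L2Curve.fc_eq_zero hgd (Or.inr rfl) hψ hk
  -- The derivatives at `0` of the two disc maps agree all along the curve, so their velocities
  -- agree too; these are the lowest Fourier coefficients of `φ` and `ψ`.
  have hnorm : fc 1 φ = fc (-1) ψ := by
    have h1 := L2Curve.hasDerivAt_deriv hfd (Or.inl rfl) hφ'
    have h2 := L2Curve.hasDerivAt_deriv hgd (Or.inr rfl) hψ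
    simp only [ConformalPair.deriv_ginv_zero] at h2
    exact h1.unique h2
  obtain ⟨v1, v2, v3⟩ := p.isDiscMap_f.fc_velocity_div (Or.inl rfl) hφ.memLp hφ0
  obtain ⟨u1, u2, u3⟩ := p.isDiscMap_ginv.fc_velocity_div (Or.inr rfl) hψ.memLp hψ0
  rw [← p.fb_eq_fun] at v1 v2 v3
  set v := fun θ => Complex.I * φ θ / deriv p.fb θ with hv
  set u := fun θ => Complex.I * ψ θ / deriv p.ginvb θ with hu
  have hφv : ∀ θ, φ θ = -Complex.I * deriv p.fb θ * v θ := fun θ => by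
    have := p.deriv_fb_ne_zero θ
    simp only [hv]
    field_simp
    linear_combination φ θ * Complex.I_sq
  have hψu : ∀ θ, ψ θ = -Complex.I * deriv p.ginvb θ * u θ := fun θ => by
    have := p.deriv_ginvb_ne_zero θ
    simp only [hu]
    field_simp
    linear_combination ψ θ * Complex.I_sq
  refine ⟨u, v, ⟨u1, v1, u2, v2, ?_, ?_⟩, hφ.congr (fun _ _ => rfl) hφv,
    hψ.congr (fun _ _ => rfl) hψu⟩
  · refine (congrArg₂ (· + ·) u3 v3).trans ?_
    rw [hnorm, p.deriv_ginv_zero]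
    push_cast
    ring
  · have hX := memLp_variation (p := p) hφ.memLp hγ.memLp
    have hHm := memLp_of_continuous hH.continuous 2
    have hY := ae_eq_zero_of_timePairing (p := p) (hX.sub hHm) fun m => by
      refine (timePairing_sub hX hHm m).trans ?_
      rw [hH.pairing, sub_eq_zero]
      exact (hasDerivAt_time hc hφ hγ m).unique (ht m)
    filter_upwards [hY] with θ hθ
    have e : variation p φ γ θ = (u θ - v θ) / densityRatio p θ := by
      rw [← variation_eq]
      simp only [variation, ← hφv, ← hψu]
      have := p.gb_ne_zero θ
      simp only [hψdef, ← hp]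
      field_simp
    have e2 : variation p φ γ θ - H θ = 0 := hθ
    rw [e, sub_eq_zero, div_eq_iff (densityRatio_ne_zero p θ)] at e2
    rw [e2, mul_comm]

theorem IsCurveThrough.isTimeCurve {n : ℤ} {p : ConformalPair} {c : ℂ → ConformalPair}
    (h : IsCurveThrough p c) {H u v : ℝ → ℂ} (hH : IsTimeDensity n p H)
    (hs : BalancedSplit (fun θ => densityRatio p θ * H θ) u v)
    (hf : L2Curve (fun s => (c s).fb) (fun θ => -Complex.I * deriv p.fb θ * v θ))
    (hg : L2Curve (fun s => (c s).ginvb) (fun θ => -Complex.I * deriv p.ginvb θ * u θ)) :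
    IsTimeCurve n p c := by
  refine ⟨h, fun m => ?_⟩
  obtain rfl : c 0 = p := h.1
  refine (hasDerivAt_time h hf hg.gb m).congr_deriv ?_
  rw [← hH.pairing m, timePairing]
  congr 1
  refine fc_congr_ae ?_ 0
  filter_upwards [hs.sub_eq] with θ hθ
  rw [variation_eq, hθ, mul_div_cancel_left₀ _ (densityRatio_ne_zero _ θ)]

/-! ### Existence of curves with a given velocity -/

/-- Supplies a truncation degree growing so slowly that, whatever the bounds `M` for the Taylor
polynomials, the perturbation scaled by `s` still tends to zero. -/
theorem exists_slow_index (M : ℕ → ℝ) : ∃ N : ℂ → ℕ, Tendsto N (𝓝[≠] 0) atTop ∧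
    Tendsto (fun s => ‖s‖ * M (N s)) (𝓝[≠] 0) (𝓝 0) := by
  classical
  set P : ℂ → ℕ → Prop := fun s n => ‖s‖ * |M n| ≤ 1 / ((n : ℝ) + 1) with hP
  -- The cap `1 / ‖s‖` keeps the search finite, yet tends to infinity as `s → 0`. If no index
  -- qualifies the value is `0`, which is excluded for small `s`.
  set N : ℂ → ℕ := fun s => Nat.findGreatest (P s) ⌊‖s‖⁻¹⌋₊ with hN
  have hinv : Tendsto (fun s : ℂ => ‖s‖⁻¹) (𝓝[≠] 0) atTop :=
    tendsto_inv_nhdsGT_zero.comp tendsto_norm_nhdsNE_zero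
  have hnorm : Tendsto (fun s : ℂ => ‖s‖) (𝓝[≠] 0) (𝓝 0) := by
    simpa using (continuous_norm.tendsto (0 : ℂ)).mono_left nhdsWithin_le_nhds
  have hNt : Tendsto N (𝓝[≠] 0) atTop := by
    refine tendsto_atTop.2 fun n => ?_
    have h1 : ∀ᶠ s in 𝓝[≠] (0 : ℂ), P s n := by
      have h2 := hnorm.mul_const |M n|
      rw [zero_mul] at h2
      exact (h2.eventually (gt_mem_nhds (by positivity : 0 < 1 / ((n : ℝ) + 1)))).mono
        fun s hs => hs.le
    filter_upwards [h1, hinv.eventually_ge_atTop (n : ℝ)] with s hs hn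
    exact Nat.le_findGreatest (Nat.le_floor hn) hs
  refine ⟨N, hNt, ?_⟩
  have h3 : Tendsto (fun s => 1 / ((N s : ℝ) + 1)) (𝓝[≠] 0) (𝓝 0) :=
    tendsto_one_div_add_atTop_nhds_zero_nat.comp hNt
  refine squeeze_zero_norm' ?_ h3
  filter_upwards [hNt.eventually_ge_atTop 1] with s hs
  have := Nat.findGreatest_of_ne_zero (P := P s) (n := ⌊‖s‖⁻¹⌋₊) rfl (by
    change N s ≠ 0
    omega)
  rw [norm_mul, norm_norm, Real.norm_eq_abs]
  exact this

/-- The Taylor polynomial of degree `N`, without constant term, of the function on the disc with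
boundary values `φ`. -/
def taylorSum (ε : ℤ) (φ : ℝ → ℂ) (N : ℕ) (w : ℂ) : ℂ :=
  ∑ k ∈ Finset.Icc 1 N, fc (ε * k) φ * w ^ k

theorem hasDerivAt_taylorSum (ε : ℤ) (φ : ℝ → ℂ) (N : ℕ) (w : ℂ) :
    HasDerivAt (taylorSum ε φ N) (∑ k ∈ Finset.Icc 1 N, fc (ε * k) φ * (k * w ^ (k - 1))) w := by
  have h := HasDerivAt.fun_sum (u := Finset.Icc 1 N) (x := w)
    fun k _ => (hasDerivAt_pow k w).const_mul (fc (ε * k) φ)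
  exact h

theorem differentiable_taylorSum (ε : ℤ) (φ : ℝ → ℂ) (N : ℕ) :
    Differentiable ℂ (taylorSum ε φ N) := fun w => (hasDerivAt_taylorSum ε φ N w).differentiableAt

theorem taylorSum_zero (ε : ℤ) (φ : ℝ → ℂ) (N : ℕ) : taylorSum ε φ N 0 = 0 := by
  refine Finset.sum_eq_zero fun k hk => ?_
  rw [Finset.mem_Icc] at hk
  rw [zero_pow (by omega), mul_zero]

theorem continuous_deriv_taylorSum (ε : ℤ) (φ : ℝ → ℂ) (N : ℕ) :
    Continuous (deriv (taylorSum ε φ N)) := by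
  rw [funext fun w => (hasDerivAt_taylorSum ε φ N w).deriv]
  fun_prop

/-- Only the linear term counts, so truncating both velocities at the same degree preserves the
normalization of the pair exactly. -/
theorem deriv_taylorSum_zero {ε ε' : ℤ} {φ ψ : ℝ → ℂ} (h : fc ε φ = fc ε' ψ) (N : ℕ) :
    deriv (taylorSum ε φ N) 0 = deriv (taylorSum ε' ψ N) 0 := by
  rw [(hasDerivAt_taylorSum ε φ N 0).deriv, (hasDerivAt_taylorSum ε' ψ N 0).deriv]
  refine Finset.sum_congr rfl fun k hk => ?_
  rw [Finset.mem_Icc] at hk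
  rcases eq_or_ne k 1 with rfl | hk1
  · simp [h]
  · rw [zero_pow (by omega), mul_zero, mul_zero, mul_zero]

theorem exists_taylorSum_bound (ε : ℤ) (φ : ℝ → ℂ) (R : ℝ) (N : ℕ) :
    ∃ M : ℝ, ∀ w, ‖w‖ ≤ R → ‖taylorSum ε φ N w‖ ≤ M ∧ ‖deriv (taylorSum ε φ N) w‖ ≤ M := by
  obtain ⟨M₁, h1⟩ := (isCompact_closedBall (0 : ℂ) R).exists_bound_of_continuousOn
    (differentiable_taylorSum ε φ N).continuous.continuousOn
  obtain ⟨M₂, h2⟩ := (isCompact_closedBall (0 : ℂ) R).exists_bound_of_continuousOn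
    (continuous_deriv_taylorSum ε φ N).continuousOn
  exact ⟨max M₁ M₂, fun w hw => ⟨(h1 w (by simpa using hw)).trans (le_max_left _ _),
    (h2 w (by simpa using hw)).trans (le_max_right _ _)⟩⟩

theorem tendsto_taylorSum {ε : ℤ} (hε : ε = 1 ∨ ε = -1) {φ : ℝ → ℂ} (hφ : MemLp φ 2 angleMeasure)
    (h0 : ∀ k < 1, fc (ε * k) φ = 0) :
    Tendsto (fun N : ℕ => eLpNorm (fun θ => taylorSum ε φ N (circ ε θ) - φ θ) 2 angleMeasure)
      atTop (𝓝 0) := by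
  refine (tendsto_fourierSum hφ).congr fun N => eLpNorm_congr_ae ?_
  have hc : Continuous fun θ => taylorSum ε φ N (circ ε θ) :=
    (differentiable_taylorSum ε φ N).continuous.comp (continuous_circ ε)
  have h := ae_eq_of_fc (memLp_of_continuous (continuous_fourierSum φ N) 2)
    (memLp_of_continuous hc 2) fun k => by
      have e : (fun θ => taylorSum ε φ N (circ ε θ)) =
          fun θ => ∑ j ∈ Finset.Icc 1 N, fc (ε * j) φ * circ (ε * j) θ := by
        funext θ
        simp only [taylorSum, circ_mul, zpow_natCast]
      have hεε := mul_self_of_sign hε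
      obtain ⟨m, rfl⟩ : ∃ m, k = ε * m := ⟨ε * k, by rw [← mul_assoc, hεε, one_mul]⟩
      rw [e, fc_laurent hε N (fun j => fc j φ), fc_fourierSum]
      by_cases hm : m < 1
      · rw [h0 m hm]
        simp
      · have : (ε * m ∈ Finset.Icc (-(N : ℤ)) N) ↔ 1 ≤ m ∧ m ≤ N := by
          rw [Finset.mem_Icc]
          rcases hε with rfl | rfl <;> omega
        simp only [this]
  filter_upwards [h] with θ hθ
  rw [hθ]

theorem eventually_nhds_of_punctured {P : ℂ → Prop} (h : ∀ᶠ s in 𝓝[≠] (0 : ℂ), P s) (h0 : P 0) :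
    ∀ᶠ s in 𝓝 (0 : ℂ), P s := by
  rw [eventually_nhdsWithin_iff] at h
  filter_upwards [h] with s hs
  by_cases hs0 : s = 0
  · rwa [hs0]
  · exact hs hs0

theorem tendstoUniformly_of_le {u : ℂ → ℝ → ℂ} {e : ℂ → ℝ} (he : Tendsto e (𝓝[≠] 0) (𝓝 0))
    (h : ∀ᶠ s in 𝓝[≠] 0, ∀ θ, ‖u s θ - u 0 θ‖ ≤ e s) : TendstoUniformly u (u 0) (𝓝 0) := by
  rw [Metric.tendstoUniformly_iff]
  intro r hr
  refine eventually_nhds_of_punctured ?_ fun θ => by rwa [dist_self]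
  filter_upwards [h, he.eventually (gt_mem_nhds hr)] with s hs her θ
  rw [dist_comm, dist_eq_norm]
  exact (hs θ).trans_lt her

/-- Perturbing a disc map by Taylor polynomials of slowly growing degree of its velocity. -/
theorem l2Curve_of_taylorSum {A : ℂ → ℂ → ℂ} (hA : ∀ s, IsDiscMap (A s)) {ε : ℤ}
    (hε : ε = 1 ∨ ε = -1) {φ : ℝ → ℂ} (hφ : MemLp φ 2 angleMeasure)
    (h0 : ∀ k < 1, fc (ε * k) φ = 0) {M : ℕ → ℝ}
    (hM : ∀ n w, ‖w‖ ≤ 1 → ‖taylorSum ε φ n w‖ ≤ M n ∧ ‖deriv (taylorSum ε φ n) w‖ ≤ M n)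
    {N : ℂ → ℕ} (hN : Tendsto N (𝓝[≠] 0) atTop)
    (hMN : Tendsto (fun s => ‖s‖ * M (N s)) (𝓝[≠] 0) (𝓝 0))
    (hAN : ∀ᶠ s in 𝓝[≠] 0, A s = fun w => A 0 w + s * taylorSum ε φ (N s) w) :
    TendstoC1 (fun s θ => A s (circ ε θ)) (fun θ => A 0 (circ ε θ)) ∧
      L2Curve (fun s θ => A s (circ ε θ)) φ := by
  have hu : TendstoUniformly (fun s θ => A s (circ ε θ)) (fun θ => A 0 (circ ε θ)) (𝓝 0) := by
    refine tendstoUniformly_of_le (u := fun s θ => A s (circ ε θ)) hMN ?_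
    filter_upwards [hAN] with s hs θ
    rw [hs, add_sub_cancel_left, norm_mul]
    exact mul_le_mul_of_nonneg_left (hM _ _ (norm_circ ε θ).le).1 (norm_nonneg _)
  refine ⟨⟨hu, ?_⟩, fun s => (hA s).continuous_boundary ε, hu.tendstoLocallyUniformly,
    ?_, hφ, ?_⟩
  · refine tendstoUniformly_of_le (u := fun s => deriv fun θ => A s (circ ε θ)) hMN ?_
    filter_upwards [hAN] with s hs θ
    have hd : HasDerivAt (fun θ => taylorSum ε φ (N s) (circ ε θ))
        (deriv (taylorSum ε φ (N s)) (circ ε θ) * (ε * Complex.I * circ ε θ)) θ :=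
      HasDerivAt.comp (h₂ := taylorSum ε φ (N s)) θ
        (differentiable_taylorSum ε φ (N s) _).hasDerivAt (hasDerivAt_circ ε θ)
    have h1 := (((hA 0).boundary hε).1 θ).hasDerivAt.add (hd.const_mul s)
    have h2 : deriv (fun θ => A s (circ ε θ)) θ = deriv (fun θ => A 0 (circ ε θ)) θ +
        s * (deriv (taylorSum ε φ (N s)) (circ ε θ) * (ε * Complex.I * circ ε θ)) := by
      rw [hs]
      exact h1.deriv
    have hεn : ‖(ε : ℂ)‖ = 1 := by rcases hε with rfl | rfl <;> simp
    rw [h2, add_sub_cancel_left, norm_mul, norm_mul, norm_mul, norm_mul, hεn, Complex.norm_I,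
      norm_circ, mul_one, mul_one, mul_one]
    exact mul_le_mul_of_nonneg_left (hM _ _ (norm_circ ε θ).le).2 (norm_nonneg _)
  · exact Eventually.of_forall fun s => memLp_of_continuous
      ((((hA s).continuous_boundary ε).sub ((hA 0).continuous_boundary ε)).div_const s) 2
  · refine ((tendsto_taylorSum hε hφ h0).comp hN).congr' ?_
    filter_upwards [hAN, self_mem_nhdsWithin] with s hs hs0
    have hs0' : s ≠ 0 := hs0
    simp only [Function.comp]
    congr 1
    funext θ
    rw [hs, add_sub_cancel_left, mul_div_cancel_left₀ _ hs0']

theorem tendstoUniformly_of_periodic {u : ℂ → ℝ → ℂ} {u₀ : ℝ → ℂ}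
    (h : TendstoLocallyUniformly u u₀ (𝓝 0)) (hp : ∀ s, Function.Periodic (u s) (2 * Real.pi))
    (hp0 : Function.Periodic u₀ (2 * Real.pi)) : TendstoUniformly u u₀ (𝓝 0) := by
  intro v hv
  filter_upwards [tendstoUniformlyOn_angle h v hv] with s hs θ
  obtain ⟨n, hn, -⟩ := existsUnique_zsmul_near_of_pos' (by positivity : 0 < 2 * Real.pi) θ
  rw [← hp0.sub_zsmul_eq n, ← (hp s).sub_zsmul_eq n]
  exact hs _ ⟨hn.1, hn.2.le⟩

theorem mkPair_ginv {a b : ℂ → ℂ} (ha : IsDiscMap a) (hb : IsDiscMap b)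
    (hab : deriv a 0 = deriv b 0) : (mkPair a b ha hb hab).ginv = b := by
  funext ζ
  by_cases h0 : ζ = 0
  · rw [h0, hb.zero]
    exact if_pos rfl
  · rw [ConformalPair.ginv_of_ne _ h0]
    simp [mkPair]

theorem ConformalPair.periodic_fb (p : ConformalPair) : Function.Periodic p.fb (2 * Real.pi) :=
  fun θ => by rw [p.fb_eq, p.fb_eq, circ_periodic]

theorem ConformalPair.periodic_gb (p : ConformalPair) : Function.Periodic p.gb (2 * Real.pi) :=
  fun θ => by rw [p.gb_eq, p.gb_eq, circ_periodic]

theorem periodic_deriv {u : ℝ → ℂ} {T : ℝ} (h : Function.Periodic u T) :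
    Function.Periodic (deriv u) T := fun θ => by
  rw [← deriv_comp_add_const, funext h]

theorem tendstoC1_gb {c : ℂ → ConformalPair}
    (h : TendstoC1 (fun s => (c s).ginvb) (c 0).ginvb) :
    TendstoC1 (fun s => (c s).gb) (c 0).gb := by
  have hc : Continuous (c 0).ginvb := (c 0).isDiscMap_ginv.continuous_boundary _
  have hcd : Continuous (deriv (c 0).ginvb) := ((c 0).isDiscMap_ginv.boundary (Or.inr rfl)).2.1
  have hg : ∀ s, (c s).gb = fun θ => ((c s).ginvb θ)⁻¹ := fun s => (c s).gb_eq_fun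
  have h1 : TendstoLocallyUniformly (fun s => (c s).gb) (c 0).gb (𝓝 0) := by
    simp only [hg]
    exact h.1.tendstoLocallyUniformly.inv₀ hc (c 0).ginv_circ_ne_zero
  have h2 : TendstoLocallyUniformly (fun s => deriv (c s).gb) (deriv (c 0).gb) (𝓝 0) := by
    have hgc := (c 0).differentiable_gb.continuous
    have h3 := (h.2.tendstoLocallyUniformly.mul₀ (h1.mul₀ h1 hgc hgc) hcd (hgc.mul hgc)).neg
    have e : ∀ s, deriv (c s).gb = -(deriv (c s).ginvb * ((c s).gb * (c s).gb)) := fun s => by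
      funext θ
      rw [(c s).deriv_gb_eq]
      simp only [Pi.neg_apply, Pi.mul_apply]
      ring
    rw [e, funext e]
    exact h3
  exact ⟨tendstoUniformly_of_periodic h1 (fun s => (c s).periodic_gb) (c 0).periodic_gb,
    tendstoUniformly_of_periodic h2 (fun s => periodic_deriv (c s).periodic_gb)
      (periodic_deriv (c 0).periodic_gb)⟩

theorem L2Curve.differentiableL2 {u : ℂ → ℝ → ℂ} {φ : ℝ → ℂ} (h : L2Curve u φ) :
    DifferentiableL2 u := ⟨φ, h.velocity.2.1, h.velocity.2.2⟩

/-- An `L²` velocity `φ` cannot simply be added as `f + s φ`, since the result need not be `C¹` up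
to the circle. Adding `s` times Taylor polynomials of degree `N(s) → ∞` works: slow growth gives
`C¹` convergence and stability of disc maps, while the polynomials tend to the velocity in `L²`. -/
theorem exists_curve (p : ConformalPair) {φ ψ : ℝ → ℂ} (hφ : MemLp φ 2 angleMeasure)
    (hψ : MemLp ψ 2 angleMeasure) (hφ0 : ∀ k < 1, fc (1 * k) φ = 0)
    (hψ0 : ∀ k < 1, fc (-1 * k) ψ = 0) (hφψ : fc 1 φ = fc (-1) ψ) :
    ∃ c, IsCurveThrough p c ∧ L2Curve (fun s => (c s).fb) φ ∧ L2Curve (fun s => (c s).ginvb) ψ := by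
  classical
  obtain ⟨δ₁, hδ₁, R₁, hR₁, H₁⟩ := p.isDiscMap_f.exists_perturbation
  obtain ⟨δ₂, hδ₂, R₂, hR₂, H₂⟩ := p.isDiscMap_ginv.exists_perturbation
  choose M₁ hM₁ using exists_taylorSum_bound 1 φ R₁
  choose M₂ hM₂ using exists_taylorSum_bound (-1) ψ R₂
  obtain ⟨N, hN, hMN⟩ := exists_slow_index fun n => max (M₁ n) (M₂ n)
  have hmem : ∀ {ε : ℤ} {χ : ℝ → ℂ} {R δ : ℝ} {M : ℕ → ℝ} {a : ℂ → ℂ},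
      (∀ n w, ‖w‖ ≤ R → ‖taylorSum ε χ n w‖ ≤ M n ∧ ‖deriv (taylorSum ε χ n) w‖ ≤ M n) →
      (∀ n, M n ≤ max (M₁ n) (M₂ n)) → 0 < δ →
      (∀ η : ℂ → ℂ, Differentiable ℂ η → η 0 = 0 →
        (∀ w, ‖w‖ ≤ R → ‖η w‖ ≤ δ ∧ ‖deriv η w‖ ≤ δ) → IsDiscMap fun w => a w + η w) →
      ∀ᶠ s in 𝓝[≠] 0, IsDiscMap fun w => a w + s * taylorSum ε χ (N s) w := by
    intro ε χ R δ M a hM hle hδ H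
    filter_upwards [hMN.eventually (gt_mem_nhds hδ)] with s hs
    have hb : ‖s‖ * M (N s) ≤ δ :=
      (mul_le_mul_of_nonneg_left (hle _) (norm_nonneg _)).trans hs.le
    refine H (fun w => s * taylorSum ε χ (N s) w) ((differentiable_taylorSum ε χ _).const_mul s)
      (by rw [taylorSum_zero, mul_zero]) fun w hw => ⟨?_, ?_⟩
    · rw [norm_mul]
      exact (mul_le_mul_of_nonneg_left (hM _ w hw).1 (norm_nonneg _)).trans hb
    · rw [deriv_const_mul _ (differentiable_taylorSum ε χ _ w), norm_mul]
      exact (mul_le_mul_of_nonneg_left (hM _ w hw).2 (norm_nonneg _)).trans hb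
  have e1 := hmem hM₁ (fun n => le_max_left _ _) hδ₁ H₁
  have e2 := hmem hM₂ (fun n => le_max_right _ _) hδ₂ H₂
  set a : ℂ → ℂ → ℂ := fun s w => p.f w + s * taylorSum 1 φ (N s) w with ha
  set b : ℂ → ℂ → ℂ := fun s w => p.ginv w + s * taylorSum (-1) ψ (N s) w with hb
  have hab : ∀ s, deriv (a s) 0 = deriv (b s) 0 := by
    intro s
    have h1 := p.isDiscMap_f.hasDerivAt_zero.add
      ((differentiable_taylorSum 1 φ (N s) 0).hasDerivAt.const_mul s)
    have h2 := p.isDiscMap_ginv.hasDerivAt_zero.add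
      ((differentiable_taylorSum (-1) ψ (N s) 0).hasDerivAt.const_mul s)
    refine h1.deriv.trans (Eq.trans ?_ h2.deriv.symm)
    rw [p.deriv_ginv_zero, deriv_taylorSum_zero hφψ]
  -- Away from `0` the fallback value `p` is used only where the perturbed maps are not disc maps,
  -- which does not happen near `s = 0`. The point `s = 0` is excluded so that `c 0` is literally
  -- `p`: the pair rebuilt from its disc maps may have another, irrelevant value of `g` at `0`.
  set c : ℂ → ConformalPair := fun s =>
    if h : s ≠ 0 ∧ IsDiscMap (a s) ∧ IsDiscMap (b s) then mkPair (a s) (b s) h.2.1 h.2.2 (hab s)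
    else p with hc
  have hc0 : c 0 = p := by
    simp only [hc]
    exact dif_neg fun h => h.1 rfl
  have hcs : ∀ᶠ s in 𝓝[≠] 0, (c s).f = a s ∧ (c s).ginv = b s := by
    filter_upwards [e1, e2, self_mem_nhdsWithin] with s h1 h2 h3
    have : c s = mkPair (a s) (b s) h1 h2 (hab s) := dif_pos ⟨h3, h1, h2⟩
    rw [this, mkPair_ginv]
    exact ⟨rfl, rfl⟩
  have hb1 : ∀ n (w : ℂ), ‖w‖ ≤ 1 → ‖taylorSum 1 φ n w‖ ≤ max (M₁ n) (M₂ n) ∧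
      ‖deriv (taylorSum 1 φ n) w‖ ≤ max (M₁ n) (M₂ n) := fun n w hw =>
    ⟨(hM₁ n w (hw.trans hR₁)).1.trans (le_max_left _ _),
      (hM₁ n w (hw.trans hR₁)).2.trans (le_max_left _ _)⟩
  have hb2 : ∀ n (w : ℂ), ‖w‖ ≤ 1 → ‖taylorSum (-1) ψ n w‖ ≤ max (M₁ n) (M₂ n) ∧
      ‖deriv (taylorSum (-1) ψ n) w‖ ≤ max (M₁ n) (M₂ n) := fun n w hw =>
    ⟨(hM₂ n w (hw.trans hR₂)).1.trans (le_max_right _ _),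
      (hM₂ n w (hw.trans hR₂)).2.trans (le_max_right _ _)⟩
  obtain ⟨f1, f2⟩ := l2Curve_of_taylorSum (A := fun s => (c s).f) (fun s => (c s).isDiscMap_f)
    (Or.inl rfl) hφ hφ0 hb1 hN hMN (hcs.mono fun s hs => by rw [hc0]; exact hs.1)
  obtain ⟨g1, g2⟩ := l2Curve_of_taylorSum (A := fun s => (c s).ginv)
    (fun s => (c s).isDiscMap_ginv) (Or.inr rfl) hψ hψ0 hb2 hN hMN
    (hcs.mono fun s hs => by rw [hc0]; exact hs.2)
  have f1' : TendstoC1 (fun s => (c s).fb) (c 0).fb := by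
    simpa only [ConformalPair.fb_eq_fun] using f1
  have f2' : L2Curve (fun s => (c s).fb) φ := by simpa only [ConformalPair.fb_eq_fun] using f2
  have g1' : TendstoC1 (fun s => (c s).ginvb) (c 0).ginvb := g1
  have g2' : L2Curve (fun s => (c s).ginvb) ψ := g2
  have hg := tendstoC1_gb g1'
  rw [hc0] at hg f1'
  exact ⟨c, ⟨hc0, f1', hg, f2'.differentiableL2, g2'.gb.differentiableL2⟩, f2', g2'⟩

theorem exists_isTimeCurve {n : ℤ} {p : ConformalPair} {H u v : ℝ → ℂ} (hH : IsTimeDensity n p H)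
    (hs : BalancedSplit (fun θ => densityRatio p θ * H θ) u v) : ∃ c, IsTimeCurve n p c := by
  obtain ⟨a1, a2, a3⟩ := p.isDiscMap_f.fc_velocity_mul (Or.inl rfl) hs.right hs.right_zero
  obtain ⟨b1, b2, b3⟩ := p.isDiscMap_ginv.fc_velocity_mul (Or.inr rfl) hs.left hs.left_zero
  rw [← p.fb_eq_fun] at a1 a2 a3
  obtain ⟨c, hc, hf, hg⟩ := exists_curve p a1 b1 a2 b2 (by
    rw [a3, b3, p.deriv_ginv_zero]
    push_cast
    linear_combination (deriv p.f 0) * hs.balance)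
  exact ⟨c, hc.isTimeCurve hH hs hf hg⟩

/-- The curves in the direction of a time variable exist and all have the same velocity. -/
theorem IsTimeCurve.l2Curve {n : ℤ} {p : ConformalPair} {c : ℂ → ConformalPair}
    (h : IsTimeCurve n p c) {H u v : ℝ → ℂ} (hH : IsTimeDensity n p H)
    (hs : BalancedSplit (fun θ => densityRatio p θ * H θ) u v) :
    L2Curve (fun s => (c s).fb) (fun θ => -Complex.I * deriv p.fb θ * v θ) ∧
      L2Curve (fun s => (c s).ginvb) (fun θ => -Complex.I * deriv p.ginvb θ * u θ) := by
  obtain ⟨u', v', hs', hf, hg⟩ := h.exists_velocity hH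
  obtain ⟨hu, hv⟩ := hs'.unique hs
  refine ⟨hf.congr_ae ?_, hg.congr_ae ?_⟩
  · filter_upwards [hv] with θ hθ
    rw [hθ]
  · filter_upwards [hu] with θ hθ
    rw [hθ]

/-! ### The Lax equations -/

/-- The polynomial part `∑_{1 ≤ k ≤ n} b_k w^{σk} + b_0 / 2` of the series with boundary values `B`
on the circle. -/
def polyPart (σ : ℤ) (n : ℕ) (B : ℝ → ℂ) (w : ℂ) : ℂ :=
  (∑ k ∈ Finset.Icc 1 n, fc (σ * k) B * w ^ (σ * k)) + 1 / 2 * fc 0 B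

theorem polyPart_circ (σ : ℤ) (n : ℕ) (B : ℝ → ℂ) (θ : ℝ) :
    polyPart σ n B (circ 1 θ) =
      (∑ k ∈ Finset.Icc 1 n, fc (σ * k) B * circ (σ * k) θ) + 1 / 2 * fc 0 B := by
  simp only [polyPart, ← circ_mul, one_mul]

theorem continuous_polyPart_circ (σ : ℤ) (n : ℕ) (B : ℝ → ℂ) :
    Continuous fun θ => polyPart σ n B (circ 1 θ) := by
  simp only [polyPart_circ]
  exact (continuous_finsetSum _ fun j _ => continuous_const.mul (continuous_circ _)).add
    continuous_const

theorem mul_deriv_polyPart (σ : ℤ) (n : ℕ) (B : ℝ → ℂ) {w : ℂ} (hw : w ≠ 0) :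
    w * deriv (polyPart σ n B) w =
      ∑ k ∈ Finset.Icc 1 n, (((σ * k : ℤ) : ℂ) * fc (σ * k) B) * w ^ (σ * k) := by
  have h : HasDerivAt (polyPart σ n B)
      (∑ k ∈ Finset.Icc 1 n, fc (σ * k) B * (((σ * k : ℤ) : ℂ) * w ^ (σ * k - 1))) w :=
    (HasDerivAt.fun_sum (u := Finset.Icc 1 n) fun (k : ℕ) _ =>
      (hasDerivAt_zpow (σ * k) w (Or.inl hw)).const_mul (fc (σ * k) B)).add_const _
  rw [h.deriv, Finset.mul_sum]
  refine Finset.sum_congr rfl fun k _ => ?_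
  rw [zpow_sub_one₀ hw]
  field_simp

theorem fc_polyPart {σ : ℤ} (hσ : σ = 1 ∨ σ = -1) (n : ℕ) (E : ℝ → ℂ) (k : ℤ) :
    fc (σ * k) (fun θ => polyPart σ n E (circ 1 θ)) =
      (if 1 ≤ k ∧ k ≤ n then fc (σ * k) E else 0) + if k = 0 then 1 / 2 * fc 0 E else 0 := by
  have hσ0 : σ ≠ 0 := by rcases hσ with rfl | rfl <;> norm_num
  simp only [polyPart_circ]
  rw [fc_add (φ := fun θ => ∑ k ∈ Finset.Icc 1 n, fc (σ * k) E * circ (σ * k) θ)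
    (memLp_of_continuous (continuous_finsetSum _ fun j _ => continuous_const.mul (continuous_circ _)) 2)
    (memLp_const _), fc_laurent hσ n (fun j => fc j E), fc_const]
  simp only [mul_eq_zero, hσ0, false_or]

theorem L2Curve.hasDerivAt_polyPart {B : ℂ → ℝ → ℂ} {E : ℝ → ℂ} (h : L2Curve B E) (σ : ℤ) (n : ℕ)
    (w : ℂ) : HasDerivAt (fun s => polyPart σ n (B s) w) (polyPart σ n E w) 0 := by
  refine HasDerivAt.add ?_ ((h.hasDerivAt_fc 0).const_mul _)
  exact HasDerivAt.fun_sum fun k _ => (h.hasDerivAt_fc _).mul_const _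

/-- Correcting the product of a splitting by the Hamiltonian into a balanced splitting. -/
theorem balanced_correction {σ : ℤ} (hσ : σ = 1 ∨ σ = -1) {n : ℕ} {B D x y : ℝ → ℂ}
    (hDc : Continuous D) (hD : ∀ k, fc k D = k * fc k B) (hB : ∀ k : ℤ, n < k → fc (σ * k) B = 0)
    (hx : MemLp x 2 angleMeasure) (hy : MemLp y 2 angleMeasure)
    (hx0 : ∀ k < 0, fc (-σ * k) x = 0) (hy0 : ∀ k < 0, fc (σ * k) y = 0) :
    (∀ k < 0, fc (-σ * k) (fun θ => hamDeriv σ n B θ * x θ -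
      polyPart σ n (fun θ => D θ * x θ) (circ 1 θ)) = 0) ∧
    (∀ k < 0, fc (σ * k) (fun θ => hamDeriv σ n B θ * y θ -
      polyPart σ n (fun θ => D θ * x θ) (circ 1 θ)) = 0) ∧
    fc 0 (fun θ => hamDeriv σ n B θ * x θ - polyPart σ n (fun θ => D θ * x θ) (circ 1 θ)) +
      fc 0 (fun θ => hamDeriv σ n B θ * y θ -
        polyPart σ n (fun θ => D θ * x θ) (circ 1 θ)) = 0 := by
  have hHc := continuous_hamDeriv σ n B
  have hHx := memLp_continuous_mul hx hHc
  have hHy := memLp_continuous_mul hy hHc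
  have hDx := memLp_continuous_mul hx hDc
  have hβ := memLp_of_continuous (continuous_polyPart_circ σ n fun θ => D θ * x θ) 2
  -- `D - hamDeriv` has only frequencies `σ k` with `k ≤ -1`, and `x` only those with `k ≤ 0`, so
  -- their product is invisible to the indices `k ≥ 0`.
  have h1 : ∀ k : ℤ, 0 ≤ k → fc (σ * k) (fun θ => hamDeriv σ n B θ * x θ) =
      fc (σ * k) (fun θ => D θ * x θ) := by
    intro k hk
    have h2 := fc_mul_eq_zero (neg_sign hσ) (hDc.sub hHc) hx (p := 1) (q := 0) (k := -k)
      (fun j hj => by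
        refine (fc_sub (memLp_of_continuous hDc 2) (memLp_of_continuous hHc 2) _).trans ?_
        rw [hD, show -σ * j = σ * -j by ring, fc_hamDeriv hσ]
        split_ifs with h
        · exact sub_self _
        · by_cases hj0 : j = 0
          · simp [hj0]
          · rw [hB (-j) (by omega)]
            simp) hx0 (by omega)
    rw [neg_mul_neg] at h2
    have h3 := fc_sub hDx hHx (σ * k)
    simp only [← sub_mul] at h3
    exact (sub_eq_zero.1 (h3.symm.trans h2)).symm
  -- Truncation at degree `n` in `polyPart` therefore discards nothing.
  have h4 : ∀ k : ℤ, n < k → fc (σ * k) (fun θ => D θ * x θ) = 0 := by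
    intro k hk
    have h2 := fc_mul_eq_zero (neg_sign hσ) hDc hx (p := -n) (q := 0) (k := -k)
      (fun j hj => by
        rw [hD, show -σ * j = σ * -j by ring, hB (-j) (by omega), mul_zero]) hx0 (by omega)
    rwa [neg_mul_neg] at h2
  have h5 : ∀ k : ℤ, k < 1 → fc (σ * k) (fun θ => hamDeriv σ n B θ * y θ) = 0 := fun k hk =>
    fc_mul_eq_zero hσ hHc hy (p := 1) (q := 0)
      (fun j hj => by rw [fc_hamDeriv hσ, if_neg (by omega)]) hy0 (by omega)
  have hβk := fc_polyPart hσ n fun θ => D θ * x θ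
  refine ⟨fun k hk => ?_, fun k hk => ?_, ?_⟩
  · rw [fc_sub hHx hβ, show -σ * k = σ * -k by ring, h1 _ (by omega), hβk,
      if_neg (show -k ≠ 0 by omega), add_zero]
    split_ifs with h
    · exact sub_self _
    · rw [h4 _ (by omega), sub_zero]
  · rw [fc_sub hHy hβ, h5 _ (by omega), hβk, if_neg (by omega), if_neg hk.ne, add_zero, sub_zero]
  -- With `e` the constant term of `D x`, the two constant terms are `e - e/2` and `0 - e/2`: the
  -- factor `1/2` in the Hamiltonian is forced by the balance.
  · have e1 := h1 0 le_rfl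
    have e2 := h5 0 one_pos
    have e3 := hβk 0
    rw [mul_zero] at e1 e2 e3
    rw [if_neg (by omega), if_pos rfl, zero_add] at e3
    rw [fc_sub hHx hβ, fc_sub hHy hβ, e1, e2, e3]
    ring

/-- The holomorphic extension of a corrected velocity. -/
theorem IsDiscMap.cauchyExt_correction {a : ℂ → ℂ} (ha : IsDiscMap a) {ε : ℤ}
    (hε : ε = 1 ∨ ε = -1) {σ : ℤ} {n : ℕ} {B E x : ℝ → ℂ} (hx : MemLp x 2 angleMeasure)
    (hx0 : ∀ k < 0, fc (ε * k) x = 0)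
    (hx0' : ∀ k < 0, fc (ε * k)
      (fun θ => hamDeriv σ n B θ * x θ - polyPart σ n E (circ 1 θ)) = 0)
    {w : ℂ} (hw0 : w ≠ 0) (hw : ‖w ^ ε‖ < 1) :
    cauchyExt ε (fun θ => -Complex.I * deriv (fun θ => a (circ ε θ)) θ *
        (hamDeriv σ n B θ * x θ - polyPart σ n E (circ 1 θ))) (w ^ ε) =
      w * deriv (polyPart σ n B) w *
        cauchyExt ε (fun θ => -Complex.I * deriv (fun θ => a (circ ε θ)) θ * x θ) (w ^ ε) -
      polyPart σ n E w * (ε * (w ^ ε * deriv a (w ^ ε))) := by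
  obtain ⟨a₁, d1, -, d3, d4⟩ := ha.exists_deriv
  have hβc := continuous_polyPart_circ σ n E
  have hm := (memLp_continuous_mul hx (continuous_hamDeriv σ n B)).sub (memLp_of_continuous hβc 2)
  obtain ⟨m0, z0, -⟩ := ha.fc_velocity_mul hε hx hx0
  obtain ⟨m1, z1, -⟩ := ha.fc_velocity_mul hε hm hx0'
  have S0 := hasSum_cauchyExt_int hε m0 (fun k hk => z0 k (by omega)) hw
  have S1 := hasSum_cauchyExt_int hε m1 (fun k hk => z1 k (by omega)) hw
  set φ := fun θ => -Complex.I * deriv (fun θ => a (circ ε θ)) θ * x θ with hφ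
  set b : ℂ → ℂ := fun ζ => ε * (ζ * a₁ ζ) with hb
  have hbd : DiffContOnCl ℂ b (Metric.ball 0 1) :=
    (differentiable_id.diffContOnCl.smul d1).const_smul (ε : ℂ)
  have hbc := DiffContOnCl_continuous_circ hbd ε
  have mb := memLp_of_continuous hbc 2
  have Sb := hasSum_cauchyExt_int hε mb (fun k hk => fc_boundary_of_neg hε hbd hk) hw
  rw [cauchyExt_boundary hε hbd hw] at Sb
  have T0 := hasSum_fc_laurent_mul m0 hw0 S0 (Finset.Icc 1 n)
    (fun k : ℕ => ((σ * k : ℤ) : ℂ) * fc (σ * k) B) (fun k => σ * k)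
  have T1 := (hasSum_fc_laurent_mul mb hw0 Sb (Finset.Icc 1 n)
    (fun k : ℕ => fc (σ * k) E) (fun k => σ * k)).add (Sb.mul_left (1 / 2 * fc 0 E))
  have T2 := T0.sub T1
  -- The Laurent polynomials mix powers of both signs, so the identity cannot be extended off the
  -- circle factor by factor. Instead both sides are sums at `w` of Laurent series whose
  -- coefficients agree because the functions agree on the circle.
  refine (S1.unique (hasSum_of_eq T2 fun k => ?_)).trans ?_
  · have e : (fun θ => -Complex.I * deriv (fun θ => a (circ ε θ)) θ *
        (hamDeriv σ n B θ * x θ - polyPart σ n E (circ 1 θ))) =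
        fun θ => hamDeriv σ n B θ * φ θ -
          ((∑ k ∈ Finset.Icc 1 n, fc (σ * k) E * circ (σ * k) θ) * b (circ ε θ) +
            1 / 2 * fc 0 E * b (circ ε θ)) := by
      funext θ
      rw [← add_mul, ← polyPart_circ]
      simp only [hφ, hb]
      rw [(d4 ε θ).deriv]
      linear_combination (polyPart σ n E (circ 1 θ) * ε * circ ε θ * a₁ (circ ε θ)) *
        Complex.I_mul_I
    have hs : Continuous fun θ => ∑ k ∈ Finset.Icc 1 n, fc (σ * k) E * circ (σ * k) θ :=
      continuous_finsetSum _ fun j _ => continuous_const.mul (continuous_circ _)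
    change fc k (fun θ => -Complex.I * deriv (fun θ => a (circ ε θ)) θ *
        (hamDeriv σ n B θ * x θ - polyPart σ n E (circ 1 θ))) * w ^ k = _
    rw [e, fc_sub (φ := fun θ => hamDeriv σ n B θ * φ θ)
      (ψ := fun θ => (∑ k ∈ Finset.Icc 1 n, fc (σ * k) E * circ (σ * k) θ) * b (circ ε θ) +
        1 / 2 * fc 0 E * b (circ ε θ)) (memLp_continuous_mul m0 (continuous_hamDeriv σ n B))
      (memLp_of_continuous ((hs.mul hbc).add (continuous_const.mul hbc)) 2),
      fc_add (φ := fun θ => (∑ k ∈ Finset.Icc 1 n, fc (σ * k) E * circ (σ * k) θ) * b (circ ε θ))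
        (memLp_of_continuous (hs.mul hbc) 2) (mb.const_mul _), fc_const_mul]
    unfold hamDeriv
    ring
  · rw [mul_deriv_polyPart _ _ _ hw0, polyPart, (d3 _ hw).deriv]
    ring

/-! ### The Hamiltonians as polynomial parts, and assembly of the Lax equations -/

theorem laurentCoeff_eq_fc (φ : ℂ → ℂ) (k : ℤ) :
    laurentCoeff φ k = fc k (fun θ => φ (circleMap 0 1 θ)) := by
  unfold laurentCoeff circleIntegral fc
  rw [intervalIntegral_eq_angleMeasure, mul_inv, mul_assoc, ← integral_const_mul]
  congr 2
  funext θ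
  have h0 := circleMap_zero_one_ne_zero θ
  simp only [deriv_circleMap, circ, smul_eq_mul]
  rw [zpow_sub_one₀ h0]
  have := Complex.I_ne_zero
  field_simp

theorem laxB_eq (n : ℕ) (p : ConformalPair) : laxB n p = polyPart 1 n (fun θ => p.gb θ ^ (n : ℤ)) := by
  funext w
  simp only [laxB, polyPart, laurentCoeff_eq_fc, one_mul, zpow_natCast]
  rfl

theorem laxBTilde_eq (n : ℕ) (p : ConformalPair) :
    laxBTilde n p = polyPart (-1) n (fun θ => p.fb θ ^ (-(n : ℤ))) := by
  funext w
  simp only [laxBTilde, polyPart, laurentCoeff_eq_fc, neg_one_mul, zpow_neg, zpow_natCast]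
  rfl

/-- The data of the variation of a pair in the direction of a time variable. -/
structure IsTimeVelocity (n : ℤ) (p : ConformalPair) (u v : ℝ → ℂ) : Prop where
  split : ∃ H, IsTimeDensity n p H ∧ BalancedSplit (fun θ => densityRatio p θ * H θ) u v

/-- A time derivative quantifies over all curves in the given direction; since such curves exist and
share their boundary velocities, differentiating along curves with these velocities is enough. -/
theorem IsTimeVelocity.hasTimeDeriv {n : ℤ} {p : ConformalPair} {u v : ℝ → ℂ}
    (h : IsTimeVelocity n p u v) {Φ : ConformalPair → ℂ} {d : ℂ}
    (hΦ : ∀ c : ℂ → ConformalPair, c 0 = p →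
      L2Curve (fun s => (c s).fb) (fun θ => -Complex.I * deriv p.fb θ * v θ) →
      L2Curve (fun s => (c s).ginvb) (fun θ => -Complex.I * deriv p.ginvb θ * u θ) →
      HasDerivAt (fun s => Φ (c s)) d 0) : HasTimeDeriv n Φ p d := by
  obtain ⟨H, hH, hs⟩ := h
  refine ⟨exists_isTimeCurve hH hs, fun c hc => ?_⟩
  obtain ⟨hf, hg⟩ := hc.l2Curve hH hs
  exact hΦ c hc.1.1 hf hg

theorem IsTimeVelocity.hasTimeDeriv_f {n : ℤ} {p : ConformalPair} {u v : ℝ → ℂ}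
    (h : IsTimeVelocity n p u v) {w : ℂ} (hw : ‖w‖ < 1) :
    HasTimeDeriv n (fun q => laxTilde q w) p
      (cauchyExt 1 (fun θ => -Complex.I * deriv p.fb θ * v θ) w) := by
  refine h.hasTimeDeriv fun c _ hf _ => ?_
  refine (hf.hasDerivAt_cauchyExt 1 hw).congr_of_eventuallyEq (Eventually.of_forall fun s => ?_)
  simp only [ConformalPair.fb_eq_fun]
  exact (cauchyExt_boundary (Or.inl rfl) (c s).isDiscMap_f.diffContOnCl hw).symm

theorem norm_inv_lt_one {w : ℂ} (hw : 1 < ‖w‖) : ‖w⁻¹‖ < 1 := by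
  rw [norm_inv]
  exact inv_lt_one_of_one_lt₀ hw

theorem ne_zero_of_one_lt_norm {w : ℂ} (hw : 1 < ‖w‖) : w ≠ 0 :=
  norm_pos_iff.1 (one_pos.trans hw)

theorem ConformalPair.g_eq (p : ConformalPair) {w : ℂ} (hw : w ≠ 0) :
    p.g w = (p.ginv w⁻¹)⁻¹ := by
  rw [p.ginv_of_ne (inv_ne_zero hw), inv_inv, inv_inv]

theorem ConformalPair.ginv_inv_ne_zero (p : ConformalPair) {w : ℂ} (hw : 1 < ‖w‖) :
    p.ginv w⁻¹ ≠ 0 :=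
  p.isDiscMap_ginv.ne_zero (norm_inv_lt_one hw).le (inv_ne_zero (ne_zero_of_one_lt_norm hw))

theorem IsTimeVelocity.hasTimeDeriv_g {n : ℤ} {p : ConformalPair} {u v : ℝ → ℂ}
    (h : IsTimeVelocity n p u v) {w : ℂ} (hw : 1 < ‖w‖) :
    HasTimeDeriv n (fun q => lax q w) p
      (-cauchyExt (-1) (fun θ => -Complex.I * deriv p.ginvb θ * u θ) w⁻¹ / p.ginv w⁻¹ ^ 2) := by
  refine h.hasTimeDeriv fun c hc _ hg => ?_
  have h1 : HasDerivAt (fun s => (c s).ginv w⁻¹)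
      (cauchyExt (-1) (fun θ => -Complex.I * deriv p.ginvb θ * u θ) w⁻¹) 0 := by
    refine (hg.hasDerivAt_cauchyExt (-1) (norm_inv_lt_one hw)).congr_of_eventuallyEq
      (Eventually.of_forall fun s => ?_)
    exact (cauchyExt_boundary (Or.inr rfl) (c s).isDiscMap_ginv.diffContOnCl
      (norm_inv_lt_one hw)).symm
  have h2 := h1.inv ((c 0).ginv_inv_ne_zero hw)
  rw [hc] at h2
  exact h2.congr_of_eventuallyEq (Eventually.of_forall fun s =>
    (c s).g_eq (ne_zero_of_one_lt_norm hw))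

theorem ConformalPair.mul_deriv_g (p : ConformalPair) {w : ℂ} (hw : 1 < ‖w‖) :
    w * deriv p.g w = w⁻¹ * deriv p.ginv w⁻¹ / p.ginv w⁻¹ ^ 2 := by
  have hw0 := ne_zero_of_one_lt_norm hw
  have h1 : HasDerivAt p.ginv (deriv p.ginv w⁻¹) w⁻¹ :=
    (p.isDiscMap_ginv.holo.differentiableAt
      (Metric.isOpen_ball.mem_nhds (by simpa using norm_inv_lt_one hw))).hasDerivAt
  have h2 := (h1.comp w (hasDerivAt_inv hw0)).inv (p.ginv_inv_ne_zero hw)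
  have h3 : HasDerivAt p.g _ w := h2.congr_of_eventuallyEq (by
    filter_upwards [isOpen_ne.mem_nhds hw0] with y hy using p.g_eq hy)
  rw [h3.deriv]
  have := p.ginv_inv_ne_zero hw
  simp only [Function.comp]
  field_simp

theorem LaxEquation.of_hasTimeDeriv {n : ℤ} {B L : ConformalPair → ℂ → ℂ} {p : ConformalPair}
    {w b l : ℂ} (hB : HasTimeDeriv 0 (fun q => B q w) p b)
    (hL : HasTimeDeriv 0 (fun q => L q w) p l)
    (h : HasTimeDeriv n (fun q => L q w) p (w * deriv (B p) w * l - w * b * deriv (L p) w)) :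
    LaxEquation n B L p w := by
  refine ⟨⟨b, hB⟩, ⟨l, hL⟩, ?_⟩
  rwa [poisson, hB.timeDeriv_eq, hL.timeDeriv_eq]

/-- The Lax equations for a Hamiltonian given by a polynomial part, in terms of the variations
in the direction of `t_0` and of `t_n`. -/
theorem laxEquation_of_velocity {n : ℤ} {σ : ℤ} {N : ℕ} {B : ConformalPair → ℝ → ℂ}
    {𝓑 : ConformalPair → ℂ → ℂ} {p : ConformalPair} {u v E : ℝ → ℂ}
    (h𝓑 : ∀ q, 𝓑 q = polyPart σ N (B q)) (h0 : IsTimeVelocity 0 p u v)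
    (hBE : ∀ c : ℂ → ConformalPair, c 0 = p →
      L2Curve (fun s => (c s).fb) (fun θ => -Complex.I * deriv p.fb θ * v θ) →
      L2Curve (fun s => (c s).ginvb) (fun θ => -Complex.I * deriv p.ginvb θ * u θ) →
      L2Curve (fun s => B (c s)) E)
    (hn : IsTimeVelocity n p
      (fun θ => hamDeriv σ N (B p) θ * u θ - polyPart σ N E (circ 1 θ))
      (fun θ => hamDeriv σ N (B p) θ * v θ - polyPart σ N E (circ 1 θ))) :
    (∀ w : ℂ, 1 < ‖w‖ → LaxEquation n 𝓑 lax p w) ∧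
      ∀ w : ℂ, w ≠ 0 → ‖w‖ < 1 → LaxEquation n 𝓑 laxTilde p w := by
  have hBw : ∀ w, HasTimeDeriv 0 (fun q => 𝓑 q w) p (polyPart σ N E w) := fun w => by
    refine h0.hasTimeDeriv fun c hc hf hg => ?_
    simp only [h𝓑]
    exact (hBE c hc hf hg).hasDerivAt_polyPart σ N w
  obtain ⟨H, -, hs⟩ := h0.split
  obtain ⟨H', -, hs'⟩ := hn.split
  refine ⟨fun w hw => ?_, fun w hw0 hw => ?_⟩
  · refine LaxEquation.of_hasTimeDeriv (hBw w) (h0.hasTimeDeriv_g hw) ?_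
    have hw0 := ne_zero_of_one_lt_norm hw
    have h1 := hn.hasTimeDeriv_g hw
    have h2 := p.isDiscMap_ginv.cauchyExt_correction (Or.inr rfl) hs.left hs.left_zero
      hs'.left_zero hw0 (by rw [zpow_neg_one]; exact norm_inv_lt_one hw)
    rw [zpow_neg_one] at h2
    have h3 : deriv (lax p) w = deriv p.g w := rfl
    convert h1 using 1
    rw [show (fun θ => -Complex.I * deriv p.ginvb θ * (hamDeriv σ N (B p) θ * u θ -
      polyPart σ N E (circ 1 θ))) = fun θ => -Complex.I * deriv (fun θ => p.ginv (circ (-1) θ)) θ *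
      (hamDeriv σ N (B p) θ * u θ - polyPart σ N E (circ 1 θ)) from rfl, h2, h𝓑, h3]
    have h4 := p.mul_deriv_g hw
    have h5 : ∀ θ, deriv p.ginvb θ = deriv (fun θ => p.ginv (circ (-1) θ)) θ := fun _ => rfl
    simp only [h5]
    push_cast
    linear_combination -(polyPart σ N E w) * h4
  · refine LaxEquation.of_hasTimeDeriv (hBw w) (h0.hasTimeDeriv_f hw) ?_
    have h1 := hn.hasTimeDeriv_f hw
    have h2 := p.isDiscMap_f.cauchyExt_correction (Or.inl rfl) hs.right hs.right_zero
      hs'.right_zero hw0 (by rwa [zpow_one])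
    rw [zpow_one, ← p.fb_eq_fun] at h2
    have h3 : deriv (laxTilde p) w = deriv p.f w := rfl
    convert h1 using 1
    rw [h2, h𝓑, h3]
    push_cast
    ring

/-- The same `β` is subtracted on both sides, so it drops out of the jump `H u - H v = R H`, where
`R = densityRatio p`. -/
theorem BalancedSplit.correction {p : ConformalPair} {H u v β : ℝ → ℂ}
    (h : BalancedSplit (fun θ => densityRatio p θ * 1) u v) (hH : Continuous H)
    (hβ : Continuous β) (hl : ∀ k < 0, fc (-1 * k) (fun θ => H θ * u θ - β θ) = 0)
    (hr : ∀ k < 0, fc (1 * k) (fun θ => H θ * v θ - β θ) = 0)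
    (hb : fc 0 (fun θ => H θ * u θ - β θ) + fc 0 (fun θ => H θ * v θ - β θ) = 0) :
    BalancedSplit (fun θ => densityRatio p θ * H θ) (fun θ => H θ * u θ - β θ)
      (fun θ => H θ * v θ - β θ) := by
  refine ⟨(memLp_continuous_mul h.left hH).sub (memLp_of_continuous hβ 2),
    (memLp_continuous_mul h.right hH).sub (memLp_of_continuous hβ 2), hl, hr, hb, ?_⟩
  filter_upwards [h.sub_eq] with θ hθ
  linear_combination H θ * hθ

/-- The derivative of a power of a curve in the plane and its Fourier coefficients. -/
theorem fc_deriv_zpow {b : ℝ → ℂ} (hb : Differentiable ℝ b) (hbc : Continuous (deriv b))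
    (hp : Function.Periodic b (2 * Real.pi)) (h0 : ∀ θ, b θ ≠ 0) (m : ℤ) :
    Continuous (fun θ => -Complex.I * (m * b θ ^ (m - 1) * deriv b θ)) ∧
      ∀ k, fc k (fun θ => -Complex.I * (m * b θ ^ (m - 1) * deriv b θ)) =
        k * fc k (fun θ => b θ ^ m) := by
  have hc : Continuous fun θ => m * b θ ^ (m - 1) * deriv b θ :=
    (continuous_const.mul (hb.continuous.zpow₀ _ fun θ => Or.inl (h0 θ))).mul hbc
  refine ⟨continuous_const.mul hc, fun k => ?_⟩
  rw [fc_const_mul, fc_deriv (B := fun θ => b θ ^ m) (fun θ =>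
    HasDerivAt.comp (h₂ := fun x : ℂ => x ^ m) θ (hasDerivAt_zpow m _ (Or.inl (h0 θ)))
      (hb θ).hasDerivAt) hc (by simp only [hp.eq])]
  linear_combination -(k * fc k (fun θ => b θ ^ m)) * Complex.I_mul_I

theorem laxEquation_laxB (p : ConformalPair) {n : ℕ} (hn : 1 ≤ n) :
    (∀ w : ℂ, 1 < ‖w‖ → LaxEquation n (laxB n) lax p w) ∧
      ∀ w : ℂ, w ≠ 0 → ‖w‖ < 1 → LaxEquation n (laxB n) laxTilde p w := by
  obtain ⟨u, v, hs⟩ := exists_balancedSplit (R := fun θ => densityRatio p θ * 1)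
    (memLp_of_continuous ((continuous_densityRatio p).mul continuous_const) 2)
  obtain ⟨hDc, hD⟩ := fc_deriv_zpow p.differentiable_gb p.continuous_deriv_gb p.periodic_gb
    p.gb_ne_zero n
  set D := fun θ => -Complex.I * (((n : ℤ) : ℂ) * p.gb θ ^ ((n : ℤ) - 1) * deriv p.gb θ) with hDdef
  have hB : ∀ k : ℤ, n < k → fc (1 * k) (fun θ => p.gb θ ^ (n : ℤ)) = 0 := fun k hk => by
    have h := p.isDiscMap_ginv.fc_inv_pow_eq_zero (Or.inr rfl) (n := n) (k := -k) (by omega)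
    rw [neg_mul_neg] at h
    rw [← h]
    congr 1
    funext θ
    rw [p.ginv_circ, inv_pow, inv_inv, zpow_natCast]
  obtain ⟨c1, c2, c3⟩ := balanced_correction (Or.inl rfl) hDc hD hB hs.left hs.right hs.left_zero
    hs.right_zero
  -- Here `D` is `w ∂_w g^n` on the circle, and `D u` is the velocity of `g^n` along the direction
  -- `t_0`; thus `polyPart` of `E` is `∂𝓑_n/∂t_0`.
  refine laxEquation_of_velocity (laxB_eq n) (u := u) (v := v) (E := fun θ => D θ * u θ)
    ⟨_, isTimeDensity_one p, hs⟩ (fun c hc _ hg => ?_) ⟨_, ?_, hs.correction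
      (continuous_hamDeriv _ _ _) (continuous_polyPart_circ _ _ _) c1 c2 c3⟩
  · subst hc
    refine (hg.gb.zpow (fun s θ => (c s).gb_ne_zero θ) n).congr (fun _ _ => rfl) fun θ => ?_
    simp only [hDdef]
    rw [(c 0).deriv_gb_eq]
    ring
  · have := isTimeDensity_hamDeriv hn p
    simpa only [zpow_natCast] using this

theorem laxEquation_laxBTilde (p : ConformalPair) {n : ℕ} (hn : 1 ≤ n) :
    (∀ w : ℂ, 1 < ‖w‖ → LaxEquation (-(n : ℤ)) (laxBTilde n) lax p w) ∧
      ∀ w : ℂ, w ≠ 0 → ‖w‖ < 1 → LaxEquation (-(n : ℤ)) (laxBTilde n) laxTilde p w := by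
  obtain ⟨u, v, hs⟩ := exists_balancedSplit (R := fun θ => densityRatio p θ * 1)
    (memLp_of_continuous ((continuous_densityRatio p).mul continuous_const) 2)
  obtain ⟨hDc, hD⟩ := fc_deriv_zpow p.differentiable_fb p.continuous_deriv_fb p.periodic_fb
    p.fb_ne_zero (-n)
  set D := fun θ => -Complex.I * (((-(n : ℤ) : ℤ) : ℂ) * p.fb θ ^ (-(n : ℤ) - 1) * deriv p.fb θ)
    with hDdef
  have hB : ∀ k : ℤ, n < k → fc (-1 * k) (fun θ => p.fb θ ^ (-(n : ℤ))) = 0 := fun k hk => by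
    have h := p.isDiscMap_f.fc_inv_pow_eq_zero (Or.inl rfl) (n := n) (k := -k) (by omega)
    rw [show -1 * k = 1 * -k by ring, ← h]
    congr 1
    funext θ
    rw [p.fb_eq, zpow_neg, zpow_natCast]
  -- The mirror case `σ = -1`: the Hamiltonian comes from `f`, so `v` and `u` exchange roles.
  obtain ⟨c1, c2, c3⟩ := balanced_correction (Or.inr rfl) hDc hD hB hs.right hs.left
    (by simpa only [neg_neg] using hs.right_zero) hs.left_zero
  rw [neg_neg] at c1
  refine laxEquation_of_velocity (laxBTilde_eq n) (u := u) (v := v) (E := fun θ => D θ * v θ)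
    ⟨_, isTimeDensity_one p, hs⟩ (fun c hc hf _ => ?_) ⟨_, ?_, hs.correction
      (continuous_hamDeriv _ _ _) (continuous_polyPart_circ _ _ _) c2 c1 ((add_comm _ _).trans c3)⟩
  · subst hc
    refine (hf.zpow (fun s θ => (c s).fb_ne_zero θ) (-n)).congr (fun _ _ => rfl) fun θ => ?_
    simp only [hDdef]
    ring
  · have := isTimeDensity_hamDeriv_neg hn p
    simpa only [zpow_neg, zpow_natCast] using this

end DToda

end

theorem theorem3p9 (p : DToda.ConformalPair) (n : ℕ) (hn : 1 ≤ n) :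
    (∀ w : ℂ, 1 < ‖w‖ →
      DToda.LaxEquation (n : ℤ) (DToda.laxB n) DToda.lax p w ∧
      DToda.LaxEquation (-(n : ℤ)) (DToda.laxBTilde n) DToda.lax p w) ∧
    (∀ w : ℂ, w ≠ 0 → ‖w‖ < 1 →
      DToda.LaxEquation (n : ℤ) (DToda.laxB n) DToda.laxTilde p w ∧
      DToda.LaxEquation (-(n : ℤ)) (DToda.laxBTilde n) DToda.laxTilde p w) :=
  ⟨fun w hw => ⟨(DToda.laxEquation_laxB p hn).1 w hw, (DToda.laxEquation_laxBTilde p hn).1 w hw⟩,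
    fun w h0 hw => ⟨(DToda.laxEquation_laxB p hn).2 w h0 hw,
      (DToda.laxEquation_laxBTilde p hn).2 w h0 hw⟩⟩
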